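/- Let $K$ be an imaginary quadratic field with ring of integers $\mathbb{Z}_K$ and discriminant $D<0$, and suppose that $D$ is odd. Let $p$ be a prime number that is inert in $K$, and let $B$ be the quaternion algebra over $\mathbb{Q}$ that is ramified exactly at $p$ and $\infty$, with canonical involution $x\mapsto x^*$ and the positive-definite $\mathbb{Q}$-valued bilinear form $(x,y)=xy^*+yx^*$. Let $J\subset\mathbb{Z}_K$ be a non-zero ideal whose norm $N(J)=[\mathbb{Z}_K:J]$ is prime to $D$. A lattice is a free $\mathbb{Z}$-module of finite rank with a non-degenerate symmetric $\mathbb{Z}$-valued bilinear form; its discriminant is the determinant of a Gram matrix. Two lattices are in the same genus if they become isomorphic over $\mathbb{Z}_l$ for every prime $l$ and over $\mathbb{R}$; a genus is the set of isomorphism classes of all lattices in the same genus as a given one. For a maximal order $R$ of $B$ and an embedding of rings $\rho:\mathbb{Z}_K\hookrightarrow R$, let $R\rho(J)$ be the left ideal of $R$ generated by $\rho(J)$, and let $$(J\hookrightarrow R\rho(J))^{\perp}=\{x\in R\rho(J)\;:\;(x,\rho(y))=0\ \text{ for all } y\in J\},$$ regarded as a lattice with the restriction of the form $(\ ,\ )$.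 Then, for every such pair $(R,\rho)$, the lattice $(J\hookrightarrow R\rho(J))^{\perp}$ is even, positive-definite, of rank $2$ and of discriminant $-p^2N(J)^2D=p^2N(J)^2|D|$, and the set of isomorphism classes $$\{[(J\hookrightarrow R\rho(J))^{\perp}]\;:\;(R,\rho)\}$$ of these lattices, for all such pairs $(R,\rho)$, is exactly one genus. -/

import Mathlib

open scoped Quaternion NumberField TensorProduct

/-! ### Integral lattices, isomorphism classes and genera -/

/-- A lattice: a free `ℤ`-module of finite rank with a non-degenerate symmetric bilinear form
with values in `ℤ`. -/
structure IntLattice where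
  carrier : Type
  [addCommGroup : AddCommGroup carrier]
  [free : Module.Free ℤ carrier]
  [finite : Module.Finite ℤ carrier]
  form : LinearMap.BilinForm ℤ carrier
  symm : ∀ x y, form x y = form y x
  nondeg : ∀ x, (∀ y, form x y = 0) → x = 0

attribute [instance] IntLattice.addCommGroup IntLattice.free IntLattice.finite

namespace IntLattice

/-- Isomorphism of lattices: a bijective isometry. -/
def Iso (M N : IntLattice) : Prop :=
  ∃ e : M.carrier ≃ₗ[ℤ] N.carrier, ∀ x y, N.form (e x) (e y) = M.form x y

/-- `M ⊗ A` and `N ⊗ A` are isomorphic as `A`-lattices, for the bilinear forms extended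
`A`-linearly. -/
def IsoOver (A : Type) [CommRing A] (M N : IntLattice) : Prop :=
  ∃ e : (A ⊗[ℤ] M.carrier) ≃ₗ[A] (A ⊗[ℤ] N.carrier),
    ∀ x y, LinearMap.BilinForm.baseChange A N.form (e x) (e y)
      = LinearMap.BilinForm.baseChange A M.form x y

/-- Two lattices are in the same genus if they become isomorphic over `ℤ_l` for every prime `l`,
and over `ℝ`. -/
def SameGenus (M N : IntLattice) : Prop :=
  (∀ (l : ℕ) [Fact l.Prime], IsoOver ℤ_[l] M N) ∧ IsoOver ℝ M N

/-- The rank of a lattice. -/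
noncomputable def rank (M : IntLattice) : ℕ := Module.finrank ℤ M.carrier

/-- The discriminant of a lattice: the determinant of a Gram matrix. -/
noncomputable def disc (M : IntLattice) : ℤ :=
  (LinearMap.BilinForm.toMatrix (Module.Free.chooseBasis ℤ M.carrier) M.form).det

/-- A lattice is even if `(x, x)` is even for all `x`. -/
def IsEven (M : IntLattice) : Prop := ∀ x, Even (M.form x x)

/-- A lattice is positive-definite if `(x, x) > 0` for all `x ≠ 0`. -/
def IsPosDef (M : IntLattice) : Prop := ∀ x, x ≠ 0 → 0 < M.form x x

theorem Iso.refl (M : IntLattice) : Iso M M := ⟨LinearEquiv.refl ℤ _, fun _ _ => rfl⟩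

theorem Iso.symm {M N : IntLattice} : Iso M N → Iso N M := by
  rintro ⟨e, he⟩
  refine ⟨e.symm, fun x y => ?_⟩
  rw [← he, e.apply_symm_apply, e.apply_symm_apply]

theorem Iso.trans {M N P : IntLattice} : Iso M N → Iso N P → Iso M P := by
  rintro ⟨e, he⟩ ⟨f, hf⟩
  exact ⟨e.trans f, fun x y => by rw [LinearEquiv.trans_apply, LinearEquiv.trans_apply, hf, he]⟩

instance setoid : Setoid IntLattice := ⟨Iso, Iso.refl, Iso.symm, Iso.trans⟩

/-- The discriminant is the Gram determinant in any basis. -/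
theorem disc_eq (M : IntLattice) {ι : Type*} [Fintype ι] [DecidableEq ι]
    (b : Module.Basis ι ℤ M.carrier) :
    M.disc = (LinearMap.BilinForm.toMatrix b M.form).det := by
  classical
  set c := Module.Free.chooseBasis ℤ M.carrier with hc
  let e := c.indexEquiv b
  set c' := c.reindex e with hc'
  have h1 : M.disc = (LinearMap.BilinForm.toMatrix c' M.form).det := by
    have : LinearMap.BilinForm.toMatrix c' M.form
        = (LinearMap.BilinForm.toMatrix c M.form).submatrix e.symm e.symm := by
      ext i j
      simp [hc', LinearMap.BilinForm.toMatrix_apply]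
    rw [this, Matrix.det_submatrix_equiv_self]
    rfl
  have h2 := LinearMap.BilinForm.toMatrix_mul_basis_toMatrix (b := b) (c := c') M.form
  have h3 : (b.toMatrix c').det * (b.toMatrix c').det = 1 := by
    have h4 : b.toMatrix c' * c'.toMatrix b = 1 := Module.Basis.toMatrix_mul_toMatrix_flip b c'
    have h5 := congrArg Matrix.det h4
    rw [Matrix.det_mul, Matrix.det_one] at h5
    rcases Int.eq_one_or_neg_one_of_mul_eq_one h5 with h | h <;> simp [h]
  rw [h1, ← h2, Matrix.det_mul, Matrix.det_mul, Matrix.det_transpose, mul_right_comm, h3, one_mul]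

end IntLattice

/-- Isomorphism classes of lattices. -/
def LatticeClass : Type 1 := Quotient IntLattice.setoid

/-- The isomorphism class of a lattice. -/
def IntLattice.cls (M : IntLattice) : LatticeClass := Quotient.mk IntLattice.setoid M

/-- The set of isomorphism classes of lattices of rank `r` with discriminant `d`. -/
def latticeClasses (r : ℕ) (d : ℤ) : Set LatticeClass :=
  {c | ∃ M : IntLattice, c = M.cls ∧ M.rank = r ∧ M.disc = d}

/-- The set of isomorphism classes of even positive-definite lattices of rank `r` with
discriminant `d`. -/
def evenPosLatticeClasses (r : ℕ) (d : ℤ) : Set LatticeClass :=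
  {c | ∃ M : IntLattice, c = M.cls ∧ M.rank = r ∧ M.disc = d ∧ M.IsEven ∧ M.IsPosDef}

/-- A set of isomorphism classes is a genus if it consists of the classes of all lattices in the
same genus as some lattice. -/
def IsGenus (G : Set LatticeClass) : Prop :=
  ∃ M : IntLattice, G = {c | ∃ N : IntLattice, c = N.cls ∧ IntLattice.SameGenus M N}

/-! ### Quaternion algebras over `ℚ`

`ℍ[F,a,b]` is the quaternion algebra over `F` with `i² = a`, `j² = b`, `ij = -ji`, with canonical
involution `star`. -/

/-- The quaternion algebra `ℍ[ℚ,a,b]` is ramified at a place with completion `F` if its base change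
`ℍ[F,a,b]` is a division algebra. -/
def RamifiedAt (F : Type) [Field F] (a b : ℚ) : Prop :=
  ∀ x : ℍ[F,(a : F),(b : F)], x ≠ 0 → IsUnit x

/-- `ℍ[ℚ,a,b]` is a quaternion algebra ramified exactly at the prime `p` and at `∞`. -/
structure RamifiedExactlyAt (p : ℕ) (a b : ℚ) : Prop where
  left_ne_zero : a ≠ 0
  right_ne_zero : b ≠ 0
  infinite : RamifiedAt ℝ a b
  finite : ∀ (l : ℕ) [Fact l.Prime], RamifiedAt ℚ_[l] a b ↔ l = p

section Orders

variable {a b : ℚ}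

/-- The bilinear form `(x, y) = x y* + y x*` on a quaternion algebra, as a rational number. -/
def quatForm (x y : ℍ[ℚ,a,b]) : ℚ := (x * star y + y * star x).re

theorem coe_quatForm (x y : ℍ[ℚ,a,b]) :
    algebraMap ℚ ℍ[ℚ,a,b] (quatForm x y) = x * star y + y * star x := by
  ext <;> simp [quatForm] <;> ring

/-- An order: a subring that is finitely generated over `ℤ` and spans the algebra over `ℚ`. -/
def IsOrder (O : Subring ℍ[ℚ,a,b]) : Prop :=
  Module.Finite ℤ O ∧ Submodule.span ℚ (O : Set ℍ[ℚ,a,b]) = ⊤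

/-- A maximal order: an order maximal among the orders with respect to inclusion. -/
def IsMaximalOrder (O : Subring ℍ[ℚ,a,b]) : Prop := Maximal IsOrder O

/-- Elements of an order have integral reduced trace. -/
theorem IsOrder.exists_trace {O : Subring ℍ[ℚ,a,b]} (hO : IsOrder O) {x : ℍ[ℚ,a,b]}
    (hx : x ∈ O) : ∃ t : ℤ, 2 * x.re = t := by
  have := hO.1
  have hint : IsIntegral ℤ (⟨x, hx⟩ : O) := Algebra.IsIntegral.isIntegral _
  have hint' : IsIntegral ℤ x := hint.map O.subtype.toIntAlgHom
  obtain ⟨f, hf, hfx⟩ := hint'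
  rw [← Polynomial.aeval_def] at hfx
  have hfx' : Polynomial.aeval x (f.map (algebraMap ℤ ℚ)) = 0 := by
    rw [Polynomial.aeval_map_algebraMap, hfx]
  by_cases him : x.imI = 0 ∧ x.imJ = 0 ∧ x.imK = 0
  · have hxr : x = algebraMap ℚ ℍ[ℚ,a,b] x.re := by
      ext <;> simp [him]
    have : IsIntegral ℤ x.re := by
      refine ⟨f, hf, ?_⟩
      rw [hxr, Polynomial.aeval_algebraMap_apply] at hfx'
      have := (algebraMap ℚ ℍ[ℚ,a,b]).injective (hfx'.trans (map_zero _).symm)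
      rwa [Polynomial.aeval_map_algebraMap, Polynomial.aeval_def] at this
    obtain ⟨z, hz⟩ := IsIntegrallyClosed.isIntegral_iff.mp this
    exact ⟨2 * z, by rw [← hz]; simp⟩
  · set n : ℚ := x.re ^ 2 - a * x.imI ^ 2 - b * x.imJ ^ 2 + a * b * x.imK ^ 2 with hn
    set q : Polynomial ℚ := Polynomial.X ^ 2 + Polynomial.C (-(2 * x.re)) * Polynomial.X
      + Polynomial.C n with hq
    have hqm : q.Monic := by rw [hq]; monicity!
    have hqd : q.natDegree = 2 := by rw [hq]; compute_degree!
    have hqx : Polynomial.aeval x q = 0 := by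
      rw [hq]
      simp only [map_add, map_mul, map_pow, Polynomial.aeval_X, Polynomial.aeval_C]
      rw [sq]
      have key : ∀ s m : ℚ, s = -(2 * x.re) → m = n →
          x * x + algebraMap ℚ ℍ[ℚ,a,b] s * x + algebraMap ℚ ℍ[ℚ,a,b] m = 0 := by
        intro s m hs hm
        ext <;> simp <;> rw [hs] <;> try rw [hm, hn]
        all_goals ring
      exact key _ _ rfl rfl
    set r := f.map (algebraMap ℤ ℚ) %ₘ q with hr
    have hrx : Polynomial.aeval x r = 0 := by
      have h := congrArg (Polynomial.aeval x) (Polynomial.modByMonic_add_div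
        (f.map (algebraMap ℤ ℚ)) q)
      rw [map_add, map_mul, hqx, zero_mul, add_zero, hfx'] at h
      exact h
    have hrd : r.natDegree ≤ 1 := by
      have hlt : r.natDegree < q.natDegree := Polynomial.natDegree_modByMonic_lt _ hqm
        (by intro h; rw [h] at hqd; simp at hqd)
      rw [hqd] at hlt
      exact Nat.le_of_lt_succ hlt
    have hr0 : r = 0 := by
      rw [Polynomial.eq_X_add_C_of_natDegree_le_one hrd] at hrx ⊢
      simp only [map_add, map_mul, Polynomial.aeval_X, Polynomial.aeval_C] at hrx
      have h0 := congrArg QuaternionAlgebra.re hrx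
      have h1 := congrArg QuaternionAlgebra.imI hrx
      have h2 := congrArg QuaternionAlgebra.imJ hrx
      have h3 := congrArg QuaternionAlgebra.imK hrx
      simp at h0 h1 h2 h3
      have hc : r.coeff 1 = 0 := by
        by_contra hc
        exact him ⟨h1.resolve_left hc, h2.resolve_left hc, h3.resolve_left hc⟩
      rw [hc] at h0 ⊢
      simp at h0
      simp [h0]
    have hdvd : q ∣ f.map (algebraMap ℤ ℚ) :=
      (Polynomial.modByMonic_eq_zero_iff_dvd hqm).mp hr0
    obtain ⟨g, hg⟩ := IsIntegrallyClosed.eq_map_mul_C_of_dvd ℚ hf hdvd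
    rw [hqm.leadingCoeff, Polynomial.C_1, mul_one] at hg
    have hc := congrArg (fun s => Polynomial.coeff s 1) hg
    simp [hq, Polynomial.coeff_C] at hc
    exact ⟨-g.coeff 1, by push_cast; linarith⟩

theorem IsOrder.star_mem {O : Subring ℍ[ℚ,a,b]} (hO : IsOrder O) {x : ℍ[ℚ,a,b]}
    (hx : x ∈ O) : star x ∈ O := by
  obtain ⟨t, ht⟩ := hO.exists_trace hx
  have : star x = (t : ℍ[ℚ,a,b]) - x := by
    ext <;> simp [← ht]
    ring
  rw [this]
  exact O.sub_mem (intCast_mem O t) hx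

/-- The form takes integral values on an order. -/
theorem IsOrder.num_quatForm {O : Subring ℍ[ℚ,a,b]} (hO : IsOrder O) (x y : O) :
    ((quatForm (x : ℍ[ℚ,a,b]) y).num : ℚ) = quatForm (x : ℍ[ℚ,a,b]) y := by
  obtain ⟨t, ht⟩ := hO.exists_trace (O.mul_mem x.2 (hO.star_mem y.2))
  have : quatForm (x : ℍ[ℚ,a,b]) y = t := by
    rw [← ht, quatForm]
    simp
    ring
  rw [this, Rat.num_intCast]

/-- The `ℤ`-valued bilinear form `(x, y) = x y* + y x*` on an order. -/
def orderForm (O : Subring ℍ[ℚ,a,b]) (hO : IsOrder O) : LinearMap.BilinForm ℤ O :=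
  LinearMap.mk₂ ℤ (fun x y => (quatForm (x : ℍ[ℚ,a,b]) y).num)
    (fun x x' y => by
      rw [← Int.cast_inj (α := ℚ), Int.cast_add, hO.num_quatForm, hO.num_quatForm,
        hO.num_quatForm]
      simp only [quatForm, Subring.coe_add, add_mul, mul_add, star_add, QuaternionAlgebra.re_add]
      ring)
    (fun c x y => by
      rw [← Int.cast_inj (α := ℚ), smul_eq_mul, Int.cast_mul, hO.num_quatForm, hO.num_quatForm]
      simp [quatForm]
      ring)
    (fun x y y' => by
      rw [← Int.cast_inj (α := ℚ), Int.cast_add, hO.num_quatForm, hO.num_quatForm,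
        hO.num_quatForm]
      simp only [quatForm, Subring.coe_add, add_mul, mul_add, star_add, QuaternionAlgebra.re_add]
      ring)
    (fun c x y => by
      rw [← Int.cast_inj (α := ℚ), smul_eq_mul, Int.cast_mul, hO.num_quatForm, hO.num_quatForm]
      simp [quatForm]
      ring)

theorem coe_orderForm {O : Subring ℍ[ℚ,a,b]} (hO : IsOrder O) (x y : O) :
    ((orderForm O hO x y : ℤ) : ℚ) = quatForm (x : ℍ[ℚ,a,b]) y := hO.num_quatForm x y

/-- A real quaternion algebra that is a division algebra has negative parameters. -/
theorem RamifiedAt.neg (h : RamifiedAt ℝ a b) : a < 0 ∧ b < 0 := by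
  constructor
  · by_contra! ha
    have ha' : (0 : ℝ) ≤ a := by exact_mod_cast ha
    have h1 := h ⟨√a, 1, 0, 0⟩ (fun h => by simpa using congrArg QuaternionAlgebra.imI h)
    have h2 : (⟨√a, 1, 0, 0⟩ : ℍ[ℝ,(a : ℝ),(b : ℝ)]) * ⟨√a, -1, 0, 0⟩ = 0 := by
      ext <;> simp [Real.mul_self_sqrt ha']
    have h3 := (h1.mul_right_eq_zero).mp h2
    simpa using congrArg QuaternionAlgebra.imI h3
  · by_contra! hb
    have hb' : (0 : ℝ) ≤ b := by exact_mod_cast hb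
    have h1 := h ⟨√b, 0, 1, 0⟩ (fun h => by simpa using congrArg QuaternionAlgebra.imJ h)
    have h2 : (⟨√b, 0, 1, 0⟩ : ℍ[ℝ,(a : ℝ),(b : ℝ)]) * ⟨√b, 0, -1, 0⟩ = 0 := by
      ext <;> simp [Real.mul_self_sqrt hb']
    have h3 := (h1.mul_right_eq_zero).mp h2
    simpa using congrArg QuaternionAlgebra.imJ h3

theorem quatForm_self_pos (h : RamifiedAt ℝ a b) {x : ℍ[ℚ,a,b]} (hx : x ≠ 0) :
    0 < quatForm x x := by
  obtain ⟨ha, hb⟩ := h.neg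
  have hab := mul_pos_of_neg_of_neg ha hb
  have e : quatForm x x = 2 * (x.re ^ 2 + (-a) * x.imI ^ 2 + (-b) * x.imJ ^ 2
      + (a * b) * x.imK ^ 2) := by
    simp [quatForm]
    ring
  rw [e]
  have ha' : 0 < -a := by linarith
  have hb' : 0 < -b := by linarith
  by_contra! hle
  apply hx
  have h0 := sq_nonneg x.re
  have h1 := mul_nonneg ha'.le (sq_nonneg x.imI)
  have h2 := mul_nonneg hb'.le (sq_nonneg x.imJ)
  have h3 := mul_nonneg hab.le (sq_nonneg x.imK)
  have e0 : x.re ^ 2 = 0 := by linarith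
  have e1 : (-a) * x.imI ^ 2 = 0 := by linarith
  have e2 : (-b) * x.imJ ^ 2 = 0 := by linarith
  have e3 : (a * b) * x.imK ^ 2 = 0 := by linarith
  ext
  · simpa using e0
  · simpa [ha'.ne', ha.ne] using e1
  · simpa [hb'.ne', hb.ne] using e2
  · simpa [ha.ne, hb.ne] using e3

theorem torsionFree_subring (O : Subring ℍ[ℚ,a,b]) : Module.IsTorsionFree ℤ O := by
  refine Module.IsTorsionFree.of_smul_eq_zero fun n x hx => ?_
  by_cases hn : n = 0
  · exact Or.inl hn
  · have hn' : (n : ℚ) ≠ 0 := by exact_mod_cast hn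
    right
    have h : (n : ℤ) • (x : ℍ[ℚ,a,b]) = 0 := by
      have h' := congrArg O.subtype hx
      rwa [map_zsmul, map_zero] at h'
    rw [← Int.cast_smul_eq_zsmul ℚ] at h
    exact Subtype.ext ((smul_eq_zero.mp h).resolve_left hn')

/-- A `ℤ`-submodule `L` of an order in a definite quaternion algebra, with the restriction of the
form `(x, y) = x y* + y x*`, as a lattice. -/
noncomputable def submoduleLattice (h : RamifiedAt ℝ a b) (O : Subring ℍ[ℚ,a,b]) (hO : IsOrder O)
    (L : Submodule ℤ O) : IntLattice :=
  haveI : Module.Finite ℤ O := hO.1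
  haveI : Module.IsTorsionFree ℤ O := torsionFree_subring O
  { carrier := L
    free := inferInstance
    finite := inferInstance
    form := (orderForm O hO).restrict L
    symm := fun x y => by
      rw [← Int.cast_inj (α := ℚ), LinearMap.BilinForm.restrict_apply, LinearMap.BilinForm.restrict_apply,
        LinearMap.domRestrict_apply, LinearMap.domRestrict_apply, coe_orderForm, coe_orderForm,
        quatForm, quatForm, add_comm]
    nondeg := fun x hx => by
      by_contra hne
      have hx' : ((x : O) : ℍ[ℚ,a,b]) ≠ 0 := by
        intro h0
        exact hne (Subtype.ext (Subtype.ext h0))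
      have hpos := quatForm_self_pos h hx'
      rw [← coe_orderForm hO] at hpos
      have hz : orderForm O hO (x : O) (x : O) = 0 := hx x
      rw [hz] at hpos
      simp at hpos }

end Orders

/-! ### Maximal orders with an embedding of the ring of integers of `K` -/

/-- A maximal order `R` of the quaternion algebra `ℍ[ℚ,a,b]` with an embedding
`ρ : 𝓞 K → R` of rings. -/
structure EmbeddedMaximalOrder (K : Type*) [Field K] (a b : ℚ) where
  R : Subring ℍ[ℚ,a,b]
  isMaximalOrder : IsMaximalOrder R
  ρ : 𝓞 K →+* R
  injective : Function.Injective ρ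

namespace EmbeddedMaximalOrder

variable {K : Type*} [Field K] {a b : ℚ}

theorem isOrder (P : EmbeddedMaximalOrder K a b) : IsOrder P.R := P.isMaximalOrder.prop

/-- The left ideal `Rρ(J)` of `R` generated by `ρ(J)`. -/
def leftIdeal (P : EmbeddedMaximalOrder K a b) (J : Ideal (𝓞 K)) : Ideal P.R :=
  Ideal.span (P.ρ '' (J : Set (𝓞 K)))

/-- The orthogonal complement of `ρ(J)` in `Rρ(J)`, as a `ℤ`-submodule of `R`. -/
def perp (P : EmbeddedMaximalOrder K a b) (J : Ideal (𝓞 K)) : Submodule ℤ P.R where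
  carrier := {x | x ∈ P.leftIdeal J ∧ ∀ j ∈ J, orderForm P.R P.isOrder x (P.ρ j) = 0}
  zero_mem' := ⟨zero_mem _, fun j _ => by simp⟩
  add_mem' := fun hx hy => ⟨add_mem hx.1 hy.1, fun j hj => by simp [hx.2 j hj, hy.2 j hj]⟩
  smul_mem' := fun c _ hx => ⟨zsmul_mem hx.1 c, fun j hj => by
    rw [LinearMap.map_smul₂, hx.2 j hj, smul_zero]⟩

/-- The lattice `(J ↪ Rρ(J))^⊥`, with the form `(x, y) = x y* + y x*`. -/
noncomputable def perpLattice (h : RamifiedAt ℝ a b) (P : EmbeddedMaximalOrder K a b)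
    (J : Ideal (𝓞 K)) : IntLattice :=
  submoduleLattice h P.R P.isOrder (P.perp J)

end EmbeddedMaximalOrder

/-! ### Tame Hilbert symbols -/

section HilbertSymbol

variable {l : ℕ} [Fact l.Prime]

/-! Write `K = ℚ(√-d)` with `d` squarefree and `d ≡ 3 mod 4`. An embedding of `K` in the quaternion
algebra `B` yields a decomposition `B = K + K j` with `j x = x̄ j` and `j² = c < 0` (`QuatModel`),
for which the form is the orthogonal sum of `Tr(α ᾱ')` and `-c Tr(β β̄')`. For an order `R`
containing the integers of `K`, let `I` be the fractional ideal of all `β` with `βj ∈ R`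
(`coeffIdeal`). The orthogonal complement of `J` in `RJ` is then `(I J̄) j` (`mem_perp_iff`). So
each lattice in question is a fractional ideal `H = I J̄` with the form `q Tr(x ȳ)`, `q = -c`
(`IsPresented`), and such a lattice has discriminant `(q N(H))² d`.

The decisive computation is `q N(I) = p` for maximal `R` (`absNorm_coeffIdeal`). The number `t = q
N(I)` is a positive integer. If the norm of a proper ideal `P` containing a prime number divided
`t`, then `R + I P⁻¹ j` would be a larger order; hence `t` is squarefree with only inert prime
factors. At an inert prime, `t` and `c` have valuations of the same parity, odd exactly when `B` is
ramified there, so `t = p`. Conversely, if `q N(I) = p`, then `𝓞 + I j` is an order, and in a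
maximal order above it the coefficient ideal has the same norm and cannot have grown. For a fixed
`q`, every fractional ideal of norm `p N(J) / q` therefore occurs
(`exists_perpLattice_isPresented`).

It remains to see that these ideals make up one genus. Two embeddings have constants `c` that differ
by a norm from `K`, so rescaling reduces everything to a single `q`. The quotient of two ideals of
equal norm has the form `A / Ā` (`exists_conjIdeal_mul_eq`) and is generated near each prime by an
element of norm one, which gives the local isometries (`IsPresented.sameGenus`). In the other
direction, a lattice in the genus has a Gram matrix with entries `2kA, kB, 2kC`, where `k = p N(J)`
and `4AC - B² = d`. By Gauss's correspondence it is a fractional ideal up to scaling, and the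
scaling can be matched because a certain number is a local norm, hence a global one
(`IsPresented.of_sameGenus`).

All global existence statements come from Legendre's theorem on conics (`legendre`). It is proved
with a sign condition and symbols at the odd primes alone, so the wild symbol at 2 is never needed.
Together with Dirichlet's theorem on primes in progressions it also shows that `K` embeds in `B`
(`exists_representation`), so that the set of lattices is not empty. -/

theorem Padic.exists_eq_unit_mul_zpow {x : ℚ_[l]} (hx : x ≠ 0) :
    ∃ u : ℤ_[l], ‖u‖ = 1 ∧ x = u * (l : ℚ_[l]) ^ x.valuation := by
  have hl : (l : ℚ_[l]) ≠ 0 := by exact_mod_cast (Fact.out : l.Prime).ne_zero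
  have hn : ‖x * (l : ℚ_[l]) ^ (-x.valuation)‖ = 1 := by
    have hl' : (l : ℝ) ≠ 0 := by exact_mod_cast (Fact.out : l.Prime).ne_zero
    rw [norm_mul, Padic.norm_eq_zpow_neg_valuation hx, norm_zpow, Padic.norm_p, inv_zpow,
      zpow_neg, inv_inv, inv_mul_cancel₀ (zpow_ne_zero _ hl')]
  refine ⟨⟨_, hn.le⟩, hn, ?_⟩
  simp only
  rw [mul_assoc, ← zpow_add₀ hl, neg_add_cancel, zpow_zero, mul_one]

/-- The residue in `ZMod l` of the unit part of an `l`-adic number. -/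
noncomputable def unitResidue (x : ℚ_[l]) : ZMod l :=
  if h : ‖x * (l : ℚ_[l]) ^ (-x.valuation)‖ ≤ 1 then PadicInt.toZMod ⟨_, h⟩ else 0

theorem unitResidue_eq {x : ℚ_[l]} {u : ℤ_[l]} (h : x = u * (l : ℚ_[l]) ^ x.valuation) :
    unitResidue x = PadicInt.toZMod u := by
  have hl : (l : ℚ_[l]) ≠ 0 := by exact_mod_cast (Fact.out : l.Prime).ne_zero
  have hu : x * (l : ℚ_[l]) ^ (-x.valuation) = u := by
    rw [zpow_neg, ← div_eq_mul_inv, div_eq_iff (zpow_ne_zero _ hl)]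
    exact h
  unfold unitResidue
  rw [dif_pos (by rw [hu]; exact u.2)]
  congr 1
  exact Subtype.ext hu

theorem PadicInt.toZMod_eq_zero_iff_norm_lt_one (u : ℤ_[l]) : PadicInt.toZMod u = 0 ↔ ‖u‖ < 1 := by
  rw [← RingHom.mem_ker, PadicInt.ker_toZMod, IsLocalRing.mem_maximalIdeal, PadicInt.mem_nonunits]

theorem unitResidue_ne_zero {x : ℚ_[l]} (hx : x ≠ 0) : unitResidue x ≠ 0 := by
  obtain ⟨u, hu, h⟩ := Padic.exists_eq_unit_mul_zpow hx
  rw [unitResidue_eq h, ne_eq, PadicInt.toZMod_eq_zero_iff_norm_lt_one, hu]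
  exact lt_irrefl _

theorem unitResidue_mul {x y : ℚ_[l]} (hx : x ≠ 0) (hy : y ≠ 0) :
    unitResidue (x * y) = unitResidue x * unitResidue y := by
  have hl : (l : ℚ_[l]) ≠ 0 := by exact_mod_cast (Fact.out : l.Prime).ne_zero
  obtain ⟨u, hu, h⟩ := Padic.exists_eq_unit_mul_zpow hx
  obtain ⟨v, hv, h'⟩ := Padic.exists_eq_unit_mul_zpow hy
  rw [unitResidue_eq h, unitResidue_eq h', ← map_mul]
  apply unitResidue_eq
  rw [Padic.valuation_mul hx hy, zpow_add₀ hl]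
  conv_lhs => rw [h, h']
  push_cast
  ring

theorem unitResidue_padicInt {u : ℤ_[l]} (hu : ‖u‖ = 1) :
    unitResidue (u : ℚ_[l]) = PadicInt.toZMod u := by
  apply unitResidue_eq
  have hu0 : (u : ℚ_[l]) ≠ 0 := by
    intro h
    rw [PadicInt.norm_def, h, norm_zero] at hu
    exact zero_ne_one hu
  have : (u : ℚ_[l]).valuation = 0 := by
    rw [PadicInt.norm_def, Padic.norm_eq_zpow_neg_valuation hu0] at hu
    have h1 : (1 : ℝ) < l := by exact_mod_cast (Fact.out : l.Prime).one_lt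
    have := zpow_right_injective₀ (by linarith) h1.ne' (hu.trans (zpow_zero _).symm)
    omega
  rw [this, zpow_zero, mul_one]

theorem valuation_eq_zero_of_norm_eq_one {x : ℚ_[l]} (hu : ‖x‖ = 1) : x.valuation = 0 := by
  have hx : x ≠ 0 := by rintro rfl; simp at hu
  rw [Padic.norm_eq_zpow_neg_valuation hx] at hu
  have h1 : (1 : ℝ) < l := by exact_mod_cast (Fact.out : l.Prime).one_lt
  have := zpow_right_injective₀ (by linarith) h1.ne' (hu.trans (zpow_zero _).symm)
  omega

theorem unitResidue_intCast {n : ℤ} (hn : ¬ (l : ℤ) ∣ n) : unitResidue (n : ℚ_[l]) = n := by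
  have h : ‖(n : ℤ_[l])‖ = 1 := by
    rcases (PadicInt.norm_le_one (n : ℤ_[l])).lt_or_eq with h | h
    · exact absurd (PadicInt.norm_int_lt_one_iff_dvd n |>.mp h) hn
    · exact h
  have := unitResidue_padicInt h
  rw [map_intCast] at this
  simpa using this

open Classical in
/-- The quadratic character of the residue of the unit part of an `l`-adic number. -/
noncomputable def unitSign (x : ℚ_[l]) : ℤˣ := if IsSquare (unitResidue x) then 1 else -1

theorem unitSign_eq_one_iff {x : ℚ_[l]} : unitSign x = 1 ↔ IsSquare (unitResidue x) := by
  unfold unitSign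
  split_ifs with h <;> simp [h]

theorem ZMod.isSquare_mul_iff {x y : ZMod l} (hx : x ≠ 0) (hy : y ≠ 0) :
    IsSquare (x * y) ↔ (IsSquare x ↔ IsSquare y) := by
  by_cases h2 : l = 2
  · subst h2
    have h : ∀ a : ZMod 2, IsSquare a := fun a => by
      fin_cases a
      · exact ⟨0, rfl⟩
      · exact ⟨1, rfl⟩
    simp [h]
  · have hx' := quadraticChar_one_iff_isSquare hx
    have hy' := quadraticChar_one_iff_isSquare hy
    have hxy := quadraticChar_one_iff_isSquare (mul_ne_zero hx hy)
    rw [map_mul] at hxy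
    rcases quadraticChar_dichotomy hx with h | h <;> rcases quadraticChar_dichotomy hy with h' | h' <;>
      simp [h, h', ← hx', ← hy', ← hxy]

theorem unitSign_mul {x y : ℚ_[l]} (hx : x ≠ 0) (hy : y ≠ 0) :
    unitSign (x * y) = unitSign x * unitSign y := by
  unfold unitSign
  rw [unitResidue_mul hx hy]
  have := ZMod.isSquare_mul_iff (unitResidue_ne_zero hx) (unitResidue_ne_zero hy)
  by_cases h : IsSquare (unitResidue x) <;> by_cases h' : IsSquare (unitResidue y) <;>
    simp [h, h', this]

/-- The tame Hilbert symbol on `ℚ_l`. For odd `l` it is the Hilbert symbol. -/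
noncomputable def tameSymbol (l : ℕ) [Fact l.Prime] (x y : ℚ_[l]) : ℤˣ :=
  unitSign (-1 : ℚ_[l]) ^ (x.valuation * y.valuation) * unitSign x ^ y.valuation *
    unitSign y ^ x.valuation

theorem tameSymbol_comm (x y : ℚ_[l]) : tameSymbol l x y = tameSymbol l y x := by
  unfold tameSymbol
  rw [mul_comm x.valuation, mul_right_comm]

theorem tameSymbol_mul_left {x x' : ℚ_[l]} (hx : x ≠ 0) (hx' : x' ≠ 0) (y : ℚ_[l]) :
    tameSymbol l (x * x') y = tameSymbol l x y * tameSymbol l x' y := by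
  unfold tameSymbol
  rw [Padic.valuation_mul hx hx', unitSign_mul hx hx', add_mul, zpow_add, zpow_add, mul_zpow]
  ac_rfl

theorem tameSymbol_mul_right (x : ℚ_[l]) {y y' : ℚ_[l]} (hy : y ≠ 0) (hy' : y' ≠ 0) :
    tameSymbol l x (y * y') = tameSymbol l x y * tameSymbol l x y' := by
  rw [tameSymbol_comm, tameSymbol_mul_left hy hy', tameSymbol_comm y, tameSymbol_comm y']

theorem tameSymbol_mul_self_left {x : ℚ_[l]} (hx : x ≠ 0) (y : ℚ_[l]) :
    tameSymbol l (x * x) y = 1 := by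
  rw [tameSymbol_mul_left hx hx, Int.units_mul_self]

theorem valuation_neg' (x : ℚ_[l]) : (-x).valuation = x.valuation := by
  by_cases hx : x = 0
  · simp [hx]
  rw [neg_eq_neg_one_mul, Padic.valuation_mul (by simp) hx,
    valuation_eq_zero_of_norm_eq_one (x := (-1 : ℚ_[l])) (by simp), zero_add]

/-- With `v` the valuation of `x`, the sign of `-1` enters with exponent `v² + v` and the sign of
`x` with exponent `2v`, both even. -/
theorem tameSymbol_neg_self {x : ℚ_[l]} (hx : x ≠ 0) : tameSymbol l x (-x) = 1 := by
  unfold tameSymbol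
  have h : unitSign (-x) = unitSign (-1 : ℚ_[l]) * unitSign x := by
    rw [← unitSign_mul (by simp) hx, neg_one_mul]
  rw [valuation_neg', h, mul_zpow, mul_comm (unitSign (-1 : ℚ_[l]) ^ x.valuation), ← mul_assoc,
    mul_assoc (unitSign (-1 : ℚ_[l]) ^ (x.valuation * x.valuation)), ← zpow_add, ← two_mul,
    mul_right_comm, ← zpow_add]
  have hsq : ∀ u : ℤˣ, ∀ n : ℤ, Even n → u ^ n = 1 := by
    rintro u n ⟨k, rfl⟩
    rw [zpow_add, Int.units_mul_self]
  rw [hsq _ _ (even_two_mul _), mul_one]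
  apply hsq
  have := Int.even_mul_succ_self x.valuation
  rwa [mul_add, mul_one] at this

theorem tameSymbol_self {x : ℚ_[l]} (hx : x ≠ 0) : tameSymbol l x x = tameSymbol l x (-1) := by
  have h := tameSymbol_mul_right x (y := -1) (y' := -x) (by simp) (by simpa)
  rw [neg_mul_neg, one_mul, tameSymbol_neg_self hx, mul_one] at h
  exact h

theorem tameSymbol_eq_one_of_units {x y : ℚ_[l]} (hx : x.valuation = 0) (hy : y.valuation = 0) :
    tameSymbol l x y = 1 := by
  simp [tameSymbol, hx, hy]

theorem tameSymbol_of_unit {x : ℚ_[l]} (hx : x.valuation = 0) (y : ℚ_[l]) :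
    tameSymbol l x y = unitSign x ^ y.valuation := by
  simp [tameSymbol, hx]

/-- A number congruent to `1` modulo `l` has trivial sign. -/
theorem unitSign_of_norm_sub_one_lt {x : ℚ_[l]} (hx : ‖x - 1‖ < 1) :
    x.valuation = 0 ∧ unitSign x = 1 := by
  have hn : ‖x‖ = 1 := by
    have := IsUltrametricDist.norm_add_eq_max_of_norm_ne_norm (x := x - 1) (y := (1 : ℚ_[l]))
      (by rw [norm_one]; exact hx.ne)
    rw [sub_add_cancel, norm_one, max_eq_right hx.le] at this
    exact this
  refine ⟨valuation_eq_zero_of_norm_eq_one hn, ?_⟩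
  rw [unitSign_eq_one_iff]
  obtain ⟨v, rfl⟩ : ∃ v : ℤ_[l], (v : ℚ_[l]) = x := ⟨⟨x, hn.le⟩, rfl⟩
  rw [unitResidue_padicInt hn]
  have h1 : PadicInt.toZMod (v - 1) = 0 := by
    rw [PadicInt.toZMod_eq_zero_iff_norm_lt_one]
    exact hx
  rw [map_sub, map_one, sub_eq_zero] at h1
  rw [h1]
  exact IsSquare.one

theorem tameSymbol_eq_one_of_norm_sub_one_lt {x : ℚ_[l]} (hx : ‖x - 1‖ < 1) (y : ℚ_[l]) :
    tameSymbol l x y = 1 := by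
  obtain ⟨h1, h2⟩ := unitSign_of_norm_sub_one_lt hx
  rw [tameSymbol_of_unit h1, h2, one_zpow]

/-- If `x` or `y` is not a unit and `‖x‖ ≤ 1`, one of the two is congruent to 1 and has trivial
symbols; two units have trivial symbol. If `‖x‖ > 1`, then `y = -x (1 - x⁻¹)` with second factor
congruent to 1, which leaves the symbol of `x` and `-x`. -/
theorem tameSymbol_steinberg {x y : ℚ_[l]} (hx : x ≠ 0) (h : x + y = 1) :
    tameSymbol l x y = 1 := by
  rcases lt_trichotomy ‖x‖ 1 with h1 | h1 | h1
  · rw [tameSymbol_comm]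
    apply tameSymbol_eq_one_of_norm_sub_one_lt
    rw [← h, sub_add_cancel_right, norm_neg]
    exact h1
  · rcases lt_or_ge ‖y‖ 1 with h2 | h2
    · apply tameSymbol_eq_one_of_norm_sub_one_lt
      rw [← h, sub_add_cancel_left, norm_neg]
      exact h2
    · have h3 : ‖y‖ ≤ 1 := by
        have := Padic.nonarchimedean (1 : ℚ_[l]) (-x)
        rw [norm_neg, h1, norm_one, max_self, ← h, add_neg_cancel_comm] at this
        exact this
      exact tameSymbol_eq_one_of_units (valuation_eq_zero_of_norm_eq_one h1)
        (valuation_eq_zero_of_norm_eq_one (le_antisymm h3 h2))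
  · have hz : ‖(1 - x⁻¹) - 1‖ < 1 := by
      rw [sub_sub_cancel_left, norm_neg, norm_inv]
      exact inv_lt_one_of_one_lt₀ h1
    have hz0 : (1 - x⁻¹) ≠ 0 := by
      intro h0
      rw [h0] at hz
      simp at hz
    have hy' : y = -x * (1 - x⁻¹) := by
      field_simp
      linear_combination h
    rw [hy', tameSymbol_mul_right _ (by simpa) hz0, tameSymbol_neg_self hx, one_mul, tameSymbol_comm,
      tameSymbol_eq_one_of_norm_sub_one_lt hz]

/-- The conic `z² = a x² + b y²` has a point over `F`. -/
def ConicSolvable (F : Type) [Field F] (a b : F) : Prop :=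
  ∃ x y z : F, (x ≠ 0 ∨ y ≠ 0 ∨ z ≠ 0) ∧ z ^ 2 = a * x ^ 2 + b * y ^ 2

theorem tameSymbol_mul_sq_left {x s : ℚ_[l]} (hx : x ≠ 0) (hs : s ≠ 0) (y : ℚ_[l]) :
    tameSymbol l (x * s ^ 2) y = tameSymbol l x y := by
  rw [tameSymbol_mul_left hx (by positivity), sq, tameSymbol_mul_self_left hs, mul_one]

theorem tameSymbol_mul_sq_right {y s : ℚ_[l]} (hy : y ≠ 0) (hs : s ≠ 0) (x : ℚ_[l]) :
    tameSymbol l x (y * s ^ 2) = tameSymbol l x y := by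
  rw [tameSymbol_comm, tameSymbol_mul_sq_left hy hs, tameSymbol_comm]

theorem tameSymbol_sq_left {s : ℚ_[l]} (hs : s ≠ 0) (y : ℚ_[l]) : tameSymbol l (s ^ 2) y = 1 := by
  rw [sq, tameSymbol_mul_self_left hs]

/-- Dividing a point with nonzero coordinates by `z²` gives the relation `u + v = 1` between
elements of the square classes of `a` and `b`, so the Steinberg relation applies. A vanishing
coordinate makes `a` or `b` a square, or puts `b` in the class of `-a`. -/
theorem ConicSolvable.tameSymbol_eq_one {a b : ℚ_[l]} (ha : a ≠ 0) (hb : b ≠ 0)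
    (h : ConicSolvable ℚ_[l] a b) : tameSymbol l a b = 1 := by
  obtain ⟨x, y, z, hne, h⟩ := h
  by_cases hx : x = 0
  · subst hx
    have hy : y ≠ 0 := by
      rintro rfl
      simp_all
    have hb' : b = (z / y) ^ 2 := by
      field_simp
      linear_combination -h
    have hz : z / y ≠ 0 := by
      intro h0
      rw [h0] at hb'
      simp at hb'
      exact hb hb'
    rw [hb', tameSymbol_comm, tameSymbol_sq_left hz]
  by_cases hy : y = 0
  · subst hy
    have hb' : a = (z / x) ^ 2 := by
      field_simp
      linear_combination -h
    have hz : z / x ≠ 0 := by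
      intro h0
      rw [h0] at hb'
      simp at hb'
      exact ha hb'
    rw [hb', tameSymbol_sq_left hz]
  rw [← tameSymbol_mul_sq_left ha hx, ← tameSymbol_mul_sq_right hb hy]
  by_cases hz : z = 0
  · have : b * y ^ 2 = -(a * x ^ 2) := by
      rw [hz] at h
      linear_combination -h
    rw [this]
    exact tameSymbol_neg_self (by positivity)
  · rw [← tameSymbol_mul_sq_left (s := z⁻¹) (by positivity) (by positivity),
      ← tameSymbol_mul_sq_right (s := z⁻¹) (y := b * y ^ 2) (by positivity) (by positivity)]
    apply tameSymbol_steinberg (by positivity)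
    field_simp
    exact h.symm

/-! ### Conics over local fields -/

theorem PadicInt.isSquare_of_isSquare_toZMod (hl : l ≠ 2) {u : ℤ_[l]} (hu : ‖u‖ = 1)
    (h : IsSquare (PadicInt.toZMod u)) : IsSquare u := by
  obtain ⟨r, hr⟩ := h
  obtain ⟨a, rfl⟩ := ZMod.ringHom_surjective (PadicInt.toZMod (p := l)) r
  have hr0 : ‖u - a * a‖ < 1 := by
    rw [← PadicInt.toZMod_eq_zero_iff_norm_lt_one, map_sub, map_mul, hr, sub_self]
  have ha : ‖a‖ = 1 := by
    refine le_antisymm (PadicInt.norm_le_one a) (not_lt.mp fun h => ?_)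
    rw [← PadicInt.toZMod_eq_zero_iff_norm_lt_one] at h
    rw [h, mul_zero, PadicInt.toZMod_eq_zero_iff_norm_lt_one, hu] at hr
    exact lt_irrefl _ hr
  have h2 : ‖(2 : ℤ_[l])‖ = 1 := by
    refine le_antisymm (PadicInt.norm_le_one _) (not_lt.mp fun h => ?_)
    have := (PadicInt.norm_int_lt_one_iff_dvd (p := l) 2).mp (by simpa using h)
    have h3 : l ∣ 2 := by exact_mod_cast this
    exact hl ((Nat.prime_dvd_prime_iff_eq Fact.out Nat.prime_two).mp h3)
  obtain ⟨z, hz, -⟩ := hensels_lemma (F := (Polynomial.X ^ 2 - Polynomial.C u : Polynomial ℤ_[l]))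
    (a := a) (by
      simp only [map_sub, map_pow, Polynomial.aeval_X, Polynomial.aeval_C, Polynomial.derivative_X_pow,
        Polynomial.derivative_C, sub_zero, map_mul]
      simp [h2, ha]
      rw [norm_sub_rev, sq]
      exact hr0)
  refine ⟨z, ?_⟩
  simp at hz
  rw [← sq]
  exact (sub_eq_zero.mp hz).symm

theorem isSquare_of_unitSign (hl : l ≠ 2) {x : ℚ_[l]} (hx : x ≠ 0) (hv : Even x.valuation)
    (h : unitSign x = 1) : IsSquare x := by
  obtain ⟨u, hu, h'⟩ := Padic.exists_eq_unit_mul_zpow hx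
  rw [unitSign_eq_one_iff, unitResidue_eq h'] at h
  obtain ⟨w, hw⟩ := PadicInt.isSquare_of_isSquare_toZMod hl hu h
  obtain ⟨k, hk⟩ := hv
  have hl0 : (l : ℚ_[l]) ≠ 0 := by exact_mod_cast (Fact.out : l.Prime).ne_zero
  refine ⟨w * (l : ℚ_[l]) ^ k, ?_⟩
  rw [h', hw, hk, zpow_add₀ hl0]
  push_cast
  ring

/-- Counting squares in the residue field solves `u c² + w d² = 1` modulo the odd prime `l`. For any
lifts of `c` and `d` the left side is congruent to 1, hence a square by Hensel's lemma. -/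
theorem conicSolvable_of_units (hl : l ≠ 2) {x y : ℚ_[l]} (hx : ‖x‖ = 1) (hy : ‖y‖ = 1) :
    ConicSolvable ℚ_[l] x y := by
  set u : ℤ_[l] := ⟨x, hx.le⟩
  set w : ℤ_[l] := ⟨y, hy.le⟩
  have hu : PadicInt.toZMod u ≠ 0 := by
    rw [ne_eq, PadicInt.toZMod_eq_zero_iff_norm_lt_one]
    change ¬ ‖x‖ < 1
    simp [hx]
  have hw : PadicInt.toZMod w ≠ 0 := by
    rw [ne_eq, PadicInt.toZMod_eq_zero_iff_norm_lt_one]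
    change ¬ ‖y‖ < 1
    simp [hy]
  obtain ⟨c, d, hcd⟩ := FiniteField.exists_root_sum_quadratic
    (f := (Polynomial.C (PadicInt.toZMod u) * Polynomial.X ^ 2 : Polynomial (ZMod l)))
    (g := (Polynomial.C (PadicInt.toZMod w) * Polynomial.X ^ 2 + Polynomial.C (-1) : Polynomial (ZMod l)))
    (by compute_degree!) (by compute_degree!)
    (by
      rw [ZMod.card]
      exact Nat.odd_iff.mp ((Fact.out : l.Prime).odd_of_ne_two hl))
  obtain ⟨c, rfl⟩ := ZMod.ringHom_surjective (PadicInt.toZMod (p := l)) c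
  obtain ⟨d, rfl⟩ := ZMod.ringHom_surjective (PadicInt.toZMod (p := l)) d
  simp only [Polynomial.eval_mul, Polynomial.eval_add, Polynomial.eval_C, Polynomial.eval_pow,
    Polynomial.eval_X] at hcd
  have hval : PadicInt.toZMod (u * c ^ 2 + w * d ^ 2) = 1 := by
    simp only [map_add, map_mul, map_pow]
    linear_combination hcd
  have hn : ‖u * c ^ 2 + w * d ^ 2‖ = 1 := by
    refine le_antisymm (PadicInt.norm_le_one _) (not_lt.mp fun h => ?_)
    rw [← PadicInt.toZMod_eq_zero_iff_norm_lt_one, hval] at h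
    exact one_ne_zero h
  obtain ⟨z, hz⟩ := PadicInt.isSquare_of_isSquare_toZMod hl hn (by rw [hval]; exact IsSquare.one)
  refine ⟨c, d, z, ?_, ?_⟩
  · right; right
    intro h
    have : z = 0 := Subtype.ext h
    rw [hz, this] at hn
    simp at hn
  · have := congrArg (fun t : ℤ_[l] => (t : ℚ_[l])) hz
    push_cast at this
    rw [sq, ← this]

theorem ConicSolvable.of_mul_sq {F : Type} [Field F] {a b s t : F} (hs : s ≠ 0) (ht : t ≠ 0)
    (h : ConicSolvable F (a * s ^ 2) (b * t ^ 2)) : ConicSolvable F a b := by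
  obtain ⟨x, y, z, hne, h⟩ := h
  refine ⟨s * x, t * y, z, ?_, by rw [h]; ring⟩
  simpa [hs, ht] using hne

theorem ConicSolvable.symm {F : Type} [Field F] {a b : F}
    (h : ConicSolvable F a b) : ConicSolvable F b a := by
  obtain ⟨x, y, z, hne, h⟩ := h
  exact ⟨y, x, z, by tauto, by rw [h]; ring⟩

theorem ConicSolvable.of_isSquare {F : Type} [Field F] {a b : F} (h : IsSquare a) :
    ConicSolvable F a b := by
  obtain ⟨r, rfl⟩ := h
  exact ⟨1, 0, r, by simp, by ring⟩

/-- The parities of the valuations decide. Two even ones reduce to units. If only one is even, the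
symbol is the sign of that argument, which is then a square. If both are odd, the symbol is the sign
of `-xy`; writing `-xy = s²` gives the point `(y, s, 0)`. -/
theorem conicSolvable_of_tameSymbol (hl : l ≠ 2) {x y : ℚ_[l]} (hx : x ≠ 0) (hy : y ≠ 0)
    (h : tameSymbol l x y = 1) : ConicSolvable ℚ_[l] x y := by
  have hl0 : (l : ℚ_[l]) ≠ 0 := by exact_mod_cast (Fact.out : l.Prime).ne_zero
  have hodd : ∀ n : ℤ, Odd n → ∀ u : ℤˣ, u ^ n = u := by
    rintro n ⟨k, rfl⟩ u
    rw [zpow_add, zpow_mul, zpow_one, show u ^ (2 : ℤ) = 1 by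
      rw [show (2 : ℤ) = 1 + 1 by norm_num, zpow_add, zpow_one, Int.units_mul_self], one_zpow, one_mul]
  have heven : ∀ n : ℤ, Even n → ∀ u : ℤˣ, u ^ n = 1 := by
    rintro n ⟨k, rfl⟩ u
    rw [zpow_add, Int.units_mul_self]
  rcases Int.even_or_odd x.valuation with hv | hv <;> rcases Int.even_or_odd y.valuation with hw | hw
  · obtain ⟨u, hu, hu'⟩ := Padic.exists_eq_unit_mul_zpow hx
    obtain ⟨w, hw1, hw'⟩ := Padic.exists_eq_unit_mul_zpow hy
    obtain ⟨k, hk⟩ := hv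
    obtain ⟨m, hm⟩ := hw
    have hs := (conicSolvable_of_units hl (x := u) (y := w) hu hw1)
    apply ConicSolvable.of_mul_sq (s := (l : ℚ_[l]) ^ (-k)) (t := (l : ℚ_[l]) ^ (-m))
      (zpow_ne_zero _ hl0) (zpow_ne_zero _ hl0)
    convert hs using 1
    · conv_lhs => rw [hu', hk]
      rw [← zpow_natCast, ← zpow_mul, mul_assoc, ← zpow_add₀ hl0]
      simp; ring_nf; simp
    · conv_lhs => rw [hw', hm]
      rw [← zpow_natCast, ← zpow_mul, mul_assoc, ← zpow_add₀ hl0]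
      simp; ring_nf; simp
  · rw [tameSymbol, heven _ (hv.mul_right _), heven _ hv, hodd _ hw, one_mul, mul_one] at h
    exact ConicSolvable.of_isSquare (isSquare_of_unitSign hl hx hv h)
  · rw [tameSymbol, heven _ (hw.mul_left _), heven _ hw, hodd _ hv, one_mul, one_mul] at h
    exact (ConicSolvable.of_isSquare (isSquare_of_unitSign hl hy hw h)).symm
  · rw [tameSymbol, hodd _ (hv.mul hw), hodd _ hv, hodd _ hw, ← unitSign_mul (by simp) hx,
      ← unitSign_mul (by simpa) hy] at h
    obtain ⟨s, hs⟩ := isSquare_of_unitSign hl (by simp [hx, hy]) (by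
      rw [neg_one_mul, neg_mul, valuation_neg', Padic.valuation_mul hx hy]
      exact hv.add_odd hw) h
    exact ⟨y, s, 0, Or.inl hy, by linear_combination y * hs⟩

end HilbertSymbol

/-! ### Legendre's theorem -/

section Legendre

theorem exists_sq_sub_dvd_of_squarefree (a : ℤ) (b : ℕ) (hb : Squarefree b)
    (h : ∀ l : ℕ, l.Prime → l ∣ b → IsSquare (a : ZMod l)) : ∃ t : ℤ, (b : ℤ) ∣ t ^ 2 - a := by
  induction b using Nat.recOnPrimeCoprime with
  | zero => exact absurd hb not_squarefree_zero
  | prime_pow p n hp =>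
    rcases Nat.eq_zero_or_pos n with rfl | hn
    · exact ⟨0, by simp⟩
    have hn1 : n = 1 := by
      rcases Nat.squarefree_pow_iff hp.one_lt.ne' hn.ne' |>.mp hb with ⟨-, h⟩
      exact h
    subst hn1
    rw [pow_one] at *
    obtain ⟨r, hr⟩ := h p hp dvd_rfl
    obtain ⟨t, rfl⟩ := ZMod.intCast_surjective r
    refine ⟨t, ?_⟩
    rw [← ZMod.intCast_zmod_eq_zero_iff_dvd]
    push_cast
    rw [hr]
    ring
  | coprime m n _ _ hmn ihm ihn =>
    have hsq := (Nat.squarefree_mul_iff.mp hb)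
    obtain ⟨t, ht⟩ := ihm hsq.2.1 fun l hl hd => h l hl (hd.mul_right _)
    obtain ⟨s, hs⟩ := ihn hsq.2.2 fun l hl hd => h l hl (hd.mul_left _)
    obtain ⟨u, v, huv⟩ := (Nat.isCoprime_iff_coprime.mpr hmn)
    -- The Bézout idempotents `v n` and `u m` glue the two square roots.
    refine ⟨t * (v * n) + s * (u * m), ?_⟩
    push_cast
    apply (Nat.isCoprime_iff_coprime.mpr hmn).mul_dvd
    · obtain ⟨k, hk⟩ := ht
      exact ⟨k + (2 * t * s * u * v * n + s ^ 2 * u ^ 2 * m) - t ^ 2 * u * (1 + v * n), by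
        linear_combination hk + (t ^ 2 * (v * n + 1)) * huv⟩
    · obtain ⟨k, hk⟩ := hs
      exact ⟨k + (2 * t * s * u * v * m + t ^ 2 * v ^ 2 * n) - s ^ 2 * v * (1 + u * m), by
        linear_combination hk + (s ^ 2 * (u * m + 1)) * huv⟩

theorem isSquare_zmod_of_tameSymbol {l : ℕ} [Fact l.Prime] {a b : ℤ}
    (hv : padicValInt l b = 1) (h : tameSymbol l (a : ℚ_[l]) (b : ℚ_[l]) = 1) :
    IsSquare (a : ZMod l) := by
  by_cases hd : (l : ℤ) ∣ a
  · rw [(ZMod.intCast_zmod_eq_zero_iff_dvd a l).mpr hd]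
    exact IsSquare.zero
  have h0 : (a : ℚ_[l]).valuation = 0 := by
    rw [Padic.valuation_intCast, padicValInt.eq_zero_of_not_dvd hd]
    rfl
  rw [tameSymbol_of_unit h0, Padic.valuation_intCast, hv, Nat.cast_one, zpow_one,
    unitSign_eq_one_iff, unitResidue_intCast hd] at h
  exact h

theorem exists_small_sq_sub_dvd {a : ℤ} {b : ℕ} (hb : 0 < b) (h : ∃ t : ℤ, (b : ℤ) ∣ t ^ 2 - a) :
    ∃ t : ℤ, (b : ℤ) ∣ t ^ 2 - a ∧ 2 * |t| ≤ b := by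
  obtain ⟨t, ht⟩ := h
  refine ⟨t.bmod b, ?_, ?_⟩
  · have h1 : (b : ℤ) ∣ t - t.bmod b := Int.dvd_self_sub_bmod
    have : t.bmod b ^ 2 - a = (t ^ 2 - a) - (t - t.bmod b) * (t + t.bmod b) := by ring
    rw [this]
    exact dvd_sub ht (h1.mul_right _)
  · have h1 := Int.le_bmod (x := t) hb
    have h2 := Int.bmod_le (x := t) hb
    rcases abs_cases (t.bmod b) with h | h <;> omega

theorem int_exists_squarefree_mul_sq {b : ℤ} (hb : b ≠ 0) :
    ∃ c s : ℤ, Squarefree c ∧ s ≠ 0 ∧ b = c * s ^ 2 := by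
  obtain ⟨c, s, h, hc⟩ := Nat.sq_mul_squarefree b.natAbs
  have hs : s ≠ 0 := by
    rintro rfl
    have : b.natAbs ≠ 0 := by simpa
    simp at h
    omega
  refine ⟨b.sign * c, s, ?_, by exact_mod_cast hs, ?_⟩
  · rw [← Int.squarefree_natAbs, Int.natAbs_mul, Int.natAbs_sign_of_ne_zero hb]
    simpa using hc
  · conv_lhs => rw [← Int.sign_mul_natAbs b, ← h]
    push_cast
    ring

/-- Legendre's descent. For `|a| ≤ |b|`, the symbols make `a` a square modulo `b`: `t² - a = b c s²`
with `|t| ≤ |b| / 2`, and hence `|c| < |b|`. The symbols of `(a, b)` and of `(a, b c s²)` are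
trivial, hence those of `(a, c)` too, and induction gives a point for `(a, c)`. The prime 2 imposes
nothing because every residue modulo 2 is a square. -/
theorem legendre_squarefree (N : ℕ) : ∀ a b : ℤ, Squarefree a → Squarefree b →
    a.natAbs + b.natAbs ≤ N →
    (0 < a ∨ 0 < b) → (∀ (l : ℕ) [Fact l.Prime], l ≠ 2 → tameSymbol l (a : ℚ_[l]) (b : ℚ_[l]) = 1) →
    ConicSolvable ℚ a b := by
  induction N using Nat.strong_induction_on with
  | _ N IH =>
  intro a b ha hb hN hpos h
  wlog hab : a.natAbs ≤ b.natAbs generalizing a b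
  · refine (this b a hb ha (by omega) hpos.symm (fun l _ hl => ?_) (by omega)).symm
    rw [tameSymbol_comm]
    exact h l hl
  have ha0 := ha.ne_zero
  have hb0 := hb.ne_zero
  by_cases hb1 : b.natAbs = 1
  · have ha1 : a.natAbs = 1 := by omega
    rcases hpos with hp | hp
    · have : a = 1 := by omega
      exact ConicSolvable.of_isSquare (by rw [this]; simp)
    · have : b = 1 := by omega
      exact (ConicSolvable.of_isSquare (by rw [this]; simp)).symm
  have hb2 : 2 ≤ b.natAbs := by omega
  obtain ⟨t, ht, htb⟩ := exists_small_sq_sub_dvd (a := a) (b := b.natAbs) (by omega)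
    (exists_sq_sub_dvd_of_squarefree a b.natAbs (Int.squarefree_natAbs.mpr hb) fun l hl hd => by
      have : Fact l.Prime := ⟨hl⟩
      by_cases hl2 : l = 2
      · subst hl2
        generalize (a : ZMod 2) = x
        fin_cases x
        · exact ⟨0, rfl⟩
        · exact ⟨1, rfl⟩
      apply isSquare_zmod_of_tameSymbol (b := b) _ (h l hl2)
      rw [padicValInt]
      apply le_antisymm
      · rw [← Nat.factorization_def _ hl]
        exact (Int.squarefree_natAbs.mpr hb).natFactorization_le_one l
      · exact one_le_padicValNat_of_dvd (by omega) hd)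
  rw [Int.natAbs_dvd] at ht
  obtain ⟨b', hb'⟩ := ht
  by_cases hb'0 : b' = 0
  · refine ConicSolvable.of_isSquare ⟨t, ?_⟩
    rw [hb'0, mul_zero, sub_eq_zero] at hb'
    rw [← sq]
    exact_mod_cast hb'.symm
  obtain ⟨c, s, hc, hs, rfl⟩ := int_exists_squarefree_mul_sq hb'0
  have hsmall : c.natAbs < b.natAbs := by
    have h1 : |b| * |c * s ^ 2| ≤ t ^ 2 + |a| := by
      rw [← abs_mul, ← hb']
      calc |t ^ 2 - a| ≤ |t ^ 2| + |a| := abs_sub _ _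
        _ = _ := by rw [abs_of_nonneg (sq_nonneg t)]
    have h2 : |c| ≤ |c * s ^ 2| := by
      rw [abs_mul]
      have : 1 ≤ |s ^ 2| := Int.one_le_abs (pow_ne_zero _ hs)
      nlinarith [abs_nonneg c]
    zify at hab hb2 htb ⊢
    by_contra! hcon
    have h3 : t ^ 2 = |t| ^ 2 := (sq_abs t).symm
    nlinarith [abs_nonneg t, abs_nonneg b, abs_nonneg c]
  have hc0 := hc.ne_zero
  have key : ConicSolvable ℚ a c := by
    refine IH (a.natAbs + c.natAbs) (by omega) a c ha hc le_rfl ?_ fun l _ hl => ?_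
    · rcases lt_or_gt_of_ne ha0 with h1 | h1
      · right
        have hbp : 0 < b := hpos.resolve_left (by omega)
        have : 0 < b * (c * s ^ 2) := by rw [← hb']; nlinarith [sq_nonneg t]
        have h3 := pos_of_mul_pos_right this hbp.le
        exact pos_of_mul_pos_left h3 (sq_nonneg s)
      · exact Or.inl h1
    · have e1 : tameSymbol l (a : ℚ_[l]) ((b : ℚ_[l]) * (c * s ^ 2)) = 1 := by
        apply ConicSolvable.tameSymbol_eq_one
        · exact_mod_cast ha0
        · have : b * (c * s ^ 2) ≠ 0 := by positivity
          exact_mod_cast this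
        · refine ⟨1, 1, t, by simp, ?_⟩
          have : ((t ^ 2 - a : ℤ) : ℚ_[l]) = (b * (c * s ^ 2) : ℤ) := by rw [hb']
          push_cast at this
          linear_combination this
      have c0 : (c : ℚ_[l]) ≠ 0 := by exact_mod_cast hc0
      have s0 : (s : ℚ_[l]) ≠ 0 := by exact_mod_cast hs
      have b0 : (b : ℚ_[l]) ≠ 0 := by exact_mod_cast hb0
      rw [tameSymbol_mul_right _ b0 (by positivity), h l hl, one_mul,
        tameSymbol_mul_sq_right c0 s0] at e1
      exact e1
  obtain ⟨x, y, z, hne, hxyz⟩ := key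
  by_cases hy : y = 0
  · refine ⟨x, 0, z, ?_, by rw [hxyz, hy]; ring⟩
    rcases hne with h | h | h
    · exact Or.inl h
    · exact absurd hy h
    · exact Or.inr (Or.inr h)
  · have hbq : ((t ^ 2 - a : ℤ) : ℚ) = (b * (c * s ^ 2) : ℤ) := by rw [hb']
    push_cast at hbq
    -- These are the coordinates of `(z + x√a)(t + √a)`, whose norm is `c y² · b c s² = b (c s y)²`.
    refine ⟨t * x + z, c * s * y, t * z + a * x, ?_, ?_⟩
    · right; left
      have : (c : ℚ) ≠ 0 := by exact_mod_cast hc0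
      have : (s : ℚ) ≠ 0 := by exact_mod_cast hs
      positivity
    · linear_combination (t ^ 2 - a) * hxyz + c * y ^ 2 * hbq

/-- **Legendre's theorem**: a conic over `ℚ` has a rational point if it has real points and its
tame symbols at the odd primes are trivial. -/
theorem legendre {a b : ℚ} (ha : a ≠ 0) (hb : b ≠ 0) (hpos : 0 < a ∨ 0 < b)
    (h : ∀ (l : ℕ) [Fact l.Prime], l ≠ 2 → tameSymbol l (a : ℚ_[l]) (b : ℚ_[l]) = 1) :
    ConicSolvable ℚ a b := by
  have key : ∀ x : ℚ, x ≠ 0 → ∃ c : ℤ, ∃ s : ℚ, Squarefree c ∧ s ≠ 0 ∧ (c : ℚ) = x * s ^ 2 := by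
    intro x hx
    obtain ⟨c, s, hc, hs, h⟩ := int_exists_squarefree_mul_sq (b := x.num * x.den)
      (mul_ne_zero (Rat.num_ne_zero.mpr hx) (by exact_mod_cast x.den_ne_zero))
    have hs' : (s : ℚ) ≠ 0 := by exact_mod_cast hs
    have hd : (x.den : ℚ) ≠ 0 := by exact_mod_cast x.den_ne_zero
    refine ⟨c, x.den / s, hc, by positivity, ?_⟩
    have h' : ((x.num * x.den : ℤ) : ℚ) = (c * s ^ 2 : ℤ) := by rw [h]
    push_cast at h'
    have hn : (x.num : ℚ) = x * x.den := (Rat.mul_den_eq_num x).symm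
    rw [hn] at h'
    field_simp
    linear_combination -h'
  obtain ⟨c, s, hc, hs, hcs⟩ := key a ha
  obtain ⟨d, t, hd, ht, hdt⟩ := key b hb
  have hsol := legendre_squarefree _ c d hc hd le_rfl (by
    rcases hpos with hp | hp
    · left
      have : (0 : ℚ) < c := by rw [hcs]; positivity
      exact_mod_cast this
    · right
      have : (0 : ℚ) < d := by rw [hdt]; positivity
      exact_mod_cast this) (fun l _ hl => by
    have e1 : (c : ℚ_[l]) = a * (s : ℚ_[l]) ^ 2 := by
      have := congrArg (fun q : ℚ => (q : ℚ_[l])) hcs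
      push_cast at this
      exact this
    have e2 : (d : ℚ_[l]) = b * (t : ℚ_[l]) ^ 2 := by
      have := congrArg (fun q : ℚ => (q : ℚ_[l])) hdt
      push_cast at this
      exact this
    rw [e1, e2, tameSymbol_mul_sq_left (by exact_mod_cast ha) (by exact_mod_cast hs),
      tameSymbol_mul_sq_right (by exact_mod_cast hb) (by exact_mod_cast ht)]
    exact h l hl)
  rw [hcs, hdt] at hsol
  exact hsol.of_mul_sq hs ht

end Legendre

/-! ### Representation of a negative discriminant by the pure part of a norm form -/

section Representation

/-- The discriminant `-d` is 1 modulo 4, so reciprocity holds without a sign. -/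
theorem jacobiSym_neg_of_three_mod_four {d q : ℕ} (hd : d % 4 = 3) (hq : Odd q) :
    jacobiSym (-d) q = jacobiSym q d := by
  have hdo : Odd d := by rw [Nat.odd_iff]; omega
  rw [jacobiSym.neg _ hq]
  rcases (by have := Nat.odd_iff.mp hq; omega : q % 4 = 1 ∨ q % 4 = 3) with h | h
  · rw [ZMod.χ₄_nat_one_mod_four h, one_mul, ← jacobiSym.quadratic_reciprocity_one_mod_four h hdo]
  · rw [ZMod.χ₄_nat_three_mod_four h, jacobiSym.quadratic_reciprocity_three_mod_four hd h]
    ring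

/-- The condition on a discriminant `-d` for a prime `p` to be inert. -/
def InertCondition (d p : ℕ) : Prop :=
  (p = 2 → d % 8 = 3) ∧ (p ≠ 2 → ¬ IsSquare (((-d : ℤ)) : ZMod p))

theorem InertCondition.not_dvd {d p : ℕ} (hd : d % 4 = 3) (h : InertCondition d p) : ¬ p ∣ d := by
  intro hdvd
  by_cases hp : p = 2
  · subst hp; omega
  · apply h.2 hp
    have : ((d : ℕ) : ZMod p) = 0 := (ZMod.natCast_eq_zero_iff d p).mpr hdvd
    push_cast
    rw [this, neg_zero]
    exact IsSquare.zero

/-- Together with reciprocity for `-d`, this shows that `-d` is a square modulo any odd prime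
congruent to `-p` modulo `d`. The auxiliary prime below is chosen in that class. -/
theorem InertCondition.jacobiSym {d p : ℕ} (hp : p.Prime) (hd : d % 4 = 3)
    (h : InertCondition d p) : jacobiSym (-p) d = 1 := by
  have hdo : Odd d := by rw [Nat.odd_iff]; omega
  rw [jacobiSym.neg _ hdo, ZMod.χ₄_nat_three_mod_four hd]
  by_cases hp2 : p = 2
  · subst hp2
    have h8 := h.1 rfl
    rw [Nat.cast_ofNat, jacobiSym.at_two hdo, ZMod.χ₈_nat_mod_eight, h8]
    decide
  · have := Fact.mk hp
    rw [← jacobiSym_neg_of_three_mod_four hd (hp.odd_of_ne_two hp2),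
      ZMod.nonsquare_iff_jacobiSym_eq_neg_one.mpr (h.2 hp2)]
    norm_num

/-- Dirichlet's theorem supplies `q` with prescribed residues modulo `p`, modulo the odd primes
dividing `d e`, and modulo 8. That `-d` is a square modulo `q` follows from `q ≡ -p mod d`. That `e`
is one is arranged modulo 8, which is possible exactly because `e` is 2 or 3 modulo 4: for `e ≡ 1
mod 4` its symbol modulo `q` would be fixed by the odd residues. -/
theorem exists_auxiliary_prime {d p : ℕ} (hp : p.Prime) (hd : d % 4 = 3) (hin : InertCondition d p)
    {e : ℤ} (he : e < 0) (he4 : e % 4 = 2 ∨ e % 4 = 3) {r : ℕ} (hr : r.Coprime p) :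
    ∃ q : ℕ, q.Prime ∧ q ≠ 2 ∧ ¬ (q : ℤ) ∣ d ∧ ¬ (q : ℤ) ∣ e ∧ q ≠ p ∧
      (p ≠ 2 → (q : ZMod p) = r) ∧
      (∀ l : ℕ, l.Prime → l ≠ 2 → l ≠ p → ((l : ℤ) ∣ d ∨ (l : ℤ) ∣ e) → (q : ZMod l) = -p) ∧
      IsSquare (e : ZMod q) ∧ IsSquare (((-d : ℤ)) : ZMod q) := by
  obtain ⟨m, hmo, hme⟩ : ∃ m : ℕ, Odd m ∧ ((e = -m ∧ m % 4 = 1) ∨ e = -2 * m) := by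
    rcases he4 with h | h
    · exact ⟨(e / 2).natAbs, by rw [Nat.odd_iff]; omega, Or.inr (by omega)⟩
    · exact ⟨e.natAbs, by rw [Nat.odd_iff]; omega, Or.inl (by omega)⟩
  have hdo : Odd d := by rw [Nat.odd_iff]; omega
  have hpd := hin.not_dvd hd
  set P : ℕ := if p = 2 then 1 else p with hP
  have hPo : Odd P := by
    rw [hP]; split_ifs with h
    · exact odd_one
    · exact hp.odd_of_ne_two h
  set W : ℕ := d * m * P with hW
  have hWo : Odd W := (hdo.mul hmo).mul hPo
  have hW0 : W ≠ 0 := by rintro h; rw [h] at hWo; exact absurd hWo (by decide)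
  set M := ordCompl[p] W with hM
  set V := ordProj[p] W with hV
  have hVM : V * M = W := Nat.ordProj_mul_ordCompl_eq_self W p
  have hpM : p.Coprime M := Nat.coprime_ordCompl hp hW0
  have hcop : V.Coprime M := hpM.pow_left _
  -- Here `V` is the `p`-part of `W` and `M` the part prime to `p`; the number `(M - 1) * p` is `-p`
  -- modulo `M`, written in `ℕ`.
  obtain ⟨k0, hk1, hk2⟩ := Nat.chineseRemainder hcop r ((M - 1) * p)
  have hM0 : 0 < M := Nat.ordCompl_pos p hW0
  have hk2' : (k0 : ZMod M) = -p := by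
    rw [(ZMod.natCast_eq_natCast_iff _ _ _).mpr hk2]
    rw [Nat.cast_mul, Nat.cast_sub hM0]
    simp
  have hk0 : k0.Coprime W := by
    rw [← hVM]
    apply Nat.Coprime.mul_right
    · have : r.Coprime V := hr.pow_right _
      rw [Nat.coprime_iff_gcd_eq_one] at this ⊢
      rw [← this]
      exact hk1.gcd_eq
    · rw [← ZMod.isUnit_iff_coprime, hk2', IsUnit.neg_iff, ZMod.isUnit_iff_coprime]
      exact hpM
  -- If the symbol of `k0` modulo `m` is 1, then `q ≡ 1 mod 8` does. Otherwise its sign is repaired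
  -- by `-1` being a nonresidue (`q ≡ 3`, case `e = -m`) or by 2 being one (`q ≡ 5`, case `e =
  -- -2m`).
  obtain ⟨c, hc8, hc⟩ : ∃ c : ℕ, Nat.Coprime 8 c ∧ ((jacobiSym k0 m = 1 ∧ c = 1) ∨
      (jacobiSym k0 m = -1 ∧ ((e = -m ∧ m % 4 = 1 ∧ c = 3) ∨ (e = -2 * m ∧ c = 5)))) := by
    have hkm : (k0 : ℤ).gcd m = 1 := by
      rw [Int.gcd_natCast_natCast]
      exact hk0.coprime_dvd_right (by rw [hW]; exact (Dvd.intro_left d rfl).mul_right P)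
    rcases jacobiSym.eq_one_or_neg_one hkm with h | h
    · exact ⟨1, by decide, Or.inl ⟨h, rfl⟩⟩
    · rcases hme with h' | h'
      · exact ⟨3, by decide, Or.inr ⟨h, Or.inl ⟨h'.1, h'.2, rfl⟩⟩⟩
      · exact ⟨5, by decide, Or.inr ⟨h, Or.inr ⟨h', rfl⟩⟩⟩
  have h8W : Nat.Coprime 8 W := by
    have : Nat.Coprime 2 W := (Nat.coprime_two_left).mpr hWo
    exact this.pow_left 3
  obtain ⟨k, hk8, hkW⟩ := Nat.chineseRemainder h8W c k0
  have : NeZero (8 * W) := ⟨by positivity⟩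
  have hkunit : IsUnit (k : ZMod (8 * W)) := by
    rw [ZMod.isUnit_iff_coprime]
    apply Nat.Coprime.mul_right
    · rw [Nat.coprime_iff_gcd_eq_one, hk8.gcd_eq]
      exact hc8.symm
    · rw [Nat.coprime_iff_gcd_eq_one, hkW.gcd_eq]
      exact hk0
  -- The lower bound `8 W p` keeps `q` from being 2 or `p` and from dividing `d` or `e`.
  obtain ⟨q, hqgt, hq, hqk⟩ := Nat.forall_exists_prime_gt_and_eq_mod hkunit (8 * W * p)
  have hqk' := (ZMod.natCast_eq_natCast_iff _ _ _).mp hqk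
  have hq8 : q ≡ c [MOD 8] := (hqk'.of_mul_right W).trans hk8
  have hqW : q ≡ k0 [MOD W] := (hqk'.of_mul_left 8).trans hkW
  have hW1 : 1 ≤ W := Nat.one_le_iff_ne_zero.mpr hW0
  have hdW : d ∣ W := ⟨m * P, by rw [hW]; ring⟩
  have hmW : m ∣ W := ⟨d * P, by rw [hW]; ring⟩
  have hP1 : 1 ≤ P := hPo.pos
  have hp1 := hp.one_lt
  have hqW' : 8 * W < q := lt_of_le_of_lt (Nat.le_mul_of_pos_right _ hp.pos) hqgt
  have hqp : p < q := lt_of_le_of_lt (Nat.le_mul_of_pos_left _ (by positivity)) hqgt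
  have hq2 : q ≠ 2 := by omega
  have hqo : Odd q := hq.odd_of_ne_two hq2
  have := Fact.mk hq
  have hqd : ¬ (q : ℤ) ∣ d := by
    intro h
    have := Nat.le_of_dvd (by omega) (Int.natCast_dvd_natCast.mp h)
    have := Nat.le_of_dvd (by omega) hdW
    omega
  have hqe : ¬ (q : ℤ) ∣ e := by
    intro h
    have h1 := Int.natAbs_dvd_natAbs.mpr h
    have h2 := Nat.le_of_dvd (by omega) h1
    have := Nat.le_of_dvd (by omega) hmW
    simp at h2
    omega
  have hlM : ∀ l : ℕ, l.Prime → l ≠ p → l ∣ W → l ∣ M := by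
    intro l hl hlp hlW
    rw [← hVM] at hlW
    rcases (Nat.Prime.dvd_mul hl).mp hlW with h | h
    · exact absurd ((Nat.prime_dvd_prime_iff_eq hl hp).mp (hl.dvd_of_dvd_pow h)) hlp
    · exact h
  have hqM : ∀ l : ℕ, l ∣ M → (q : ZMod l) = -p := by
    intro l hl
    have h1 : q ≡ k0 [MOD M] := hqW.of_dvd ⟨V, by rw [← hVM]; ring⟩
    have h2 : (q : ZMod M) = -p := by rw [← hk2']; exact (ZMod.natCast_eq_natCast_iff _ _ _).mpr h1
    have h3 := congrArg (ZMod.castHom hl (ZMod l)) h2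
    rwa [map_neg, map_natCast, map_natCast] at h3
  refine ⟨q, hq, hq2, hqd, hqe, hqp.ne', ?_, ?_, ?_, ?_⟩
  · intro hp2
    have hpV : p ∣ V := by
      apply dvd_pow_self
      rw [← Nat.pos_iff_ne_zero]
      apply hp.factorization_pos_of_dvd hW0
      rw [hW, hP, if_neg hp2]
      exact Dvd.intro_left _ rfl
    have : q ≡ r [MOD p] := ((hqW.of_dvd ⟨M, hVM.symm⟩).trans hk1).of_dvd hpV
    exact (ZMod.natCast_eq_natCast_iff _ _ _).mpr this
  · intro l hl hl2 hlp h
    apply hqM l (hlM l hl hlp _)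
    rcases h with h | h
    · exact (Int.natCast_dvd_natCast.mp h).trans hdW
    · refine dvd_trans ?_ hmW
      rcases hme with ⟨h', -⟩ | h'
      · rw [h', dvd_neg] at h
        exact Int.natCast_dvd_natCast.mp h
      · rw [h', neg_mul, dvd_neg] at h
        have h2 : l ∣ 2 * m := by exact_mod_cast h
        rcases (Nat.Prime.dvd_mul hl).mp h2 with h3 | h3
        · exact absurd ((Nat.prime_dvd_prime_iff_eq hl Nat.prime_two).mp h3) hl2
        · exact h3
  · apply ZMod.isSquare_of_jacobiSym_eq_one
    have hJ : jacobiSym q m = jacobiSym k0 m := by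
      apply jacobiSym.mod_left'
      exact_mod_cast hqW.of_dvd hmW
    have h8 : q % 8 = c % 8 := hq8
    rcases hc with ⟨h1, rfl⟩ | ⟨h1, ⟨h2, h3, rfl⟩ | ⟨h2, rfl⟩⟩
    · have hrec := jacobiSym.quadratic_reciprocity_one_mod_four (a := q) (b := m) (by omega) hmo
      have hn : jacobiSym (-m) q = 1 := by
        rw [jacobiSym.neg _ hqo, ZMod.χ₄_nat_one_mod_four (by omega), ← hrec, hJ, h1, one_mul]
      rcases hme with ⟨h', -⟩ | h'
      · rw [h', hn]
      · rw [h', neg_mul, ← mul_neg, jacobiSym.mul_left, hn, jacobiSym.at_two hqo,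
          ZMod.χ₈_nat_mod_eight, h8]
        decide
    · rw [h2, jacobiSym.neg _ hqo, ZMod.χ₄_nat_three_mod_four (by omega),
        jacobiSym.quadratic_reciprocity_one_mod_four h3 hqo, hJ, h1]
      norm_num
    · rw [h2, neg_mul, ← mul_neg, jacobiSym.mul_left, jacobiSym.neg _ hqo,
        ZMod.χ₄_nat_one_mod_four (by omega), jacobiSym.at_two hqo, ZMod.χ₈_nat_mod_eight, h8,
        ← jacobiSym.quadratic_reciprocity_one_mod_four (a := q) (b := m) (by omega) hmo, hJ, h1]
      decide
  · apply ZMod.isSquare_of_jacobiSym_eq_one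
    rw [jacobiSym_neg_of_three_mod_four hd hqo]
    have hdM : d ∣ M := by
      have h1 : d ∣ V * M := by rw [hVM]; exact hdW
      refine Nat.Coprime.dvd_of_dvd_mul_left ?_ h1
      exact Nat.Coprime.pow_right _ ((Nat.Prime.coprime_iff_not_dvd hp).mpr hpd).symm
    have h1 := hqM d hdM
    rw [← hin.jacobiSym hp hd]
    apply jacobiSym.mod_left'
    apply (ZMod.intCast_eq_intCast_iff _ _ d).mp
    push_cast
    exact h1

theorem padicInt_valuation_natCast_prime_ne {l q : ℕ} [hl : Fact l.Prime] (hq : q.Prime)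
    (h : l ≠ q) : ((q : ℕ) : ℚ_[l]).valuation = 0 := by
  rw [Padic.valuation_natCast, padicValNat.eq_zero_of_not_dvd, Nat.cast_zero]
  exact fun h' => h ((Nat.prime_dvd_prime_iff_eq hl.out hq).mp h')

theorem unitSign_intCast_eq_one {l : ℕ} [Fact l.Prime] {n : ℤ} (hn : ¬ (l : ℤ) ∣ n)
    (h : IsSquare (n : ZMod l)) : unitSign (n : ℚ_[l]) = 1 := by
  rw [unitSign_eq_one_iff, unitResidue_intCast hn]
  exact h

theorem valuation_intCast_of_not_dvd {l : ℕ} [Fact l.Prime] {n : ℤ} (hn : ¬ (l : ℤ) ∣ n) :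
    (n : ℚ_[l]).valuation = 0 := by
  rw [Padic.valuation_intCast, padicValInt.eq_zero_of_not_dvd hn, Nat.cast_zero]

theorem units_zpow_of_even {n : ℤ} (hn : Even n) (u : ℤˣ) : u ^ n = 1 := by
  obtain ⟨k, rfl⟩ := hn
  rw [zpow_add, Int.units_mul_self]

theorem units_zpow_of_odd {n : ℤ} (hn : Odd n) (u : ℤˣ) : u ^ n = u := by
  obtain ⟨k, rfl⟩ := hn
  rw [zpow_add, zpow_one, units_zpow_of_even (even_two_mul k), one_mul]

/-- If `e` has odd valuation, the symbol of `-pq` and `e` changes with the quadratic character of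
`q` modulo `p`, so a suitable residue exists. If the valuation is even, the hypothesis says that `e`
is not a square, and `-pq`, having valuation 1, has symbol `-1` with it for any `q`. -/
theorem exists_residue_tameSymbol {p : ℕ} [hp : Fact p.Prime] (hp2 : p ≠ 2) {a e : ℚ_[p]}
    (he0 : e ≠ 0) (h : tameSymbol p a e = -1) :
    ∃ r : ℕ, r.Coprime p ∧ ∀ q : ℕ, q.Prime → q ≠ p → (q : ZMod p) = r →
      tameSymbol p ((-(p * q) : ℤ) : ℚ_[p]) e = -1 := by
  have hp0 : (p : ℚ_[p]) ≠ 0 := by exact_mod_cast hp.out.ne_zero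
  have key : ∀ q : ℕ, q.Prime → q ≠ p → tameSymbol p ((-(p * q) : ℤ) : ℚ_[p]) e =
      tameSymbol p (-p) e * unitSign (q : ℚ_[p]) ^ e.valuation := by
    intro q hq hqp
    have hq0 : (q : ℚ_[p]) ≠ 0 := by exact_mod_cast hq.ne_zero
    have : ((-(p * q) : ℤ) : ℚ_[p]) = (-p) * q := by push_cast; ring
    rw [this, tameSymbol_mul_left (neg_ne_zero.mpr hp0) hq0,
      tameSymbol_of_unit (padicInt_valuation_natCast_prime_ne hq hqp.symm)]
  have hqd : ∀ q : ℕ, q.Prime → q ≠ p → ¬ (p : ℤ) ∣ (q : ℤ) := fun q hq hqp h' =>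
    hqp ((Nat.prime_dvd_prime_iff_eq hp.out hq).mp (Int.natCast_dvd_natCast.mp h')).symm
  rcases Int.even_or_odd e.valuation with hv | hv
  · refine ⟨1, Nat.coprime_one_left p, fun q hq hqp _ => ?_⟩
    rw [key q hq hqp, units_zpow_of_even hv, mul_one]
    have he : unitSign e = -1 := by
      rcases Int.units_eq_one_or (unitSign e) with h1 | h1
      · obtain ⟨s, rfl⟩ := isSquare_of_unitSign hp2 he0 hv h1
        have hs : s ≠ 0 := by rintro rfl; simp at he0
        rw [tameSymbol_comm, tameSymbol_mul_self_left hs] at h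
        exact absurd h (by decide)
      · exact h1
    have hvp : (-(p : ℚ_[p])).valuation = 1 := by rw [valuation_neg', Padic.valuation_p]
    rw [tameSymbol, hvp, he, one_mul, zpow_one, units_zpow_of_even hv, units_zpow_of_even hv]
    simp
  · rcases Int.units_eq_one_or (tameSymbol p (-p) e) with h1 | h1
    · obtain ⟨c, hc⟩ := FiniteField.exists_nonsquare (F := ZMod p) (by rwa [ZMod.ringChar_zmod_n])
      obtain ⟨r, rfl⟩ := ZMod.natCast_zmod_surjective c
      refine ⟨r, ?_, fun q hq hqp hqr => ?_⟩
      · refine ((Nat.Prime.coprime_iff_not_dvd hp.out).mpr fun hd => hc ?_).symm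
        rw [(ZMod.natCast_eq_zero_iff r p).mpr hd]
        exact IsSquare.zero
      · rw [key q hq hqp, h1, one_mul, units_zpow_of_odd hv]
        unfold unitSign
        have := unitResidue_intCast (l := p) (hqd q hq hqp)
        push_cast at this
        rw [this, hqr, if_neg hc]
    · refine ⟨1, Nat.coprime_one_left p, fun q hq hqp hqr => ?_⟩
      rw [key q hq hqp, h1, units_zpow_of_odd hv]
      have : unitSign (q : ℚ_[p]) = 1 := by
        have := unitSign_intCast_eq_one (l := p) (hqd q hq hqp) (by push_cast; rw [hqr]; simp)
        exact_mod_cast this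
      rw [this, mul_one]

/-- A number that is a unit at `l`, and a square modulo `l` if `l` divides `n`. -/
theorem tameSymbol_eq_one_of_isSquare {l : ℕ} [Fact l.Prime] {s n : ℤ} (hs : ¬ (l : ℤ) ∣ s)
    (h : (l : ℤ) ∣ n → IsSquare (s : ZMod l)) :
    tameSymbol l (s : ℚ_[l]) (n : ℚ_[l]) = 1 := by
  rw [tameSymbol_of_unit (valuation_intCast_of_not_dvd hs)]
  by_cases hd : (l : ℤ) ∣ n
  · rw [unitSign_intCast_eq_one hs (h hd), one_zpow]
  · rw [valuation_intCast_of_not_dvd hd, zpow_zero]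

theorem tameSymbol_neg_mul_prime {l m : ℕ} [hl : Fact l.Prime] (hm : m.Prime) (hlm : l ≠ m) {n : ℤ}
    (hn : ¬ (l : ℤ) ∣ n) :
    tameSymbol l ((-(l * m) : ℤ) : ℚ_[l]) (n : ℚ_[l]) = unitSign (n : ℚ_[l]) := by
  rw [tameSymbol_comm, tameSymbol_of_unit (valuation_intCast_of_not_dvd hn)]
  have hl0 : (l : ℚ_[l]) ≠ 0 := by exact_mod_cast hl.out.ne_zero
  have hm0 : (m : ℚ_[l]) ≠ 0 := by exact_mod_cast hm.ne_zero
  push_cast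
  rw [valuation_neg', Padic.valuation_mul hl0 hm0, Padic.valuation_p,
    padicInt_valuation_natCast_prime_ne hm hlm, add_zero, zpow_one]

/-- There is a number with prescribed tame symbols against `e` and `-d`. -/
theorem exists_tameSymbol_eq {d p : ℕ} (hp : p.Prime) (hd : d % 4 = 3)
    (hin : InertCondition d p) {a : ℚ} {e : ℤ} (he : e < 0) (he4 : e % 4 = 2 ∨ e % 4 = 3)
    (hae : ∀ (l : ℕ) [Fact l.Prime], l ≠ 2 → tameSymbol l (a : ℚ_[l]) (e : ℚ_[l]) =
      if l = p then -1 else 1) :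
    ∃ s : ℤ, s < 0 ∧ ∀ (l : ℕ) [Fact l.Prime], l ≠ 2 →
      tameSymbol l (s : ℚ_[l]) (e : ℚ_[l]) = (if l = p then -1 else 1) ∧
      tameSymbol l (s : ℚ_[l]) ((-d : ℤ) : ℚ_[l]) = (if l = p then -1 else 1) := by
  obtain ⟨r, hr, hrq⟩ : ∃ r : ℕ, r.Coprime p ∧ ∀ [Fact p.Prime], p ≠ 2 → ∀ q : ℕ, q.Prime → q ≠ p →
      (q : ZMod p) = r → tameSymbol p ((-(p * q) : ℤ) : ℚ_[p]) (e : ℚ_[p]) = -1 := by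
    by_cases hp2 : p = 2
    · exact ⟨1, Nat.coprime_one_left p, fun h => absurd hp2 h⟩
    · have := Fact.mk hp
      have h := hae p hp2
      rw [if_pos rfl] at h
      obtain ⟨r, hr, h'⟩ := exists_residue_tameSymbol hp2 (by exact_mod_cast he.ne) h
      exact ⟨r, hr, fun _ => h'⟩
  obtain ⟨q, hq, hq2, hqd, hqe, hqp, hqr, hqM, hsq1, hsq2⟩ :=
    exists_auxiliary_prime hp hd hin he he4 hr
  have hqd' : ¬ (q : ℤ) ∣ (-d : ℤ) := by rwa [dvd_neg]
  -- At a prime `l ≠ p` dividing `d e`, the congruence `q ≡ -p` makes `-pq` the square of `p`; at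
  -- `q`, both `e` and `-d` are squares; at `p`, inertness settles `-d` and the choice of `r`
  -- settles `e`.
  refine ⟨-(p * q), by
    have := hp.pos
    have := hq.pos
    rw [neg_lt_zero]
    positivity, fun l hl hl2 => ?_⟩
  by_cases hlp : l = p
  · subst hlp
    rw [if_pos rfl]
    refine ⟨hrq hl2 q hq hqp (hqr hl2), ?_⟩
    have hnd : ¬ (l : ℤ) ∣ (-d : ℤ) := by
      rw [dvd_neg, Int.natCast_dvd_natCast]
      exact hin.not_dvd hd
    rw [tameSymbol_neg_mul_prime hq (Ne.symm hqp) hnd]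
    unfold unitSign
    rw [unitResidue_intCast hnd, if_neg (hin.2 hl2)]
  rw [if_neg hlp]
  by_cases hlq : l = q
  · subst hlq
    have hcomm : (-(p * l) : ℤ) = -(l * p) := by ring
    rw [hcomm, tameSymbol_neg_mul_prime hp hlp hqe, tameSymbol_neg_mul_prime hp hlp hqd']
    exact ⟨unitSign_intCast_eq_one hqe hsq1, unitSign_intCast_eq_one hqd' hsq2⟩
  · have hns : ¬ (l : ℤ) ∣ (-(p * q) : ℤ) := by
      rw [dvd_neg]
      intro h
      rcases (Nat.Prime.dvd_mul hl.out).mp (by exact_mod_cast h) with h | h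
      · exact hlp ((Nat.prime_dvd_prime_iff_eq hl.out hp).mp h)
      · exact hlq ((Nat.prime_dvd_prime_iff_eq hl.out hq).mp h)
    have hs : (l : ℤ) ∣ d ∨ (l : ℤ) ∣ e → IsSquare (((-(p * q) : ℤ)) : ZMod l) := by
      intro h
      refine ⟨p, ?_⟩
      push_cast
      rw [hqM l hl.out hl2 hlp h]
      ring
    exact ⟨tameSymbol_eq_one_of_isSquare hns fun h => hs (Or.inr h),
      tameSymbol_eq_one_of_isSquare hns fun h => hs (Or.inl (by rwa [dvd_neg] at h))⟩

/-- The equation is `a X² + b Y² = -d U² + a b V²`, scaled so that `U = 1`. It suffices to find a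
common value `t` of the two binary forms. For `t = a b s`, the first form requires the symbol of `s`
and `-ab` to equal that of `a` and `b`; the second requires the symbols of `s` with `-ab` and with
`-d` to agree. The number `s` is built for this, and Legendre's theorem then applies to both conics.
-/
theorem exists_representation_aux {d p : ℕ} (hp : p.Prime) (hd : d % 4 = 3)
    (hin : InertCondition d p) {a b : ℚ} (ha : a < 0) (hb : b < 0) {e : ℤ} {k : ℚ} (hk : k ≠ 0)
    (hek : (e : ℚ) = -(a * b) * k ^ 2) (he4 : e % 4 = 2 ∨ e % 4 = 3)
    (hab : ∀ (l : ℕ) [Fact l.Prime], l ≠ 2 → tameSymbol l (a : ℚ_[l]) (b : ℚ_[l]) =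
      if l = p then -1 else 1) :
    ∃ x y z : ℚ, -(d : ℚ) = a * x ^ 2 + b * y ^ 2 - a * b * z ^ 2 := by
  have hab0 : 0 < a * b := mul_pos_of_neg_of_neg ha hb
  have hd0 : (0 : ℚ) < d := by
    have : 0 < d := by omega
    exact_mod_cast this
  have he : e < 0 := by
    have : (e : ℚ) < 0 := by
      rw [hek, neg_mul, neg_lt_zero]
      positivity
    exact_mod_cast this
  have cast_e : ∀ (l : ℕ) [Fact l.Prime], (e : ℚ_[l]) = -(a * b : ℚ_[l]) * (k : ℚ_[l]) ^ 2 := by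
    intro l _
    have := congrArg (fun q : ℚ => (q : ℚ_[l])) hek
    push_cast at this
    exact this
  have nz : ∀ (l : ℕ) [Fact l.Prime] (q : ℚ), q ≠ 0 → (q : ℚ_[l]) ≠ 0 := by
    intro l _ q hq
    exact_mod_cast hq
  have tame_e : ∀ (l : ℕ) [Fact l.Prime] (x : ℚ_[l]),
      tameSymbol l x (e : ℚ_[l]) = tameSymbol l x (-(a * b)) := by
    intro l _ x
    have h1 := nz l a ha.ne
    have h2 := nz l b hb.ne
    rw [cast_e, tameSymbol_mul_sq_right (by simp [h1, h2]) (nz l k hk)]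
  obtain ⟨s, hs, hsl⟩ := exists_tameSymbol_eq (a := a) hp hd hin he he4 (fun l _ hl => by
    have h1 := nz l a ha.ne
    have h2 := nz l b hb.ne
    rw [tame_e, ← neg_mul, tameSymbol_mul_right _ (neg_ne_zero.mpr h1) h2, tameSymbol_neg_self h1, one_mul]
    exact hab l hl)
  have hs0 : s ≠ 0 := hs.ne
  have hsq : (s : ℚ) < 0 := by exact_mod_cast hs
  set t : ℚ := a * b * s with ht
  have ht0 : t < 0 := mul_neg_of_pos_of_neg hab0 hsq
  have conic1 : ConicSolvable ℚ (a * t) (b * t) := by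
    apply legendre (mul_ne_zero ha.ne ht0.ne) (mul_ne_zero hb.ne ht0.ne)
      (Or.inl (mul_pos_of_neg_of_neg ha ht0))
    intro l _ hl
    have h1 := nz l a ha.ne
    have h2 := nz l b hb.ne
    have h3 : (s : ℚ_[l]) ≠ 0 := by exact_mod_cast hs0
    have e1 : ((a * t : ℚ) : ℚ_[l]) = (b * s : ℚ_[l]) * (a : ℚ_[l]) ^ 2 := by
      rw [ht]; push_cast; ring
    have e2 : ((b * t : ℚ) : ℚ_[l]) = (a * s : ℚ_[l]) * (b : ℚ_[l]) ^ 2 := by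
      rw [ht]; push_cast; ring
    rw [e1, e2, tameSymbol_mul_sq_left (by positivity) h1, tameSymbol_mul_sq_right (by positivity) h2,
      tameSymbol_mul_left h2 h3, tameSymbol_mul_right _ h1 h3, tameSymbol_mul_right _ h1 h3,
      tameSymbol_self h3, tameSymbol_comm (b : ℚ_[l]) s]
    have h5 := (hsl l hl).1
    rw [tame_e, ← neg_one_mul, tameSymbol_mul_right _ (by simp) (by positivity),
      tameSymbol_mul_right _ h1 h2] at h5
    have h6 := hab l hl
    rw [tameSymbol_comm] at h6
    rw [h6]
    calc _ = (if l = p then (-1 : ℤˣ) else 1) * (tameSymbol l (s : ℚ_[l]) (-1) *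
        (tameSymbol l (s : ℚ_[l]) a * tameSymbol l (s : ℚ_[l]) b)) := by ac_rfl
      _ = 1 := by rw [h5, Int.units_mul_self]
  have conic2 : ConicSolvable ℚ (-d * t) (a * b * t) := by
    apply legendre (mul_ne_zero (by linarith) ht0.ne) (mul_ne_zero hab0.ne' ht0.ne)
      (Or.inl (mul_pos_of_neg_of_neg (by linarith) ht0))
    intro l _ hl
    have h1 := nz l a ha.ne
    have h2 := nz l b hb.ne
    have h3 : (s : ℚ_[l]) ≠ 0 := by exact_mod_cast hs0
    have h4 : ((-d : ℤ) : ℚ_[l]) ≠ 0 := by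
      have : (-d : ℤ) ≠ 0 := by omega
      exact_mod_cast this
    have e2 : ((a * b * t : ℚ) : ℚ_[l]) = (s : ℚ_[l]) * (a * b : ℚ_[l]) ^ 2 := by
      rw [ht]; push_cast; ring
    have e1 : ((-d * t : ℚ) : ℚ_[l]) = ((-d : ℤ) : ℚ_[l]) * (-(a * b)) * (-1 * s) := by
      rw [ht]; push_cast; ring
    have h7 : -((a : ℚ_[l]) * b) ≠ 0 := by simp [h1, h2]
    rw [e1, e2, tameSymbol_mul_sq_right h3 (by positivity),
      tameSymbol_mul_left (by positivity) (by simpa), tameSymbol_mul_left h4 h7, neg_one_mul,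
      tameSymbol_comm (-(s : ℚ_[l])), tameSymbol_neg_self h3, mul_one,
      tameSymbol_comm _ (s : ℚ_[l]), tameSymbol_comm _ (s : ℚ_[l]), ← tame_e, (hsl l hl).1,
      (hsl l hl).2, Int.units_mul_self]
  obtain ⟨x, y, z, hne, h1⟩ := conic1
  obtain ⟨x', y', z', hne', h2⟩ := conic2
  have hz : z ≠ 0 := by
    rintro rfl
    have hat : 0 < a * t := mul_pos_of_neg_of_neg ha ht0
    have hbt : 0 < b * t := mul_pos_of_neg_of_neg hb ht0
    rcases hne with h | h | h
    · nlinarith [mul_pos hat (pow_pos (abs_pos.mpr h) 2), sq_abs x, mul_nonneg hbt.le (sq_nonneg y)]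
    · nlinarith [mul_pos hbt (pow_pos (abs_pos.mpr h) 2), sq_abs y, mul_nonneg hat.le (sq_nonneg x)]
    · exact h rfl
  by_cases hz' : z' = 0
  · subst hz'
    have h3 : -d * x' ^ 2 + a * b * y' ^ 2 = 0 := by
      apply mul_left_cancel₀ ht0.ne
      linear_combination -h2
    have hx' : x' ≠ 0 := by
      rintro rfl
      have : y' ≠ 0 := by
        rcases hne' with h | h | h
        · exact absurd rfl h
        · exact h
        · exact absurd rfl h
      have : 0 < a * b * y' ^ 2 := by positivity
      linarith
    refine ⟨0, 0, y' / x', ?_⟩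
    field_simp
    linear_combination h3
  · have r1 : t = a * (t * x / z) ^ 2 + b * (t * y / z) ^ 2 := by
      have h1' : z ^ 2 = t * (a * x ^ 2 + b * y ^ 2) := by rw [h1]; ring
      have hzz : t = t * z ^ 2 / z ^ 2 := by field_simp
      rw [hzz]
      nth_rewrite 1 [h1']
      clear_value t
      field_simp
    have r2 : t = -d * (t * x' / z') ^ 2 + a * b * (t * y' / z') ^ 2 := by
      have h2' : z' ^ 2 = t * (-d * x' ^ 2 + a * b * y' ^ 2) := by rw [h2]; ring
      have hzz : t = t * z' ^ 2 / z' ^ 2 := by field_simp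
      rw [hzz]
      nth_rewrite 1 [h2']
      clear_value t
      field_simp
    set X := t * x / z
    set Y := t * y / z
    set U := t * x' / z'
    set V := t * y' / z'
    -- The value `t` is negative while `a b V²` is not.
    have hU : U ≠ 0 := by
      intro h
      rw [h] at r2
      nlinarith [mul_nonneg hab0.le (sq_nonneg V)]
    refine ⟨X / U, Y / U, V / U, ?_⟩
    field_simp
    linear_combination r1 - r2

theorem exists_int_square_class {x : ℚ} (hx : x ≠ 0) :
    ∃ (c : ℤ) (k : ℚ), k ≠ 0 ∧ (c : ℚ) = x * k ^ 2 ∧ Squarefree c := by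
  obtain ⟨c, s, hc, hs, h⟩ := int_exists_squarefree_mul_sq (b := x.num * x.den)
    (mul_ne_zero (Rat.num_ne_zero.mpr hx) (by exact_mod_cast x.den_ne_zero))
  have hs' : (s : ℚ) ≠ 0 := by exact_mod_cast hs
  have hd : (x.den : ℚ) ≠ 0 := by exact_mod_cast x.den_ne_zero
  refine ⟨c, x.den / s, by positivity, ?_, hc⟩
  have h' : ((x.num * x.den : ℤ) : ℚ) = (c * s ^ 2 : ℤ) := by rw [h]
  push_cast at h'
  rw [(Rat.mul_den_eq_num x).symm] at h'
  field_simp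
  linear_combination -h'

/-- If a definite quaternion algebra has the local invariants of a quaternion algebra ramified
exactly at `p` and `∞`, its pure part represents the discriminants at which `p` is inert. -/
theorem exists_representation {d p : ℕ} (hp : p.Prime) (hd : d % 4 = 3)
    (hin : InertCondition d p) {a b : ℚ} (ha : a < 0) (hb : b < 0)
    (hab : ∀ (l : ℕ) [Fact l.Prime], l ≠ 2 → tameSymbol l (a : ℚ_[l]) (b : ℚ_[l]) =
      if l = p then -1 else 1) :
    ∃ x y z : ℚ, -(d : ℚ) = a * x ^ 2 + b * y ^ 2 - a * b * z ^ 2 := by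
  obtain ⟨a', k, hk, hak, hsa⟩ := exists_int_square_class ha.ne
  obtain ⟨b', m, hm, hbm, hsb⟩ := exists_int_square_class hb.ne
  have mod4 : ∀ c : ℤ, Squarefree c → c % 4 = 1 ∨ c % 4 = 2 ∨ c % 4 = 3 := by
    intro c hc
    have : c % 4 ≠ 0 := by
      intro h
      have h2 : (2 : ℤ) * 2 ∣ c := by omega
      have := hc 2 h2
      rw [Int.isUnit_iff] at this
      omega
    omega
  have ha0 : a ≠ 0 := ha.ne
  have hb0 : b ≠ 0 := hb.ne
  have hab0 : 0 < a * b := mul_pos_of_neg_of_neg ha hb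
  have nz : ∀ (l : ℕ) [Fact l.Prime] (q : ℚ), q ≠ 0 → (q : ℚ_[l]) ≠ 0 := by
    intro l _ q hq
    exact_mod_cast hq
  have swap : ∀ a b : ℚ, a < 0 → b < 0 → ∀ (l : ℕ) [Fact l.Prime],
      tameSymbol l (b : ℚ_[l]) ((-(a * b) : ℚ) : ℚ_[l]) = tameSymbol l (a : ℚ_[l]) (b : ℚ_[l]) := by
    intro a b ha hb l _
    have h1 := nz l a ha.ne
    have h2 := nz l b hb.ne
    push_cast
    rw [← mul_neg, tameSymbol_mul_right _ h1 (neg_ne_zero.mpr h2), tameSymbol_neg_self h2, mul_one,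
      tameSymbol_comm]
  -- The auxiliary statement needs the squarefree class of `-ab` to be 2 or 3 modulo 4. It is 3 if
  -- both classes are 1. Otherwise the generators are changed to `(a, -ab)` or `(b, -ab)`, which
  -- permutes the terms of the ternary form up to squares, keeps the symbols, and puts the class of
  -- `b` or of `a` in place of that of `-ab`.
  rcases mod4 a' hsa with h4 | h4
  · rcases mod4 b' hsb with h5 | h5
    · have hprod : a' * b' % 4 = 1 := by rw [Int.mul_emod, h4, h5]; rfl
      refine exists_representation_aux hp hd hin ha hb (e := -(a' * b')) (k := k * m)
        (by positivity) ?_ (by omega) hab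
      push_cast
      rw [hak, hbm]
      ring
    · obtain ⟨x, y, z, h⟩ := exists_representation_aux hp hd hin ha (b := -(b * a))
        (by linarith) (e := b') (k := m / a) (by positivity)
        (by rw [hbm]; field_simp) h5 (fun l _ hl => by
          rw [swap b a hb ha, tameSymbol_comm]
          exact hab l hl)
      exact ⟨x, a * z, y, by rw [h]; ring⟩
  · obtain ⟨x, y, z, h⟩ := exists_representation_aux hp hd hin hb (b := -(a * b))
      (by linarith) (e := a') (k := k / b) (by positivity)
      (by rw [hak]; field_simp) h4 (fun l _ hl => by
        rw [swap a b ha hb]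
        exact hab l hl)
    exact ⟨b * z, x, y, by rw [h]; ring⟩

end Representation

/-! ### Ramification and conics -/

section Ramification

theorem QuaternionAlgebra.mul_star_eq {F : Type} [Field F] {a b : F} (x : ℍ[F,a,b]) :
    x * star x = algebraMap F ℍ[F,a,b]
      (x.re ^ 2 - a * x.imI ^ 2 - b * x.imJ ^ 2 + a * b * x.imK ^ 2) := by
  generalize hn : x.re ^ 2 - a * x.imI ^ 2 - b * x.imJ ^ 2 + a * b * x.imK ^ 2 = n
  ext <;> simp <;> try rw [← hn]
  all_goals ring

theorem QuaternionAlgebra.star_mul_eq {F : Type} [Field F] {a b : F} (x : ℍ[F,a,b]) :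
    star x * x = algebraMap F ℍ[F,a,b]
      (x.re ^ 2 - a * x.imI ^ 2 - b * x.imJ ^ 2 + a * b * x.imK ^ 2) := by
  generalize hn : x.re ^ 2 - a * x.imI ^ 2 - b * x.imJ ^ 2 + a * b * x.imK ^ 2 = n
  ext <;> simp <;> try rw [← hn]
  all_goals ring

theorem QuaternionAlgebra.isUnit_iff_norm_ne_zero {F : Type} [Field F] {a b : F} (x : ℍ[F,a,b]) :
    IsUnit x ↔ x.re ^ 2 - a * x.imI ^ 2 - b * x.imJ ^ 2 + a * b * x.imK ^ 2 ≠ 0 := by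
  have h := QuaternionAlgebra.mul_star_eq x
  have h' := QuaternionAlgebra.star_mul_eq x
  set n := x.re ^ 2 - a * x.imI ^ 2 - b * x.imJ ^ 2 + a * b * x.imK ^ 2
  constructor
  · rintro hx h0
    rw [h0, map_zero] at h
    have h1 := hx.mul_right_eq_zero.mp h
    rw [star_eq_zero] at h1
    rw [h1] at hx
    exact not_isUnit_zero hx
  · intro hn
    refine ⟨⟨x, star x * algebraMap F _ n⁻¹, ?_, ?_⟩, rfl⟩
    · rw [← mul_assoc, h, ← map_mul, mul_inv_cancel₀ hn, map_one]
    · rw [mul_assoc, Algebra.commutes, ← mul_assoc, h', ← map_mul, mul_inv_cancel₀ hn, map_one]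

/-- Vanishing of the reduced norm reads `n(re + imI √a) = b · n(imJ + imK √a)` with `n(u + v√a) = u²
- a v²`. If the right-hand `n` is nonzero, multiplying the two elements gives a point; if it
vanishes, `a` alone already gives one. -/
theorem not_ramifiedAt_iff {F : Type} [Field F] {a b : ℚ} :
    ¬ RamifiedAt F a b ↔ ConicSolvable F a b := by
  unfold RamifiedAt
  push Not
  constructor
  · rintro ⟨x, hx, hu⟩
    rw [QuaternionAlgebra.isUnit_iff_norm_ne_zero, not_not] at hu
    by_cases h2 : x.imJ ^ 2 - a * x.imK ^ 2 = 0
    · have h1 : x.re ^ 2 = a * x.imI ^ 2 := by linear_combination hu + b * h2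
      by_cases hI : x.re = 0 ∧ x.imI = 0
      · refine ⟨x.imK, 0, x.imJ, ?_, by linear_combination h2⟩
        by_contra! hc
        exact hx (by ext <;> simp [hI, hc])
      · refine ⟨x.imI, 0, x.re, ?_, by linear_combination h1⟩
        by_contra! hc
        exact hI ⟨hc.2.2, hc.1⟩
    · refine ⟨x.re * x.imK + x.imI * x.imJ, x.imJ ^ 2 - a * x.imK ^ 2,
        x.re * x.imJ + a * x.imI * x.imK, Or.inr (Or.inl h2), ?_⟩
      linear_combination (x.imJ ^ 2 - a * x.imK ^ 2) * hu
  · rintro ⟨x, y, z, hne, h⟩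
    refine ⟨⟨z, x, y, 0⟩, fun h0 => ?_, ?_⟩
    · have h1 := congrArg QuaternionAlgebra.re h0
      have h2 := congrArg QuaternionAlgebra.imI h0
      have h3 := congrArg QuaternionAlgebra.imJ h0
      simp at h1 h2 h3
      simp_all
    · rw [QuaternionAlgebra.isUnit_iff_norm_ne_zero, not_not]
      simp only
      linear_combination h

theorem RamifiedExactlyAt.tameSymbol_eq {p : ℕ} {a b : ℚ} (h : RamifiedExactlyAt p a b) (l : ℕ)
    [Fact l.Prime] (hl : l ≠ 2) :
    tameSymbol l (a : ℚ_[l]) (b : ℚ_[l]) = if l = p then -1 else 1 := by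
  have ha : (a : ℚ_[l]) ≠ 0 := by exact_mod_cast h.left_ne_zero
  have hb : (b : ℚ_[l]) ≠ 0 := by exact_mod_cast h.right_ne_zero
  have h1 := h.finite l
  split_ifs with hlp
  · have h2 := h1.mpr hlp
    rcases Int.units_eq_one_or (tameSymbol l (a : ℚ_[l]) (b : ℚ_[l])) with h3 | h3
    · exact absurd h2 (not_ramifiedAt_iff.mpr (conicSolvable_of_tameSymbol hl ha hb h3))
    · exact h3
  · exact (not_ramifiedAt_iff.mp (mt h1.mp hlp)).tameSymbol_eq_one ha hb

/-! ### Norms from the unramified quadratic extension -/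

theorem valuation_eq_of_norm_eq {l : ℕ} [hl : Fact l.Prime] {x : ℚ_[l]} {k : ℤ}
    (h : ‖x‖ = (l : ℝ) ^ (-k)) : x.valuation = k := by
  have hl0 : (0 : ℝ) < l := by exact_mod_cast hl.out.pos
  have hx : x ≠ 0 := by
    rintro rfl
    rw [norm_zero] at h
    exact (zpow_pos hl0 _).ne h
  rw [Padic.norm_eq_zpow_neg_valuation hx] at h
  have h1 : (1 : ℝ) < l := by exact_mod_cast hl.out.one_lt
  have := zpow_right_injective₀ hl0 h1.ne' h
  omega

theorem PadicInt.toZMod_two_of_unit {w : ℤ_[2]} (hw : ‖w‖ = 1) : PadicInt.toZMod w = 1 := by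
  have h : PadicInt.toZMod w ≠ 0 := by
    rw [ne_eq, PadicInt.toZMod_eq_zero_iff_norm_lt_one, hw]
    exact lt_irrefl _
  generalize PadicInt.toZMod w = r at h
  fin_cases r
  · exact absurd rfl h
  · rfl

theorem PadicInt.norm_two_le_of_dvd {w : ℤ_[2]} {n : ℕ} (h : (2 : ℤ_[2]) ^ n ∣ w) :
    ‖w‖ ≤ (2 : ℝ) ^ (-n : ℤ) := by
  have := (PadicInt.norm_le_pow_iff_mem_span_pow w n).mpr (Ideal.mem_span_singleton.mpr
    (by exact_mod_cast h))
  exact_mod_cast this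

theorem PadicInt.two_dvd_sub_one {w : ℤ_[2]} (hw : ‖w‖ = 1) : (2 : ℤ_[2]) ∣ w - 1 := by
  have : ‖w - 1‖ < 1 := by
    rw [← PadicInt.toZMod_eq_zero_iff_norm_lt_one, map_sub, PadicInt.toZMod_two_of_unit hw, map_one,
      sub_self]
  have := (PadicInt.norm_lt_one_iff_dvd _).mp this
  exact_mod_cast this

theorem PadicInt.eight_dvd_sq_sub_one {w : ℤ_[2]} (hw : ‖w‖ = 1) : (2 : ℤ_[2]) ^ 3 ∣ w ^ 2 - 1 := by
  obtain ⟨s, hs⟩ := PadicInt.two_dvd_sub_one hw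
  have h2 : (2 : ℤ_[2]) ∣ s * (s + 1) := by
    rcases (PadicInt.norm_le_one s).lt_or_eq with h | h
    · have := (PadicInt.norm_lt_one_iff_dvd _).mp h
      exact Dvd.dvd.mul_right (by exact_mod_cast this) _
    · obtain ⟨r, hr⟩ := PadicInt.two_dvd_sub_one h
      exact Dvd.dvd.mul_left ⟨r + 1, by linear_combination hr⟩ _
  obtain ⟨r, hr⟩ := h2
  have hw' : w = 1 + 2 * s := by linear_combination hs
  exact ⟨r, by rw [hw']; linear_combination 4 * hr⟩

theorem PadicInt.isSquare_of_eight_dvd {w : ℤ_[2]} (h : (2 : ℤ_[2]) ^ 3 ∣ w - 1) : IsSquare w := by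
  have hn := PadicInt.norm_two_le_of_dvd h
  obtain ⟨z, hz, -⟩ := hensels_lemma (F := (Polynomial.X ^ 2 - Polynomial.C w : Polynomial ℤ_[2]))
    (a := 1) (by
      simp only [map_sub, map_pow, Polynomial.aeval_X, Polynomial.aeval_C, Polynomial.derivative_X_pow,
        Polynomial.derivative_C, sub_zero, map_mul]
      simp only [one_pow, Nat.cast_ofNat, mul_one]
      rw [norm_sub_rev]
      refine hn.trans_lt ?_
      have h3 : ‖((2 : ℕ) : ℤ_[2])‖ = 2⁻¹ := PadicInt.norm_p
      norm_num at h3 ⊢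
      rw [h3]
      norm_num)
  refine ⟨z, ?_⟩
  simp at hz
  rw [← sq]
  exact (sub_eq_zero.mp hz).symm

/-- For a 2-adic unit `u`, the number `-d + 4u` is 1 modulo 8 and hence a square, which gives the
point `(1, 2, z)`. -/
theorem conicSolvable_two_of_even {d : ℕ} (hd : d % 8 = 3) {c : ℚ_[2]} (hc : c ≠ 0)
    (hv : Even c.valuation) : ConicSolvable ℚ_[2] (-d) c := by
  obtain ⟨u, hu, hu'⟩ := Padic.exists_eq_unit_mul_zpow hc
  obtain ⟨k, hk⟩ := hv
  have h20 : ((2 : ℕ) : ℚ_[2]) ≠ 0 := by norm_num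
  obtain ⟨v, hv⟩ := PadicInt.two_dvd_sub_one hu
  obtain ⟨z, hz⟩ : IsSquare (-(d : ℤ_[2]) + 4 * u) := by
    apply PadicInt.isSquare_of_eight_dvd
    obtain ⟨m, hm⟩ : ∃ m, d = 8 * m + 3 := ⟨d / 8, by omega⟩
    refine ⟨v - m, ?_⟩
    rw [hm, show u = 1 + 2 * v by linear_combination hv]
    push_cast
    ring
  have hz' := congrArg (fun t : ℤ_[2] => (t : ℚ_[2])) hz
  push_cast at hz'
  apply ConicSolvable.of_mul_sq (s := 1) (t := ((2 : ℕ) : ℚ_[2]) ^ (-k)) one_ne_zero (zpow_ne_zero _ h20)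
  refine ⟨1, 2, z, by simp, ?_⟩
  have : c * (((2 : ℕ) : ℚ_[2]) ^ (-k)) ^ 2 = u := by
    conv_lhs => rw [hu', hk]
    rw [← zpow_natCast, ← zpow_mul, mul_assoc, ← zpow_add₀ h20,
      show k + k + -k * ((2 : ℕ) : ℤ) = 0 by push_cast; ring, zpow_zero, mul_one]
  rw [this, sq, ← hz', show ((4 : ℤ_[2]) : ℚ_[2]) = 4 from rfl]
  ring

/-- Odd squares are 1 modulo 8 and `d ≡ 3 mod 8`. So both values are units for a nonunit `w`, and
congruent to 4 modulo 8 for a unit `w`. These are the two normalisations of the norm form of the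
unramified extension of `ℚ_2`. -/
theorem even_valuation_sq_add_two {d : ℕ} (hd : d % 8 = 3) {w : ℚ_[2]} (hw : ‖w‖ ≤ 1) :
    (w ^ 2 + d ≠ 0 ∧ Even (w ^ 2 + d).valuation) ∧
      (1 + d * w ^ 2 ≠ 0 ∧ Even (1 + d * w ^ 2).valuation) := by
  obtain ⟨m, hm⟩ : ∃ m, d = 8 * m + 3 := ⟨d / 8, by omega⟩
  obtain ⟨w, rfl⟩ : ∃ v : ℤ_[2], (v : ℚ_[2]) = w := ⟨⟨w, hw⟩, rfl⟩
  have hdn : ‖(d : ℤ_[2])‖ = 1 := by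
    refine le_antisymm (PadicInt.norm_le_one _) (not_lt.mp fun h => ?_)
    have := (PadicInt.norm_int_lt_one_iff_dvd (p := 2) (d : ℤ)).mp (by exact_mod_cast h)
    omega
  have unit : ∀ x : ℤ_[2], ‖x‖ = 1 → ((x : ℚ_[2]) ≠ 0 ∧ Even ((x : ℚ_[2]).valuation)) := by
    intro x hx
    rw [PadicInt.norm_def] at hx
    refine ⟨?_, ?_⟩
    · intro h
      rw [h, norm_zero] at hx
      exact zero_ne_one hx
    · rw [valuation_eq_zero_of_norm_eq_one hx]
      exact Even.zero
  have four : ∀ x : ℤ_[2], (2 : ℤ_[2]) ^ 3 ∣ x - 4 →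
      ((x : ℚ_[2]) ≠ 0 ∧ Even ((x : ℚ_[2]).valuation)) := by
    intro x hx
    have h1 := PadicInt.norm_two_le_of_dvd hx
    have h2 : ‖(2 : ℤ_[2])‖ = 2⁻¹ := by
      have := PadicInt.norm_p (p := 2)
      exact_mod_cast this
    have h4 : ‖(4 : ℤ_[2])‖ = (4 : ℝ)⁻¹ := by
      rw [show (4 : ℤ_[2]) = 2 * 2 by norm_num, norm_mul, h2]
      norm_num
    have h3 : ‖x‖ = 4⁻¹ := by
      have := IsUltrametricDist.norm_add_eq_max_of_norm_ne_norm (x := x - 4) (y := (4 : ℤ_[2]))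
        (by
          rw [h4]
          refine (h1.trans_lt ?_).ne
          norm_num)
      rw [sub_add_cancel, h4, max_eq_right (h1.trans (by norm_num))] at this
      exact this
    rw [PadicInt.norm_def] at h3
    refine ⟨?_, ?_⟩
    · intro h
      rw [h] at h3
      norm_num at h3
    · have : (x : ℚ_[2]).valuation = 2 := by
        apply valuation_eq_of_norm_eq
        rw [h3]
        norm_num
      rw [this]
      exact even_two
  rcases hw.lt_or_eq with h | h
  · have hsq : ‖w ^ 2‖ < 1 := by
      rw [norm_pow]
      exact pow_lt_one₀ (norm_nonneg _) h two_ne_zero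
    have hdw : ‖(d : ℤ_[2]) * w ^ 2‖ < 1 := by
      rw [norm_mul, hdn, one_mul]
      exact hsq
    have e1 : ‖w ^ 2 + (d : ℤ_[2])‖ = 1 := by
      rw [IsUltrametricDist.norm_add_eq_max_of_norm_ne_norm (by rw [hdn]; exact hsq.ne), hdn,
        max_eq_right hsq.le]
    have e2 : ‖1 + (d : ℤ_[2]) * w ^ 2‖ = 1 := by
      rw [IsUltrametricDist.norm_add_eq_max_of_norm_ne_norm (by rw [norm_one]; exact hdw.ne'), norm_one,
        max_eq_left hdw.le]
    have u1 := unit _ e1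
    have u2 := unit _ e2
    push_cast at u1 u2
    exact ⟨u1, u2⟩
  · obtain ⟨r, hr⟩ := PadicInt.eight_dvd_sq_sub_one (w := w) h
    have u1 := four (w ^ 2 + (d : ℤ_[2])) ⟨r + m, by
      rw [hm]; push_cast; linear_combination hr⟩
    have u2 := four (1 + (d : ℤ_[2]) * w ^ 2) ⟨d * r + m, by
      have hd' : (d : ℤ_[2]) = 8 * m + 3 := by rw [hm]; push_cast; rfl
      linear_combination (d : ℤ_[2]) * hr + hd'⟩
    push_cast at u1 u2
    exact ⟨u1, u2⟩

theorem even_of_conicSolvable_two {d : ℕ} (hd : d % 8 = 3) {c : ℚ_[2]} (hc : c ≠ 0)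
    (h : ConicSolvable ℚ_[2] (-d) c) : Even c.valuation := by
  obtain ⟨x, y, z, hne, h⟩ := h
  have key : (x ≠ 0 ∨ z ≠ 0) → (z ^ 2 + d * x ^ 2 ≠ 0 ∧ Even (z ^ 2 + d * x ^ 2).valuation) := by
    intro hxz
    rcases le_total ‖x‖ ‖z‖ with hle | hle
    · have hz : z ≠ 0 := by
        rintro rfl
        simp at hle
        simp [hle] at hxz
      have hw : ‖x / z‖ ≤ 1 := by
        rw [norm_div]
        exact div_le_one_of_le₀ hle (norm_nonneg _)
      obtain ⟨-, h1, h2⟩ := even_valuation_sq_add_two hd hw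
      have e : z ^ 2 + d * x ^ 2 = (1 + d * (x / z) ^ 2) * z ^ 2 := by
        field_simp
      rw [e]
      refine ⟨mul_ne_zero h1 (by positivity), ?_⟩
      rw [Padic.valuation_mul h1 (by positivity), Padic.valuation_pow]
      exact h2.add (even_two_mul _)
    · have hx : x ≠ 0 := by
        rintro rfl
        simp at hle
        simp [hle] at hxz
      have hw : ‖z / x‖ ≤ 1 := by
        rw [norm_div]
        exact div_le_one_of_le₀ hle (norm_nonneg _)
      obtain ⟨⟨h1, h2⟩, -⟩ := even_valuation_sq_add_two hd hw
      have e : z ^ 2 + d * x ^ 2 = ((z / x) ^ 2 + d) * x ^ 2 := by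
        field_simp
      rw [e]
      refine ⟨mul_ne_zero h1 (by positivity), ?_⟩
      rw [Padic.valuation_mul h1 (by positivity), Padic.valuation_pow]
      exact h2.add (even_two_mul _)
  have e : z ^ 2 + d * x ^ 2 = c * y ^ 2 := by linear_combination h
  rw [e] at key
  have hxz : x ≠ 0 ∨ z ≠ 0 := by
    by_contra! hcon
    rw [hcon.1, hcon.2] at e hne
    have hy : y ≠ 0 := by simpa using hne
    have : c * y ^ 2 ≠ 0 := by positivity
    apply this
    rw [← e]; ring
  obtain ⟨h1, h2⟩ := key hxz
  have hy : y ≠ 0 := by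
    rintro rfl
    simp at h1
  rw [Padic.valuation_mul hc (by positivity), Padic.valuation_pow] at h2
  exact (Int.even_add.mp h2).mpr (even_two_mul _)

/-- At an inert prime, the conic `z² = -d x² + c y²` is solvable iff `c` has even valuation. -/
theorem conicSolvable_iff_even_of_inert {d l : ℕ} [hl : Fact l.Prime] (hd : d % 4 = 3)
    (hin : InertCondition d l) {c : ℚ} (hc : c ≠ 0) :
    ConicSolvable ℚ_[l] (-d) c ↔ Even (padicValRat l c) := by
  have hc' : (c : ℚ_[l]) ≠ 0 := by exact_mod_cast hc
  rw [← Padic.valuation_ratCast]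
  by_cases hl2 : l = 2
  · subst hl2
    exact ⟨even_of_conicSolvable_two (hin.1 rfl) hc', conicSolvable_two_of_even (hin.1 rfl) hc'⟩
  · have hnd : ¬ (l : ℤ) ∣ (-d : ℤ) := by
      rw [dvd_neg, Int.natCast_dvd_natCast]
      exact hin.not_dvd hd
    have hd0 : (-d : ℚ_[l]) ≠ 0 := by
      have : (-d : ℤ) ≠ 0 := by omega
      exact_mod_cast this
    have h1 : unitSign (-d : ℚ_[l]) = -1 := by
      have : unitSign ((-d : ℤ) : ℚ_[l]) = -1 := by
        unfold unitSign
        rw [unitResidue_intCast hnd, if_neg (hin.2 hl2)]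
      exact_mod_cast this
    have h0 : (-d : ℚ_[l]).valuation = 0 := by
      have := valuation_intCast_of_not_dvd hnd
      exact_mod_cast this
    have h2 : tameSymbol l (-d : ℚ_[l]) c = (-1) ^ (c : ℚ_[l]).valuation := by
      rw [tameSymbol_of_unit h0, h1]
    constructor
    · intro h
      have h3 := h.tameSymbol_eq_one hd0 hc'
      rw [h2] at h3
      by_contra hodd
      rw [Int.not_even_iff_odd] at hodd
      rw [units_zpow_of_odd hodd] at h3
      exact absurd h3 (by decide)
    · intro h
      apply conicSolvable_of_tameSymbol hl2 hd0 hc'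
      rw [h2, units_zpow_of_even h]

end Ramification

/-! ### Imaginary quadratic fields of odd discriminant -/

section QuadraticField

open NumberField

/-- An imaginary quadratic field with coordinates `x + y √-d`, where `-d` is its discriminant and is
odd. -/
structure QuadraticModel (K : Type*) [Field K] [NumberField K] where
  d : ℕ
  e : K ≃ₐ[ℚ] QuadraticAlgebra ℚ (-(d : ℚ)) 0
  mod_four : d % 4 = 3
  squarefree : Squarefree d
  discr_eq : discr K = -d
  isIntegral_iff : ∀ x : K, IsIntegral ℤ x ↔ ∃ r s : ℤ, e x = ⟨r + s / 2, s / 2⟩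

variable {K : Type*} [Field K] [NumberField K]

/-- A common divisor `g` of the coordinates of 1 is a unit of the ring, so its norm `g²` is a unit
and `g = 1`. A Bézout relation then completes 1 to a basis. -/
theorem exists_basis_one (hK : Module.finrank ℚ K = 2) :
    ∃ b : Module.Basis (Fin 2) ℤ (𝓞 K), b 0 = 1 := by
  have hfr : Module.finrank ℤ (𝓞 K) = 2 := by rw [RingOfIntegers.rank, hK]
  let b := Module.finBasisOfFinrankEq ℤ (𝓞 K) hfr
  set m := b.repr 1 0 with hm
  set n := b.repr 1 1 with hn
  have h1 : m • b 0 + n • b 1 = 1 := by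
    have := b.sum_repr 1
    rwa [Fin.sum_univ_two] at this
  have hcop : IsCoprime m n := by
    rw [Int.isCoprime_iff_gcd_eq_one]
    by_contra hg
    set g := Int.gcd m n with hgdef
    obtain ⟨m', hm'⟩ := Int.gcd_dvd_left (a := m) (b := n)
    obtain ⟨n', hn'⟩ := Int.gcd_dvd_right (a := m) (b := n)
    have h2 : (g : 𝓞 K) * (m' • b 0 + n' • b 1) = 1 := by
      have hmg : (m : 𝓞 K) = (g : 𝓞 K) * m' := by exact_mod_cast congrArg (Int.cast (R := 𝓞 K)) hm'
      have hng : (n : 𝓞 K) = (g : 𝓞 K) * n' := by exact_mod_cast congrArg (Int.cast (R := 𝓞 K)) hn'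
      simp only [zsmul_eq_mul] at h1 ⊢
      linear_combination h1 - b 0 * hmg - b 1 * hng
    have hu : IsUnit ((g : ℤ) : 𝓞 K) := IsUnit.of_mul_eq_one _ (by exact_mod_cast h2)
    have h3 := hu.map (Algebra.norm ℤ)
    rw [show ((g : ℤ) : 𝓞 K) = algebraMap ℤ (𝓞 K) g by simp, Algebra.norm_algebraMap, hfr] at h3
    have h4 := isUnit_of_dvd_unit (dvd_pow_self (g : ℤ) two_ne_zero) h3
    rw [Int.isUnit_iff] at h4
    omega
  obtain ⟨u, v, huv⟩ := hcop
  set c := -v • b 0 + u • b 1 with hc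
  have hspan : ⊤ ≤ Submodule.span ℤ (Set.range ![(1 : 𝓞 K), c]) := by
    rintro x -
    have hx := b.sum_repr x
    rw [Fin.sum_univ_two] at hx
    rw [Matrix.range_cons, Matrix.range_cons, Matrix.range_empty, Set.union_empty,
      Set.singleton_union, Submodule.mem_span_pair]
    refine ⟨u * b.repr x 0 + v * b.repr x 1, -n * b.repr x 0 + m * b.repr x 1, ?_⟩
    conv_rhs => rw [← hx]
    rw [← h1, hc]
    have huv' : ((u : ℤ) : 𝓞 K) * m + v * n = 1 := by exact_mod_cast huv
    simp only [zsmul_eq_mul]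
    push_cast
    linear_combination ((b.repr x 0 : 𝓞 K) * b 0 + (b.repr x 1 : 𝓞 K) * b 1) * huv'
  have hli : LinearIndependent ℤ ![(1 : 𝓞 K), c] := by
    apply linearIndependent_of_top_le_span_of_card_eq_finrank hspan
    simp [hfr]
  exact ⟨Module.Basis.mk hli hspan, by simp⟩

/-- In a basis `1, w` the discriminant is `t² + 4n` with `t` the trace of `w`. It is odd only if `t
= 2k + 1`, and then `w - k` has trace 1. -/
theorem exists_quadratic_generator (hK : Module.finrank ℚ K = 2) (hodd : Odd (discr K)) :
    ∃ (ω : 𝓞 K) (n : ℤ), ω * ω = ω - n ∧ discr K = 1 - 4 * n ∧ ∀ x : 𝓞 K, ∃ r s : ℤ, x = r + s * ω := by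
  obtain ⟨b, hb⟩ := exists_basis_one hK
  have hfr : Module.finrank ℤ (𝓞 K) = 2 := by rw [RingOfIntegers.rank, hK]
  set w := b 1 with hw
  set n := b.repr (w * w) 0 with hn
  set t := b.repr (w * w) 1 with ht
  have hww : w * w = n + t * w := by
    have := b.sum_repr (w * w)
    rw [Fin.sum_univ_two, hb] at this
    rw [← this]
    simp only [zsmul_eq_mul, mul_one, hn, ht, hw]
  have htr1 : Algebra.trace ℤ (𝓞 K) 1 = 2 := by
    have := Algebra.trace_algebraMap (S := 𝓞 K) (1 : ℤ)
    rw [map_one, hfr] at this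
    simpa using this
  have hrw : b.repr w = Finsupp.single 1 1 := by rw [hw, b.repr_self]
  have htrw : Algebra.trace ℤ (𝓞 K) w = t := by
    rw [Algebra.trace_eq_matrix_trace b, Matrix.trace, Fin.sum_univ_two]
    simp [Algebra.leftMulMatrix_eq_repr_mul, hb, hrw, ← hw, ← ht]
  have htrww : Algebra.trace ℤ (𝓞 K) (w * w) = 2 * n + t * t := by
    rw [hww, map_add]
    have e1 : (n : 𝓞 K) = n • 1 := by simp
    have e2 : (t : 𝓞 K) * w = t • w := by simp
    rw [e1, e2, map_zsmul, map_zsmul, htr1, htrw]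
    simp [mul_comm]
  have hdisc : discr K = t * t + 4 * n := by
    rw [← discr_eq_discr K b, Algebra.discr_def, Matrix.det_fin_two]
    simp only [Algebra.traceMatrix_apply, Algebra.traceForm_apply, hb, ← hw, one_mul, mul_one]
    rw [htr1, htrw, htrww]
    ring
  have htodd : Odd t := by
    rw [hdisc] at hodd
    by_contra hev
    rw [Int.not_odd_iff_even] at hev
    have : Even (t * t + 4 * n) := (hev.mul_left t).add ⟨2 * n, by ring⟩
    exact (Int.not_odd_iff_even.mpr this) hodd
  obtain ⟨k, hk⟩ := htodd
  refine ⟨w - k, -(n + k ^ 2 + k), ?_, ?_, ?_⟩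
  · have hk' : (t : 𝓞 K) = 2 * k + 1 := by exact_mod_cast hk
    push_cast
    linear_combination hww + w * hk'
  · rw [hdisc, hk]; ring
  · intro x
    have := b.sum_repr x
    rw [Fin.sum_univ_two, hb, ← hw] at this
    refine ⟨b.repr x 0 + b.repr x 1 * k, b.repr x 1, ?_⟩
    conv_lhs => rw [← this]
    simp only [zsmul_eq_mul]
    push_cast
    ring

theorem exists_quadraticModel (hK : Module.finrank ℚ K = 2) (hD : discr K < 0)
    (hodd : Odd (discr K)) : Nonempty (QuadraticModel K) := by
  obtain ⟨ω, n, hω, hdisc, hspan⟩ := exists_quadratic_generator hK hodd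
  obtain ⟨d, hd⟩ : ∃ d : ℕ, (d : ℤ) = 4 * n - 1 := ⟨(4 * n - 1).toNat, by omega⟩
  have hdpos : 0 < d := by omega
  have hd4 : d % 4 = 3 := by omega
  have hdq : (d : ℚ) = 4 * n - 1 := by exact_mod_cast hd
  have hδ : (2 * (ω : K) - 1) * (2 * (ω : K) - 1) = (-(d : ℚ)) • (1 : K) + (0 : ℚ) • (2 * (ω : K) - 1) := by
    have h1 : (ω : K) * ω = ω - n := by
      have := congrArg (fun x : 𝓞 K => (x : K)) hω
      simpa using this
    have h2 : ((d : ℚ) : K) = 4 * n - 1 := by rw [hdq]; push_cast; rfl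
    rw [zero_smul, add_zero, Algebra.smul_def, mul_one]
    simp only [map_neg, eq_ratCast, h2]
    linear_combination 4 * h1
  let f : QuadraticAlgebra ℚ (-(d : ℚ)) 0 →ₐ[ℚ] K := QuadraticAlgebra.lift ⟨_, hδ⟩
  have hf : ∀ x, f x = (x.re : K) + x.im * (2 * (ω : K) - 1) := by
    intro x
    change QuadraticAlgebra.lift ⟨_, hδ⟩ x = _
    simp [QuadraticAlgebra.lift, Algebra.smul_def]
  have hinj : Function.Injective f := by
    rw [injective_iff_map_eq_zero]
    intro x hx
    have h1 : f (x * star x) = 0 := by rw [map_mul, hx, zero_mul]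
    rw [← QuadraticAlgebra.algebraMap_norm_eq_mul_star, AlgHom.commutes] at h1
    have h2 : QuadraticAlgebra.norm x = 0 := (algebraMap ℚ K).injective (by rw [h1, map_zero])
    rw [QuadraticAlgebra.norm_def] at h2
    have hdq0 : (0 : ℚ) < d := by exact_mod_cast hdpos
    have h3 : x.re = 0 ∧ x.im = 0 := by
      constructor
      · have : x.re ^ 2 = 0 := by nlinarith [sq_nonneg x.re, mul_nonneg hdq0.le (sq_nonneg x.im)]
        simpa using this
      · have : d * x.im ^ 2 = 0 := by nlinarith [sq_nonneg x.re, mul_nonneg hdq0.le (sq_nonneg x.im)]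
        simpa [hdq0.ne'] using this
    ext <;> simp [h3]
  have hbij : Function.Bijective f := by
    refine ⟨hinj, ?_⟩
    have hfin : Module.finrank ℚ (QuadraticAlgebra ℚ (-(d : ℚ)) 0) = Module.finrank ℚ K := by
      rw [QuadraticAlgebra.finrank_eq_two, hK]
    exact (LinearMap.injective_iff_surjective_of_finrank_eq_finrank (f := f.toLinearMap) hfin).mp hinj
  let e := (AlgEquiv.ofBijective f hbij).symm
  have hint : ∀ x : K, IsIntegral ℤ x ↔ ∃ r s : ℤ, e x = ⟨r + s / 2, s / 2⟩ := by
    intro x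
    have hmk : ∀ r s : ℤ, f ⟨r + s / 2, s / 2⟩ = ((r + s * ω : 𝓞 K) : K) := by
      intro r s
      rw [hf]
      change _ = algebraMap (𝓞 K) K (r + s * ω)
      rw [map_add, map_mul, map_intCast, map_intCast]
      push_cast
      ring
    constructor
    · intro hx
      obtain ⟨r, s, hrs⟩ := hspan ⟨x, hx⟩
      refine ⟨r, s, ?_⟩
      have : x = f ⟨r + s / 2, s / 2⟩ := by
        rw [hmk, ← hrs]
        rfl
      rw [this]
      exact (AlgEquiv.ofBijective f hbij).symm_apply_apply _
    · rintro ⟨r, s, hrs⟩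
      have : x = f ⟨r + s / 2, s / 2⟩ := by
        rw [← hrs]
        exact ((AlgEquiv.ofBijective f hbij).apply_symm_apply x).symm
      rw [this, hmk]
      exact RingOfIntegers.isIntegral_coe _
  refine ⟨⟨d, e, hd4, ?_, by rw [hdisc]; omega, hint⟩⟩
  -- If `d = l² k`, then `k ≡ 3 mod 4`, and `(1 + √-d / l) / 2` is a root of `X² - X + (k + 1)/4`.
  -- It is integral but its coordinates are not those of an integer of `K`.
  rw [Nat.squarefree_iff_prime_squarefree]
  rintro l hl ⟨k, hk⟩
  have hl2 : l ≠ 2 := by rintro rfl; omega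
  have hlo : l % 2 = 1 := Nat.odd_iff.mp (hl.odd_of_ne_two hl2)
  have hll : l * l % 4 = 1 := by
    rcases (by omega : l % 4 = 1 ∨ l % 4 = 3) with h | h <;> rw [Nat.mul_mod, h]
  have hk4 : k % 4 = 3 := by
    rw [hk, Nat.mul_mod, hll] at hd4
    omega
  obtain ⟨m, hm⟩ : ∃ m : ℕ, k + 1 = 4 * m := ⟨(k + 1) / 4, by omega⟩
  have hl0 : (l : ℚ) ≠ 0 := by exact_mod_cast hl.ne_zero
  let z : QuadraticAlgebra ℚ (-(d : ℚ)) 0 := ⟨1 / 2, 1 / (2 * l)⟩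
  have hz : z * z - z + algebraMap ℚ _ (m : ℚ) = 0 := by
    have hm' : (k : ℚ) = 4 * m - 1 := by
      have : (k : ℚ) + 1 = 4 * m := by exact_mod_cast hm
      linarith
    have hdk : (d : ℚ) = l * l * (4 * m - 1) := by
      rw [← hm']
      exact_mod_cast hk
    ext
    · simp [z, hdk]
      field_simp
      ring
    · simp [z]
      field_simp
      ring
  have hzi : IsIntegral ℤ (f z) := by
    refine ⟨Polynomial.X ^ 2 - Polynomial.X + Polynomial.C (m : ℤ), by monicity!, ?_⟩
    have := congrArg f hz
    rw [map_add, map_sub, map_mul, map_zero, AlgHom.commutes] at this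
    simp only [Polynomial.eval₂_add, Polynomial.eval₂_sub, Polynomial.eval₂_pow, Polynomial.eval₂_X,
      Polynomial.eval₂_C]
    rw [← this]
    simp [sq]
  obtain ⟨r, s, hrs⟩ := (hint _).mp hzi
  have h1 : e (f z) = z := (AlgEquiv.ofBijective f hbij).symm_apply_apply z
  rw [h1] at hrs
  have h2 := congrArg QuadraticAlgebra.im hrs
  simp only [z] at h2
  have h3 : (1 : ℚ) = s * l := by
    field_simp at h2
    linarith
  have h4 : (1 : ℤ) = s * l := by exact_mod_cast h3
  have h5 : (l : ℤ) ∣ 1 := ⟨s, by rw [h4]; ring⟩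
  have := Int.natCast_dvd_natCast.mp (by exact_mod_cast h5 : (l : ℤ) ∣ (1 : ℕ))
  exact hl.one_lt.ne' (Nat.dvd_one.mp this)

end QuadraticField

/-! ### Coordinates, conjugation and norms of ideals in the quadratic field -/

section QuadraticIdeals

open NumberField

/-- Fractional ideals of a number field. -/
abbrev FracIdeal (K : Type*) [Field K] [NumberField K] := FractionalIdeal (nonZeroDivisors (𝓞 K)) K

namespace QuadraticModel

variable {K : Type*} [Field K] [NumberField K] (m : QuadraticModel K)

theorem d_pos : 0 < m.d := by have := m.mod_four; omega

theorem d_pos_rat : (0 : ℚ) < m.d := by exact_mod_cast m.d_pos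

noncomputable def re (x : K) : ℚ := (m.e x).re
noncomputable def im (x : K) : ℚ := (m.e x).im
noncomputable def ofCoords (r s : ℚ) : K := m.e.symm ⟨r, s⟩

@[simp] theorem re_ofCoords (r s : ℚ) : m.re (m.ofCoords r s) = r := by simp [re, ofCoords]
@[simp] theorem im_ofCoords (r s : ℚ) : m.im (m.ofCoords r s) = s := by simp [im, ofCoords]
@[simp] theorem re_add (x y : K) : m.re (x + y) = m.re x + m.re y := by simp [re]
@[simp] theorem im_add (x y : K) : m.im (x + y) = m.im x + m.im y := by simp [im]
@[simp] theorem re_sub (x y : K) : m.re (x - y) = m.re x - m.re y := by simp [re]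
@[simp] theorem im_sub (x y : K) : m.im (x - y) = m.im x - m.im y := by simp [im]
@[simp] theorem re_neg (x : K) : m.re (-x) = -m.re x := by simp [re]
@[simp] theorem im_neg (x : K) : m.im (-x) = -m.im x := by simp [im]
@[simp] theorem re_mul (x y : K) : m.re (x * y) = m.re x * m.re y - m.d * (m.im x * m.im y) := by
  simp [re, im]; ring
@[simp] theorem im_mul (x y : K) : m.im (x * y) = m.re x * m.im y + m.im x * m.re y := by
  simp [re, im]
@[simp] theorem re_ratCast (q : ℚ) : m.re (q : K) = q := by
  have := m.e.commutes q
  simp only [re, eq_ratCast] at *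
  rw [this]; rfl
@[simp] theorem im_ratCast (q : ℚ) : m.im (q : K) = 0 := by
  have := m.e.commutes q
  simp only [im, eq_ratCast] at *
  rw [this]; rfl
@[simp] theorem re_intCast (q : ℤ) : m.re (q : K) = q := by
  have := m.re_ratCast q; rwa [Rat.cast_intCast] at this
@[simp] theorem im_intCast (q : ℤ) : m.im (q : K) = 0 := by
  have := m.im_ratCast q; rwa [Rat.cast_intCast] at this
@[simp] theorem re_natCast (q : ℕ) : m.re (q : K) = q := by
  have := m.re_ratCast q; rwa [Rat.cast_natCast] at this
@[simp] theorem im_natCast (q : ℕ) : m.im (q : K) = 0 := by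
  have := m.im_ratCast q; rwa [Rat.cast_natCast] at this
@[simp] theorem re_zero : m.re 0 = 0 := by simp [re]
@[simp] theorem im_zero : m.im 0 = 0 := by simp [im]
@[simp] theorem re_one : m.re 1 = 1 := by simpa using m.re_natCast 1
@[simp] theorem im_one : m.im 1 = 0 := by simpa using m.im_natCast 1
@[simp] theorem re_smul (q : ℚ) (x : K) : m.re (q • x) = q * m.re x := by
  rw [Algebra.smul_def]; simp
@[simp] theorem im_smul (q : ℚ) (x : K) : m.im (q • x) = q * m.im x := by
  rw [Algebra.smul_def]; simp

theorem ext {x y : K} (h1 : m.re x = m.re y) (h2 : m.im x = m.im y) : x = y :=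
  m.e.injective (QuadraticAlgebra.ext h1 h2)

/-- Complex conjugation. -/
noncomputable def conj : K ≃ₐ[ℚ] K :=
  AlgEquiv.ofAlgHom
    { toFun := fun x => m.ofCoords (m.re x) (-m.im x)
      map_one' := m.ext (by simp) (by simp)
      map_mul' := fun x y => m.ext (by simp) (by simp; ring)
      map_zero' := m.ext (by simp) (by simp)
      map_add' := fun x y => m.ext (by simp) (by simp; ring)
      commutes' := fun q => m.ext (by simp) (by simp) }
    { toFun := fun x => m.ofCoords (m.re x) (-m.im x)
      map_one' := m.ext (by simp) (by simp)
      map_mul' := fun x y => m.ext (by simp) (by simp; ring)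
      map_zero' := m.ext (by simp) (by simp)
      map_add' := fun x y => m.ext (by simp) (by simp; ring)
      commutes' := fun q => m.ext (by simp) (by simp) }
    (AlgHom.ext fun x => m.ext (by simp) (by simp)) (AlgHom.ext fun x => m.ext (by simp) (by simp))

@[simp] theorem re_conj (x : K) : m.re (m.conj x) = m.re x := m.re_ofCoords _ _
@[simp] theorem im_conj (x : K) : m.im (m.conj x) = -m.im x := m.im_ofCoords _ _
@[simp] theorem conj_conj (x : K) : m.conj (m.conj x) = x := m.ext (by simp) (by simp)

/-- The norm to `ℚ`. -/
noncomputable def nrm (x : K) : ℚ := m.re x ^ 2 + m.d * m.im x ^ 2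

theorem mul_conj (x : K) : x * m.conj x = (m.nrm x : K) :=
  m.ext (by rw [re_ratCast]; simp only [re_mul, re_conj, im_conj, nrm]; ring)
    (by rw [im_ratCast]; simp; ring)

theorem nrm_mul (x y : K) : m.nrm (x * y) = m.nrm x * m.nrm y := by simp [nrm]; ring

@[simp] theorem nrm_conj (x : K) : m.nrm (m.conj x) = m.nrm x := by simp [nrm]

theorem nrm_nonneg (x : K) : 0 ≤ m.nrm x := by
  have := m.d_pos_rat
  unfold nrm
  positivity

theorem nrm_eq_zero {x : K} : m.nrm x = 0 ↔ x = 0 := by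
  constructor
  · intro h
    have := m.mul_conj x
    rw [h, Rat.cast_zero, mul_eq_zero] at this
    rcases this with h | h
    · exact h
    · simpa using h
  · rintro rfl; simp [nrm]

theorem nrm_pos {x : K} (hx : x ≠ 0) : 0 < m.nrm x :=
  lt_of_le_of_ne (m.nrm_nonneg x) fun h => hx (m.nrm_eq_zero.mp h.symm)

theorem nrm_ratCast (q : ℚ) : m.nrm (q : K) = q ^ 2 := by simp [nrm]

theorem nrm_natCast (q : ℕ) : m.nrm (q : K) = q ^ 2 := by simp [nrm]

theorem nrm_inv (x : K) : m.nrm x⁻¹ = (m.nrm x)⁻¹ := by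
  by_cases hx : x = 0
  · simp [hx, nrm]
  · have h := m.nrm_mul x x⁻¹
    rw [mul_inv_cancel₀ hx] at h
    have h1 : m.nrm 1 = 1 := by simp [nrm]
    rw [h1] at h
    exact (inv_eq_of_mul_eq_one_right h.symm).symm

theorem algebraNorm_eq (x : K) : Algebra.norm ℚ x = m.nrm x := by
  rw [show m.nrm x = (m.e x).re ^ 2 + m.d * (m.e x).im ^ 2 from rfl,
    ← Algebra.norm_eq_of_algEquiv m.e, Algebra.norm_apply]
  have := QuadraticAlgebra.det_toLinearMap_eq_norm (m.e x)
  rw [QuadraticAlgebra.norm_def] at this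
  exact this.trans (by ring)

theorem coe_algebraNorm_int (x : 𝓞 K) : ((Algebra.norm ℤ x : ℤ) : ℚ) = m.nrm x := by
  rw [Algebra.coe_norm_int, m.algebraNorm_eq]

theorem absNorm_spanSingleton (x : K) :
    FractionalIdeal.absNorm (FractionalIdeal.spanSingleton (nonZeroDivisors (𝓞 K)) x) = m.nrm x := by
  rw [FractionalIdeal.absNorm_span_singleton, m.algebraNorm_eq, abs_of_nonneg (m.nrm_nonneg x)]

theorem absNorm_span_singleton (x : 𝓞 K) : ((Ideal.absNorm (Ideal.span {x}) : ℕ) : ℚ) = m.nrm x := by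
  rw [Ideal.absNorm_span_singleton, ← m.coe_algebraNorm_int]
  have : 0 ≤ Algebra.norm ℤ x := by
    have := m.nrm_nonneg x
    rw [← m.coe_algebraNorm_int] at this
    exact_mod_cast this
  rw [Nat.cast_natAbs, abs_of_nonneg this]

/-- Complex conjugation on the ring of integers. -/
noncomputable def conjO : 𝓞 K ≃+* 𝓞 K := RingOfIntegers.mapRingEquiv m.conj.toRingEquiv

@[simp] theorem coe_conjO (x : 𝓞 K) : (m.conjO x : K) = m.conj x := rfl

@[simp] theorem conjO_conjO (x : 𝓞 K) : m.conjO (m.conjO x) = x := by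
  ext; simp

/-- The conjugate of an ideal. -/
noncomputable def conjIdeal (I : Ideal (𝓞 K)) : Ideal (𝓞 K) := I.map m.conjO

theorem conjO_mem {I : Ideal (𝓞 K)} {x : 𝓞 K} (hx : x ∈ I) : m.conjO x ∈ m.conjIdeal I :=
  Ideal.mem_map_of_mem _ hx

theorem mem_conjIdeal {I : Ideal (𝓞 K)} {x : 𝓞 K} : x ∈ m.conjIdeal I ↔ m.conjO x ∈ I := by
  unfold conjIdeal
  rw [Ideal.mem_map_of_equiv]
  constructor
  · rintro ⟨y, hy, rfl⟩; simpa
  · intro h; exact ⟨_, h, by simp⟩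

@[simp] theorem conjIdeal_conjIdeal (I : Ideal (𝓞 K)) : m.conjIdeal (m.conjIdeal I) = I := by
  ext x; simp [mem_conjIdeal]

theorem conjIdeal_ne_bot {I : Ideal (𝓞 K)} (h : I ≠ ⊥) : m.conjIdeal I ≠ ⊥ := by
  intro h0
  apply h
  rw [← m.conjIdeal_conjIdeal I, h0]
  simp [conjIdeal]

theorem isIntegral_add_conj (x : 𝓞 K) : ∃ t : ℤ, (x : K) + m.conj x = t := by
  obtain ⟨r, s, h⟩ := (m.isIntegral_iff x).mp (RingOfIntegers.isIntegral_coe x)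
  refine ⟨2 * r + s, m.ext ?_ ?_⟩
  · have : m.re x = r + s / 2 := by rw [re, h]
    rw [re_intCast, re_add, re_conj, this]
    push_cast
    ring
  · rw [im_intCast, im_add, im_conj, add_neg_cancel]

theorem mul_conj_int (x : 𝓞 K) : ∃ t : ℤ, (m.nrm x = t) ∧ x * m.conjO x = t := by
  refine ⟨Algebra.norm ℤ x, (m.coe_algebraNorm_int x).symm, ?_⟩
  ext
  have : ((x * m.conjO x : 𝓞 K) : K) = x * m.conj x := by simp
  rw [this, m.mul_conj, ← m.coe_algebraNorm_int]
  simp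

/-- Write `I = (α, β)` and let `g` be the gcd of `N(α)`, `N(β)` and `Tr(α β̄)`. The product with the
conjugate ideal is `(g)`: each product of generators is divisible by `g`, and `g` is an integral
combination of the three numbers. Both ideal norms divide `g` and their product is `g²`, so both
equal `g`. -/
theorem mul_conjIdeal (I : Ideal (𝓞 K)) (hI : I ≠ ⊥) :
    I * m.conjIdeal I = Ideal.span {(Ideal.absNorm I : 𝓞 K)} ∧
      Ideal.absNorm (m.conjIdeal I) = Ideal.absNorm I := by
  obtain ⟨α, hα, hα0⟩ := Submodule.exists_mem_ne_zero_of_ne_bot hI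
  obtain ⟨β, hβ⟩ := IsDedekindDomain.exists_eq_span_pair hα hα0
  have hβI : β ∈ I := by rw [hβ]; exact Ideal.subset_span (by simp)
  obtain ⟨a, ha, ha'⟩ := m.mul_conj_int α
  obtain ⟨b, hb, hb'⟩ := m.mul_conj_int β
  obtain ⟨t, ht⟩ := m.isIntegral_add_conj (α * m.conjO β)
  have ht' : α * m.conjO β + m.conjO α * β = t := by
    ext
    have : ((α * m.conjO β + m.conjO α * β : 𝓞 K) : K) = α * m.conj β + m.conj α * β := by simp
    rw [this]
    simp only [map_mul, coe_conjO, conj_conj] at ht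
    rw [ht]
    simp
  set g : ℤ := ((Int.gcd a (Int.gcd b t) : ℕ) : ℤ) with hg
  have hga : g ∣ a := Int.gcd_dvd_left a _
  have hgbt : g ∣ (Int.gcd b t : ℤ) := Int.gcd_dvd_right a _
  have hgb : g ∣ b := hgbt.trans (Int.gcd_dvd_left _ _)
  have hgt : g ∣ t := hgbt.trans (Int.gcd_dvd_right _ _)
  have ha0 : a ≠ 0 := by
    rintro rfl
    have h0 := m.nrm_pos (x := (α : K)) (by exact_mod_cast hα0)
    rw [ha] at h0
    simp at h0
  have hg0 : g ≠ 0 := by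
    intro h; rw [h] at hga; exact ha0 (zero_dvd_iff.mp hga)
  have hgpos : 0 < g := lt_of_le_of_ne (by positivity) (Ne.symm hg0)
  obtain ⟨a₁, ha₁⟩ := hga
  obtain ⟨b₁, hb₁⟩ := hgb
  obtain ⟨t₁, ht₁⟩ := hgt
  have hgK : (g : K) ≠ 0 := by exact_mod_cast hg0
  have haK : (α : K) * m.conj α = g * a₁ := by
    rw [m.mul_conj, ha, ha₁]; push_cast; rfl
  have hbK : (β : K) * m.conj β = g * b₁ := by
    rw [m.mul_conj, hb, hb₁]; push_cast; rfl
  have htK : (α : K) * m.conj β + m.conj α * β = g * t₁ := by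
    have := congrArg (algebraMap (𝓞 K) K) ht'
    rw [ht₁] at this
    simpa using this
  -- The quotient `α β̄ / g` has trace `t₁` and norm `a₁ b₁`, so it is integral.
  have hcross : ∃ z : 𝓞 K, α * m.conjO β = g * z := by
    have hz : IsIntegral ℤ ((α : K) * m.conj β / g) := by
      refine ⟨Polynomial.X ^ 2 - Polynomial.C t₁ * Polynomial.X + Polynomial.C (a₁ * b₁),
        by monicity!, ?_⟩
      simp only [Polynomial.eval₂_add, Polynomial.eval₂_sub, Polynomial.eval₂_pow, Polynomial.eval₂_X,
        Polynomial.eval₂_C, Polynomial.eval₂_mul]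
      simp only [algebraMap_int_eq, eq_intCast, Int.cast_mul]
      field_simp
      linear_combination (α : K) * m.conj β * htK - (β : K) * m.conj β * haK - g * a₁ * hbK
    obtain ⟨z, hzz⟩ : ∃ z : 𝓞 K, algebraMap (𝓞 K) K z = (α : K) * m.conj β / g := ⟨⟨_, hz⟩, rfl⟩
    refine ⟨z, RingOfIntegers.coe_injective ?_⟩
    rw [map_mul, map_mul, map_intCast, hzz]
    change (α : K) * m.conj β = _
    field_simp
  obtain ⟨z, hz⟩ := hcross
  have hz' : m.conjO α * β = g * m.conjO z := by
    have := congrArg m.conjO hz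
    simpa using this
  have hspan : I * m.conjIdeal I = Ideal.span {(g : 𝓞 K)} := by
    apply le_antisymm
    · have : m.conjIdeal I = Ideal.span {m.conjO α, m.conjO β} := by
        conv_lhs => rw [hβ]
        rw [conjIdeal, Ideal.map_span, Set.image_pair]
      rw [this]
      conv_lhs => rw [hβ]
      rw [Ideal.span_pair_mul_span_pair, Ideal.span_le]
      have ha'' : α * m.conjO α = g * a₁ := by rw [ha', ha₁]; push_cast; rfl
      have hb'' : β * m.conjO β = g * b₁ := by rw [hb', hb₁]; push_cast; rfl
      rintro x (rfl | rfl | rfl | rfl)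
      · exact Ideal.mem_span_singleton.mpr ⟨_, ha''⟩
      · exact Ideal.mem_span_singleton.mpr ⟨_, hz⟩
      · exact Ideal.mem_span_singleton.mpr ⟨_, by rw [mul_comm]; exact hz'⟩
      · exact Ideal.mem_span_singleton.mpr ⟨_, hb''⟩
    · rw [Ideal.span_singleton_le_iff_mem]
      have h1 : (a : 𝓞 K) ∈ I * m.conjIdeal I := ha' ▸ Ideal.mul_mem_mul hα (m.conjO_mem hα)
      have h2 : (b : 𝓞 K) ∈ I * m.conjIdeal I := hb' ▸ Ideal.mul_mem_mul hβI (m.conjO_mem hβI)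
      have h3 : (t : 𝓞 K) ∈ I * m.conjIdeal I := by
        rw [← ht']
        refine add_mem (Ideal.mul_mem_mul hα (m.conjO_mem hβI)) ?_
        rw [mul_comm (m.conjO α)]
        exact Ideal.mul_mem_mul hβI (m.conjO_mem hα)
      have e1 := Int.gcd_eq_gcd_ab b t
      have e2 := Int.gcd_eq_gcd_ab a (Int.gcd b t)
      have e3 : (g : 𝓞 K) = a * (Int.gcdA a (Int.gcd b t)) + (b * (Int.gcdA b t) + t * Int.gcdB b t) *
          (Int.gcdB a (Int.gcd b t)) := by
        have e1' := congrArg (Int.cast (R := 𝓞 K)) e1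
        have e2' := congrArg (Int.cast (R := 𝓞 K)) e2
        push_cast at e1' e2'
        rw [hg, Int.cast_natCast, e2', e1']
      rw [e3]
      exact add_mem (Ideal.mul_mem_right _ _ h1)
        (Ideal.mul_mem_right _ _ (add_mem (Ideal.mul_mem_right _ _ h2) (Ideal.mul_mem_right _ _ h3)))
  have hdvd : ∀ I' : Ideal (𝓞 K), α ∈ I' → β ∈ I' → (Ideal.absNorm I' : ℤ) ∣ g := by
    intro I' h1 h2
    have key : ∀ x : 𝓞 K, x ∈ I' → ∀ c : ℤ, m.nrm x = c → (Ideal.absNorm I' : ℤ) ∣ c := by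
      intro x hx c hc
      have := Ideal.absNorm_dvd_norm_of_mem hx
      rw [← m.coe_algebraNorm_int] at hc
      have hc' : Algebra.norm ℤ x = c := by exact_mod_cast hc
      rwa [hc'] at this
    have k1 := key α h1 a ha
    have k2 := key β h2 b hb
    have k3 := key (α + β) (add_mem h1 h2) (a + b + t) (by
      have : (m.nrm ((α + β : 𝓞 K) : K) : K) = ((a + b + t : ℤ) : ℚ) := by
        rw [← m.mul_conj]
        have e1 := m.mul_conj α
        have e2 := m.mul_conj β
        rw [ha] at e1
        rw [hb] at e2
        have e3 : (α : K) * m.conj β + m.conj α * β = t := by rw [htK, ht₁]; push_cast; rfl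
        simp only [map_add]
        push_cast at *
        linear_combination e1 + e2 + e3
      exact_mod_cast this)
    have k4 : (Ideal.absNorm I' : ℤ) ∣ t := by
      have := dvd_sub k3 (dvd_add k1 k2)
      rwa [add_sub_cancel_left] at this
    exact Int.dvd_coe_gcd k1 (Int.dvd_coe_gcd k2 k4)
  have hd1 := hdvd I hα hβI
  have hd2 : (Ideal.absNorm (m.conjIdeal I) : ℤ) ∣ g := by
    have key : ∀ x : 𝓞 K, x ∈ m.conjIdeal I → ∀ c : ℤ, m.nrm x = c →
        (Ideal.absNorm (m.conjIdeal I) : ℤ) ∣ c := by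
      intro x hx c hc
      have := Ideal.absNorm_dvd_norm_of_mem hx
      rw [← m.coe_algebraNorm_int] at hc
      have hc' : Algebra.norm ℤ x = c := by exact_mod_cast hc
      rwa [hc'] at this
    have k1 := key _ (m.conjO_mem hα) a (by rw [coe_conjO, nrm_conj, ha])
    have k2 := key _ (m.conjO_mem hβI) b (by rw [coe_conjO, nrm_conj, hb])
    have k3 := key _ (m.conjO_mem (add_mem hα hβI)) (a + b + t) (by
      rw [coe_conjO, nrm_conj]
      have : (m.nrm ((α + β : 𝓞 K) : K) : K) = ((a + b + t : ℤ) : ℚ) := by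
        rw [← m.mul_conj]
        have e1 := m.mul_conj α
        have e2 := m.mul_conj β
        rw [ha] at e1
        rw [hb] at e2
        have e3 : (α : K) * m.conj β + m.conj α * β = t := by rw [htK, ht₁]; push_cast; rfl
        simp only [map_add]
        push_cast at *
        linear_combination e1 + e2 + e3
      exact_mod_cast this)
    have k4 : (Ideal.absNorm (m.conjIdeal I) : ℤ) ∣ t := by
      have := dvd_sub k3 (dvd_add k1 k2)
      rwa [add_sub_cancel_left] at this
    exact Int.dvd_coe_gcd k1 (Int.dvd_coe_gcd k2 k4)
  have hprod : (Ideal.absNorm I : ℤ) * Ideal.absNorm (m.conjIdeal I) = g * g := by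
    have h1 := congrArg Ideal.absNorm hspan
    rw [map_mul] at h1
    have h2 := m.absNorm_span_singleton (g : 𝓞 K)
    rw [← h1] at h2
    have h3 : ((g : 𝓞 K) : K) = ((g : ℚ) : K) := by
      change algebraMap (𝓞 K) K _ = _
      rw [map_intCast]; simp
    rw [h3, nrm_ratCast] at h2
    have h4 : ((Ideal.absNorm I * Ideal.absNorm (m.conjIdeal I) : ℕ) : ℤ) = g ^ 2 := by exact_mod_cast h2
    push_cast at h4
    rw [h4, sq]
  obtain ⟨u, hu⟩ := hd1
  obtain ⟨v, hv⟩ := hd2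
  have hNI : (Ideal.absNorm I : ℤ) ≠ 0 := by
    intro h; rw [h, zero_mul] at hu; exact hg0 hu
  have hNI' : (Ideal.absNorm (m.conjIdeal I) : ℤ) ≠ 0 := by
    intro h; rw [h, zero_mul] at hv; exact hg0 hv
  have huv : u * v = 1 := by
    have : (Ideal.absNorm I : ℤ) * Ideal.absNorm (m.conjIdeal I) * (u * v) =
        (Ideal.absNorm I : ℤ) * Ideal.absNorm (m.conjIdeal I) * 1 := by
      rw [mul_one, hprod]
      nth_rewrite 3 [hu]
      nth_rewrite 3 [hv]
      rw [← hprod]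
      ring
    exact mul_left_cancel₀ (mul_ne_zero hNI hNI') this
  have hupos : 0 < u := by
    by_contra! h
    have : (0 : ℤ) ≤ Ideal.absNorm I := by positivity
    nlinarith
  have hu1 : u = 1 := by
    rcases Int.eq_one_or_neg_one_of_mul_eq_one huv with h | h
    · exact h
    · omega
  have hv1 : v = 1 := by rw [hu1, one_mul] at huv; exact huv
  rw [hu1, mul_one] at hu
  rw [hv1, mul_one] at hv
  refine ⟨?_, by exact_mod_cast hv.symm.trans hu⟩
  rw [hspan, hu]
  simp

end QuadraticModel

end QuadraticIdeals

/-! ### Fractional ideals: local generators and quotients of norm one -/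

section FractionalIdeals

open NumberField

namespace QuadraticModel

variable {K : Type*} [Field K] [NumberField K] (m : QuadraticModel K)

/-- Every integer is of the form `r + s ω` with `ω = (1 + √-d)/2`. -/
theorem coords (x : 𝓞 K) : ∃ r s : ℤ, m.re x = r + s / 2 ∧ m.im x = s / 2 := by
  obtain ⟨r, s, h⟩ := (m.isIntegral_iff x).mp (RingOfIntegers.isIntegral_coe x)
  exact ⟨r, s, by rw [re, h], by rw [im, h]⟩

theorem exists_int_of_coords {x : K} (r s : ℤ) (h1 : m.re x = r + s / 2) (h2 : m.im x = s / 2) :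
    ∃ y : 𝓞 K, (y : K) = x :=
  ⟨⟨x, (m.isIntegral_iff x).mpr ⟨r, s, QuadraticAlgebra.ext h1 h2⟩⟩, rfl⟩

theorem intCast_eq_natCast_of_conjIdeal (I : Ideal (𝓞 K)) (hI : I ≠ ⊥) {x y : 𝓞 K} (hx : x ∈ I)
    (hy : y ∈ I) : ∃ z : 𝓞 K, (x : K) * m.conj y = (Ideal.absNorm I : ℚ) • (z : K) := by
  have h := Ideal.mul_mem_mul hx (m.conjO_mem hy)
  rw [(m.mul_conjIdeal I hI).1, Ideal.mem_span_singleton] at h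
  obtain ⟨z, hz⟩ := h
  refine ⟨z, ?_⟩
  have := congrArg (algebraMap (𝓞 K) K) hz
  rw [map_mul, map_mul, map_natCast] at this
  rw [Algebra.smul_def, map_natCast]
  exact this

theorem exists_ideal_eq {I : FracIdeal K} (hI : I ≠ 0) : ∃ (a : 𝓞 K) (J : Ideal (𝓞 K)), a ≠ 0 ∧ J ≠ ⊥ ∧
    I = FractionalIdeal.spanSingleton (nonZeroDivisors (𝓞 K)) ((a : K))⁻¹ * J := by
  obtain ⟨a, J, ha, h⟩ := FractionalIdeal.exists_eq_spanSingleton_mul I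
  refine ⟨a, J, ha, ?_, h⟩
  rintro rfl
  apply hI
  rw [h]
  simp

theorem absNorm_span_mul (x : K) (J : FracIdeal K) :
    FractionalIdeal.absNorm (FractionalIdeal.spanSingleton (nonZeroDivisors (𝓞 K)) x * J) =
      m.nrm x * FractionalIdeal.absNorm J := by
  rw [map_mul, m.absNorm_spanSingleton]

theorem mul_conj_mem {I : FracIdeal K} (hI : I ≠ 0) {x y : K} (hx : x ∈ I) (hy : y ∈ I) :
    ∃ z : 𝓞 K, x * m.conj y = (FractionalIdeal.absNorm I) • (z : K) := by
  obtain ⟨a, J, ha, hJ, h⟩ := exists_ideal_eq hI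
  rw [h, FractionalIdeal.mem_singleton_mul] at hx hy
  obtain ⟨x', hx', rfl⟩ := hx
  obtain ⟨y', hy', rfl⟩ := hy
  obtain ⟨x'', hx'', rfl⟩ := (FractionalIdeal.mem_coeIdeal _).mp hx'
  obtain ⟨y'', hy'', rfl⟩ := (FractionalIdeal.mem_coeIdeal _).mp hy'
  obtain ⟨z, hz⟩ := m.intCast_eq_natCast_of_conjIdeal J hJ hx'' hy''
  refine ⟨z, ?_⟩
  rw [h, m.absNorm_span_mul, FractionalIdeal.coeIdeal_absNorm, mul_smul, ← hz, m.nrm_inv,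
    Algebra.smul_def, eq_ratCast, Rat.cast_inv, ← m.mul_conj, map_mul, map_inv₀, mul_inv]
  ring

theorem absNorm_pos {I : FracIdeal K} (hI : I ≠ 0) : 0 < FractionalIdeal.absNorm I :=
  lt_of_le_of_ne (FractionalIdeal.absNorm_nonneg I)
    fun h => hI (FractionalIdeal.absNorm_eq_zero_iff.mp h.symm)

theorem nrm_mem {I : FracIdeal K} (hI : I ≠ 0) {x : K} (hx : x ∈ I) :
    ∃ t : ℕ, m.nrm x = FractionalIdeal.absNorm I * t := by
  obtain ⟨z, hz⟩ := m.mul_conj_mem hI hx hx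
  have hN := absNorm_pos hI
  have hre := congrArg m.re hz
  have him := congrArg m.im hz
  rw [m.mul_conj] at hre him
  simp only [re_ratCast, im_ratCast, re_smul, im_smul] at hre him
  obtain ⟨r, s, h1, h2⟩ := m.coords z
  have him' : m.im z = 0 := by
    rcases mul_eq_zero.mp him.symm with h | h
    · exact absurd h hN.ne'
    · exact h
  have hs : (s : ℚ) = 0 := by rw [h2] at him'; linarith
  rw [h1, hs, zero_div, add_zero] at hre
  have hr : 0 ≤ r := by
    by_contra! hr
    have h3 : (r : ℚ) < 0 := by exact_mod_cast hr
    have := m.nrm_nonneg x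
    nlinarith [mul_pos_of_neg_of_neg h3 (neg_lt_zero.mpr hN)]
  exact ⟨r.toNat, by rw [hre]; congr 1; exact_mod_cast (Int.toNat_of_nonneg hr).symm⟩

/-- A generator `γ` of `I` modulo `l I` satisfies `(γ) = I B` with `B` prime to `l`. It serves as a
generator of `I` near `l`, so no localization is needed. -/
theorem exists_span_eq_mul (I : Ideal (𝓞 K)) (hI : I ≠ ⊥) {l : ℕ} (hl : l.Prime) :
    ∃ (γ : 𝓞 K) (B : Ideal (𝓞 K)), γ ≠ 0 ∧ Ideal.span {γ} = I * B ∧ ¬ l ∣ Ideal.absNorm B := by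
  have hl0 : Ideal.span {(l : 𝓞 K)} ≠ ⊥ := by
    rw [Ne, Ideal.span_singleton_eq_bot]
    exact_mod_cast hl.ne_zero
  have hle : I * Ideal.span {(l : 𝓞 K)} ≤ I := Ideal.mul_le_left
  obtain ⟨γ, hγ⟩ := IsDedekindDomain.exists_sup_span_eq hle (mul_ne_zero hI hl0)
  have hγI : Ideal.span {γ} ≤ I := le_sup_right.trans hγ.le
  obtain ⟨B, hB⟩ := Ideal.dvd_iff_le.mpr hγI
  have htop : Ideal.span {(l : 𝓞 K)} ⊔ B = ⊤ := by
    rw [hB, ← Ideal.mul_sup] at hγ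
    have h2 : I * (Ideal.span {(l : 𝓞 K)} ⊔ B) = I * ⊤ := by rw [hγ, Ideal.mul_top]
    exact mul_left_cancel₀ hI h2
  have hB' : ¬ l ∣ Ideal.absNorm B := by
    intro h
    obtain ⟨P, hP, hPl, hPB⟩ := Ideal.exists_isMaximal_dvd_of_dvd_absNorm' hl B h
    apply hP.ne_top
    rw [eq_top_iff, ← htop, sup_le_iff]
    refine ⟨?_, Ideal.dvd_iff_le.mp hPB⟩
    rw [Ideal.span_singleton_le_iff_mem]
    have : (l : ℤ) ∈ Ideal.under ℤ P := by rw [hPl]; exact Ideal.mem_span_singleton_self _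
    simpa [Ideal.under, Ideal.mem_comap] using this
  refine ⟨γ, B, ?_, hB, hB'⟩
  rintro rfl
  have h0 : I * B = ⊥ := by rw [← hB]; simp
  rcases mul_eq_zero.mp h0 with h | h
  · exact hI h
  · rw [h] at hB'; simp at hB'

theorem exists_nrm_eq_mul {I : FracIdeal K} (hI : I ≠ 0) {l : ℕ} (hl : l.Prime) :
    ∃ x ∈ I, ∃ N : ℕ, x ≠ 0 ∧ m.nrm x = FractionalIdeal.absNorm I * N ∧ ¬ l ∣ N := by
  obtain ⟨a, J, ha, hJ, h⟩ := exists_ideal_eq hI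
  obtain ⟨γ, B, hγ, hB, hlB⟩ := exists_span_eq_mul J hJ hl
  have haK : (a : K) ≠ 0 := by exact_mod_cast ha
  have hγK : (γ : K) ≠ 0 := by exact_mod_cast hγ
  refine ⟨(a : K)⁻¹ * γ, ?_, Ideal.absNorm B, mul_ne_zero (inv_ne_zero haK) hγK, ?_, hlB⟩
  · rw [h, FractionalIdeal.mem_singleton_mul]
    refine ⟨γ, (FractionalIdeal.mem_coeIdeal _).mpr ⟨γ, ?_, rfl⟩, rfl⟩
    have : γ ∈ Ideal.span {γ} := Ideal.mem_span_singleton_self _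
    rw [hB] at this
    exact Ideal.mul_le_left this
  · rw [h, m.absNorm_span_mul, FractionalIdeal.coeIdeal_absNorm, m.nrm_mul, ← m.absNorm_span_singleton γ,
      hB, map_mul]
    push_cast
    ring

/-- A prime `l` in the denominator of `c N(I)` would survive in `c N(x)` for a generator `x` of `I`
near `l`. -/
theorem mul_absNorm_int {I : FracIdeal K} (hI : I ≠ 0) (c : ℚ) (h : ∀ x ∈ I, ∃ t : ℤ, c * m.nrm x = t) :
    ∃ t : ℤ, c * FractionalIdeal.absNorm I = t := by
  refine ⟨(c * FractionalIdeal.absNorm I).num, ?_⟩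
  have hden : (c * FractionalIdeal.absNorm I).den = 1 := by
    by_contra hne
    obtain ⟨l, hl, hld⟩ := Nat.exists_prime_and_dvd hne
    obtain ⟨x, hx, N, hx0, hxN, hlN⟩ := m.exists_nrm_eq_mul hI hl
    obtain ⟨t, ht⟩ := h x hx
    rw [hxN, ← mul_assoc] at ht
    set q := c * FractionalIdeal.absNorm I with hq
    have h1 : q.num * (N : ℤ) = t * q.den := by
      have h2 : (q.num : ℚ) = q * q.den := (Rat.mul_den_eq_num q).symm
      have : (q.num : ℚ) * N = t * q.den := by rw [h2, ← ht]; ring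
      exact_mod_cast this
    have h3 : (l : ℤ) ∣ q.num * N := by
      rw [h1]; exact Dvd.dvd.mul_left (by exact_mod_cast hld) _
    rcases (Nat.prime_iff_prime_int.mp hl).dvd_or_dvd h3 with h4 | h4
    · have h5 := q.reduced
      have h6 : l ∣ q.num.natAbs := Int.natCast_dvd.mp h4
      exact hl.one_lt.ne' (Nat.eq_one_of_dvd_coprimes h5 h6 hld)
    · exact hlN (by exact_mod_cast h4)
  have := Rat.coe_int_num_of_den_eq_one hden
  exact this.symm

/-- A form of Hilbert 90 for ideals. Write `Λ / H = B / D` with `B`, `D` coprime; their norms agree.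
Since `D` divides `(N(D)) = (N(B)) = B B̄` and is prime to `B`, it divides `B̄`, and equality of
norms gives `D = B̄`. -/
theorem exists_conjIdeal_mul_eq {Λ H : FracIdeal K} (hΛ : Λ ≠ 0) (hH : H ≠ 0)
    (hN : FractionalIdeal.absNorm Λ = FractionalIdeal.absNorm H) :
    ∃ A : Ideal (𝓞 K), A ≠ ⊥ ∧ Λ * (m.conjIdeal A : FracIdeal K) = (A : FracIdeal K) * H := by
  have hX : Λ * H⁻¹ ≠ 0 := mul_ne_zero hΛ (inv_ne_zero hH)
  obtain ⟨a, J, ha, hJ, h⟩ := exists_ideal_eq hX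
  have haK : (a : K) ≠ 0 := by exact_mod_cast ha
  have ha0 : Ideal.span {a} ≠ ⊥ := by rwa [Ne, Ideal.span_singleton_eq_bot]
  set G := Ideal.span {a} ⊔ J with hG
  have hG0 : G ≠ ⊥ := fun h => ha0 (le_bot_iff.mp (le_sup_left.trans h.le))
  obtain ⟨D, hD⟩ := Ideal.dvd_iff_le.mpr (le_sup_left : Ideal.span {a} ≤ G)
  obtain ⟨B, hB⟩ := Ideal.dvd_iff_le.mpr (le_sup_right : J ≤ G)
  have hcop : D ⊔ B = ⊤ := by
    have h1 : G * (D ⊔ B) = G * ⊤ := by rw [Ideal.mul_sup, ← hD, ← hB, Ideal.mul_top]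
    exact mul_left_cancel₀ hG0 h1
  have hD0 : D ≠ ⊥ := by rintro rfl; apply ha0; rw [hD]; simp
  have hB0 : B ≠ ⊥ := by rintro rfl; apply hJ; rw [hB]; simp
  have hXDB : Λ * (D : FracIdeal K) = (B : FracIdeal K) * H := by
    have h1 : Λ = Λ * H⁻¹ * H := by rw [mul_assoc, inv_mul_cancel₀ hH, mul_one]
    have hGF : ((G : Ideal (𝓞 K)) : FracIdeal K) ≠ 0 := by
      rwa [Ne, FractionalIdeal.coeIdeal_eq_zero]
    apply mul_left_cancel₀ hGF
    calc (G : FracIdeal K) * (Λ * D) = Λ * ((G * D : Ideal (𝓞 K)) : FracIdeal K) := by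
          rw [FractionalIdeal.coeIdeal_mul]; ring
      _ = (G * B : Ideal (𝓞 K)) * H := by
          rw [← hD, ← hB, h1, h, FractionalIdeal.coeIdeal_span_singleton]
          change FractionalIdeal.spanSingleton _ (a : K)⁻¹ * (J : FracIdeal K) * H *
            FractionalIdeal.spanSingleton _ (a : K) = _
          have : FractionalIdeal.spanSingleton (nonZeroDivisors (𝓞 K)) (a : K)⁻¹ *
            FractionalIdeal.spanSingleton (nonZeroDivisors (𝓞 K)) (a : K) = 1 := by
            rw [FractionalIdeal.spanSingleton_mul_spanSingleton, inv_mul_cancel₀ haK,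
              FractionalIdeal.spanSingleton_one]
          calc _ = (FractionalIdeal.spanSingleton (nonZeroDivisors (𝓞 K)) (a : K)⁻¹ *
            FractionalIdeal.spanSingleton (nonZeroDivisors (𝓞 K)) (a : K)) * ((J : FracIdeal K) * H) := by ring
            _ = _ := by rw [this, one_mul]
      _ = _ := by rw [FractionalIdeal.coeIdeal_mul]; ring
  have hNN : Ideal.absNorm D = Ideal.absNorm B := by
    have h1 := congrArg FractionalIdeal.absNorm hXDB
    rw [map_mul, map_mul, hN, FractionalIdeal.coeIdeal_absNorm, FractionalIdeal.coeIdeal_absNorm,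
      mul_comm] at h1
    exact_mod_cast mul_right_cancel₀ (absNorm_pos hH).ne' h1
  obtain ⟨e1, e2⟩ := m.mul_conjIdeal B hB0
  obtain ⟨e3, e4⟩ := m.mul_conjIdeal D hD0
  have hdvd : D ∣ m.conjIdeal B := by
    have h1 : D ∣ B * m.conjIdeal B := by rw [e1, ← hNN, ← e3]; exact dvd_mul_right _ _
    have h2 : IsCoprime D B := Ideal.isCoprime_iff_sup_eq.mpr hcop
    exact h2.dvd_of_dvd_mul_left h1
  obtain ⟨E, hE⟩ := hdvd
  have hE1 : E = ⊤ := by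
    have h1 := congrArg Ideal.absNorm hE
    rw [e2, map_mul, hNN] at h1
    have hpos : Ideal.absNorm B ≠ 0 := by rwa [Ne, Ideal.absNorm_eq_zero_iff]
    rw [← Ideal.absNorm_eq_one_iff]
    exact (Nat.eq_of_mul_eq_mul_left (Nat.pos_of_ne_zero hpos) (by rw [mul_one]; exact h1)).symm
  rw [hE1, Ideal.mul_top] at hE
  exact ⟨B, hB0, by rw [hE]; exact hXDB⟩

/-- With `Λ / H = A / Ā` and `γ` a generator of `A` near `l`, the element `y = γ̄ / γ` has norm one
and carries `Λ` to `H` near `l`. If `(γ) = A B`, the factor `n = N(B)` clears all remaining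
denominators. -/
theorem exists_nrm_one_mul_mem {Λ H : FracIdeal K} (hΛ : Λ ≠ 0) (hH : H ≠ 0)
    (hN : FractionalIdeal.absNorm Λ = FractionalIdeal.absNorm H) {l : ℕ} (hl : l.Prime) :
    ∃ (y : K) (n : ℕ), m.nrm y = 1 ∧ ¬ l ∣ n ∧ (∀ x ∈ Λ, n • (y * x) ∈ H) ∧ ∀ x ∈ H, n • (y⁻¹ * x) ∈ Λ := by
  obtain ⟨A, hA, hAΛ⟩ := m.exists_conjIdeal_mul_eq hΛ hH hN
  obtain ⟨γ, B, hγ, hB, hlB⟩ := exists_span_eq_mul A hA hl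
  have hγK : (γ : K) ≠ 0 := by exact_mod_cast hγ
  have hB0 : B ≠ ⊥ := by rintro rfl; simp at hlB
  have hγc : m.conj (γ : K) ≠ 0 := by simpa using hγK
  have hAF : ((A : Ideal (𝓞 K)) : FracIdeal K) ≠ 0 := by rwa [Ne, FractionalIdeal.coeIdeal_eq_zero]
  have hAF' : ((m.conjIdeal A : Ideal (𝓞 K)) : FracIdeal K) ≠ 0 := by
    rw [Ne, FractionalIdeal.coeIdeal_eq_zero]; exact m.conjIdeal_ne_bot hA
  have hB' : Ideal.span {m.conjO γ} = m.conjIdeal A * m.conjIdeal B := by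
    rw [conjIdeal, conjIdeal, ← Ideal.map_mul, ← hB, Ideal.map_span, Set.image_singleton]
  set s : K → FracIdeal K := fun x => FractionalIdeal.spanSingleton (nonZeroDivisors (𝓞 K)) x with hs
  have hsmul : ∀ x y, s (x * y) = s x * s y := fun x y => by
    simp only [hs, FractionalIdeal.spanSingleton_mul_spanSingleton]
  have hs1 : s 1 = 1 := FractionalIdeal.spanSingleton_one
  have f1 : s (γ : K) = A * B := by
    rw [← FractionalIdeal.coeIdeal_mul, ← hB, FractionalIdeal.coeIdeal_span_singleton]
  have f2 : s (m.conj γ : K) = (m.conjIdeal A : FracIdeal K) * (m.conjIdeal B : FracIdeal K) := by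
    rw [← FractionalIdeal.coeIdeal_mul, ← hB', FractionalIdeal.coeIdeal_span_singleton]; rfl
  have f3 : s ((Ideal.absNorm B : ℕ) : K) = B * (m.conjIdeal B : FracIdeal K) := by
    rw [← FractionalIdeal.coeIdeal_mul, (m.mul_conjIdeal B hB0).1, FractionalIdeal.coeIdeal_span_singleton,
      map_natCast]
  have hint : ∀ (C : Ideal (𝓞 K)) (F : FracIdeal K), (C : FracIdeal K) * F ≤ F := fun C F => by
    calc (C : FracIdeal K) * F ≤ 1 * F := by gcongr; exact FractionalIdeal.coeIdeal_le_one
      _ = F := one_mul F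
  have hγγ : s (γ : K)⁻¹ * s γ = 1 := by rw [← hsmul, inv_mul_cancel₀ hγK, hs1]
  have hγγ' : s (m.conj γ : K)⁻¹ * s (m.conj γ) = 1 := by rw [← hsmul, inv_mul_cancel₀ hγc, hs1]
  refine ⟨m.conj γ / γ, Ideal.absNorm B, ?_, hlB, ?_, ?_⟩
  · rw [div_eq_mul_inv, m.nrm_mul, m.nrm_conj, m.nrm_inv, mul_inv_cancel₀]
    exact (m.nrm_pos hγK).ne'
  · intro x hx
    have key : s ((Ideal.absNorm B : ℕ) : K) * (s (m.conj γ * (γ : K)⁻¹) * Λ) ≤ H := by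
      have : s ((Ideal.absNorm B : ℕ) : K) * (s (m.conj γ * (γ : K)⁻¹) * Λ) =
          ((m.conjIdeal B * m.conjIdeal B : Ideal (𝓞 K)) : FracIdeal K) * H := by
        rw [hsmul, f3, f2, FractionalIdeal.coeIdeal_mul]
        calc _ = (s (γ : K)⁻¹ * B * (m.conjIdeal B : FracIdeal K) * (m.conjIdeal B : FracIdeal K)) *
              (Λ * (m.conjIdeal A : FracIdeal K)) := by ring
          _ = (s (γ : K)⁻¹ * (A * B)) * ((m.conjIdeal B : FracIdeal K) * (m.conjIdeal B : FracIdeal K) * H) := by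
              rw [hAΛ]; ring
          _ = _ := by rw [← f1, hγγ, one_mul]
      rw [this]
      exact hint _ _
    apply key
    rw [FractionalIdeal.mem_singleton_mul]
    refine ⟨m.conj γ / γ * x, ?_, by rw [nsmul_eq_mul]⟩
    rw [FractionalIdeal.mem_singleton_mul]
    exact ⟨x, hx, by rw [div_eq_mul_inv]⟩
  · intro x hx
    have key : s ((Ideal.absNorm B : ℕ) : K) * (s (γ * (m.conj γ : K)⁻¹) * H) ≤ Λ := by
      have : s ((Ideal.absNorm B : ℕ) : K) * (s (γ * (m.conj γ : K)⁻¹) * H) =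
          ((B * B : Ideal (𝓞 K)) : FracIdeal K) * Λ := by
        rw [hsmul, f3, f1, FractionalIdeal.coeIdeal_mul]
        calc _ = (s (m.conj γ : K)⁻¹ * B * (m.conjIdeal B : FracIdeal K) * B) *
              (A * H) := by ring
          _ = (s (m.conj γ : K)⁻¹ * ((m.conjIdeal A : FracIdeal K) * (m.conjIdeal B : FracIdeal K))) * (B * B * Λ) := by
              rw [← hAΛ]; ring
          _ = _ := by rw [← f2, hγγ', one_mul]
      rw [this]
      exact hint _ _
    apply key
    rw [FractionalIdeal.mem_singleton_mul]
    refine ⟨γ / m.conj γ * x, ?_, by rw [nsmul_eq_mul, inv_div]⟩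
    rw [FractionalIdeal.mem_singleton_mul]
    exact ⟨x, hx, by rw [div_eq_mul_inv]⟩

/-- If the condition fails, `l` divides a product of two elements without dividing either. For `l =
2` and `d ≡ 7 mod 8` the product is `ω (ω - 1)`; for odd `l` and `-d ≡ r²` it is `(√-d - r)(√-d +
r)`. -/
theorem inertCondition_of_isPrime {l : ℕ} (hl : l.Prime) (h : (Ideal.span {(l : 𝓞 K)}).IsPrime) :
    InertCondition m.d l := by
  have key : ∀ x y : 𝓞 K, (l : 𝓞 K) ∣ x * y → (l : 𝓞 K) ∣ x ∨ (l : 𝓞 K) ∣ y := fun x y hxy => by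
    rw [← Ideal.mem_span_singleton] at hxy ⊢
    rw [← Ideal.mem_span_singleton]
    exact h.mem_or_mem hxy
  have notdvd : ∀ (x : 𝓞 K) (s : ℤ), m.im x = s / 2 → ¬ (l : ℤ) ∣ s → ¬ (l : 𝓞 K) ∣ x := by
    rintro x s hx hs ⟨z, rfl⟩
    obtain ⟨r', s', h1, h2⟩ := m.coords z
    apply hs
    refine ⟨s', ?_⟩
    have : m.im (((l : 𝓞 K) * z : 𝓞 K) : K) = l * m.im z := by
      have : (((l : 𝓞 K) * z : 𝓞 K) : K) = (l : K) * z := by simp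
      rw [this]; simp
    rw [this, h2] at hx
    have : (s : ℚ) = l * s' := by linarith
    exact_mod_cast this
  obtain ⟨ω, hω⟩ := m.exists_int_of_coords (x := m.ofCoords (1 / 2) (1 / 2)) 0 1 (by simp) (by simp)
  have hd4 := m.mod_four
  have hre : m.re ω = 1 / 2 := by rw [hω]; simp
  have him : m.im ω = 1 / 2 := by rw [hω]; simp
  have hl2 : ¬ (l : ℤ) ∣ 1 := fun h => by
    have := Int.eq_one_of_dvd_one (by positivity) h
    exact hl.one_lt.ne' (by exact_mod_cast this)
  constructor
  · rintro rfl
    by_contra hne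
    have h7 : m.d % 8 = 7 := by omega
    obtain ⟨k, hk⟩ : ∃ k, m.d = 8 * k + 7 := ⟨m.d / 8, by omega⟩
    have hprod : ω * (ω - 1) = (2 : ℕ) * ((-(k + 1 : ℤ) : ℤ) : 𝓞 K) := by
      apply RingOfIntegers.coe_injective
      rw [map_mul, map_mul, map_sub, map_one, map_natCast, map_intCast]
      have hkq : (m.d : ℚ) = 8 * k + 7 := by exact_mod_cast hk
      apply m.ext
      · rw [re_mul, re_sub, im_sub, re_one, im_one, re_mul, re_natCast, re_intCast, im_natCast, im_intCast]
        change m.re (ω : K) * (m.re (ω : K) - 1) - m.d * (m.im (ω : K) * (m.im (ω : K) - 0)) = _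
        rw [hre, him, hkq]
        push_cast
        ring
      · rw [im_mul, re_sub, im_sub, re_one, im_one, im_mul, re_natCast, re_intCast, im_natCast, im_intCast]
        change m.re (ω : K) * (m.im (ω : K) - 0) + (m.im (ω : K) * (m.re (ω : K) - 1)) = _
        rw [hre, him]
        push_cast
        ring
    rcases key _ _ ⟨_, hprod⟩ with h | h
    · exact notdvd _ 1 (by rw [him]; simp) hl2 h
    · refine notdvd _ 1 ?_ hl2 h
      have : ((ω - 1 : 𝓞 K) : K) = ω - 1 := by simp
      rw [this, im_sub, him]; simp
  · rintro hl2' ⟨r, hr⟩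
    obtain ⟨r, rfl⟩ := ZMod.intCast_surjective r
    have hdvd : (l : ℤ) ∣ r * r + m.d := by
      rw [← ZMod.intCast_zmod_eq_zero_iff_dvd] 
      push_cast at hr ⊢
      rw [← hr]; ring
    obtain ⟨k, hk⟩ := hdvd
    have hkq : (r : ℚ) * r + m.d = l * k := by exact_mod_cast hk
    have hprod : (2 * ω - 1 - (r : 𝓞 K)) * (2 * ω - 1 + (r : 𝓞 K)) = l * ((-k : ℤ) : 𝓞 K) := by
      apply RingOfIntegers.coe_injective
      have e2 : ((2 : 𝓞 K)) = ((2 : ℕ) : 𝓞 K) := by norm_num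
      rw [e2]
      simp only [map_mul, map_add, map_sub, map_one, map_natCast, map_intCast]
      apply m.ext
      · simp only [re_mul, re_add, re_sub, im_mul, im_add, im_sub, re_one, im_one, re_natCast, im_natCast,
          re_intCast, im_intCast]
        change ((2 : ℕ) * m.re (ω : K) - _ * (0 * m.im (ω : K)) - 1 - r) * ((2 : ℕ) * m.re (ω : K) - _ * (0 * m.im (ω : K)) - 1 + r) - m.d *
          (((2 : ℕ) * m.im (ω : K) + 0 * m.re (ω : K) - 0 - 0) * ((2 : ℕ) * m.im (ω : K) + 0 * m.re (ω : K) - 0 + 0)) = _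
        rw [hre, him]
        push_cast
        linear_combination -hkq
      · simp only [re_mul, re_add, re_sub, im_mul, im_add, im_sub, re_one, im_one, re_natCast, im_natCast,
          re_intCast, im_intCast]
        change ((2 : ℕ) * m.re (ω : K) - _ * (0 * m.im (ω : K)) - 1 - r) * ((2 : ℕ) * m.im (ω : K) + 0 * m.re (ω : K) - 0 + 0) +
          ((2 : ℕ) * m.im (ω : K) + 0 * m.re (ω : K) - 0 - 0) * ((2 : ℕ) * m.re (ω : K) - _ * (0 * m.im (ω : K)) - 1 + r) = _
        rw [hre, him]
        push_cast
        ring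
    have hl2'' : ¬ (l : ℤ) ∣ 2 := fun h => by
      have := (Nat.prime_dvd_prime_iff_eq hl Nat.prime_two).mp (by exact_mod_cast h)
      exact hl2' this
    have him2 : ∀ x : 𝓞 K, x = 2 * ω - 1 - (r : 𝓞 K) ∨ x = 2 * ω - 1 + (r : 𝓞 K) → m.im x = (2 : ℤ) / 2 := by
      have e3 : ∀ r : ℤ, m.im ((2 * ω - 1 + (r : 𝓞 K) : 𝓞 K) : K) = 1 := fun r => by
        have : ((2 * ω - 1 + (r : 𝓞 K) : 𝓞 K) : K) = (ω : K) + ω - 1 + r := by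
          rw [two_mul]; simp
        rw [this]
        simp only [im_add, im_sub, im_one, im_intCast, him]
        norm_num
      rintro x (rfl | rfl)
      · have := e3 (-r)
        rw [Int.cast_neg, ← sub_eq_add_neg] at this
        rw [this]; norm_num
      · rw [e3]; norm_num
    rcases key _ _ ⟨_, hprod⟩ with h | h
    · exact notdvd _ 2 (him2 _ (Or.inl rfl)) hl2'' h
    · exact notdvd _ 2 (him2 _ (Or.inr rfl)) hl2'' h

end QuadraticModel

end FractionalIdeals

/-! ### Base change of quaternion algebras -/

section BaseChange

variable {a b a' b' : ℚ}

/-- The images of `i` and `j` under a homomorphism, over an extension field. -/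
noncomputable def quaternionBasisExtend (F : Type) [Field F] [CharZero F]
    (f : ℍ[ℚ,a',b'] →ₐ[ℚ] ℍ[ℚ,a,b]) :
    QuaternionAlgebra.Basis ℍ[F,(a : F),(b : F)] (a' : F) 0 (b' : F) :=
  let cast : ℍ[ℚ,a,b] → ℍ[F,(a : F),(b : F)] := fun x => ⟨x.re, x.imI, x.imJ, x.imK⟩
  have cast_mul : ∀ x y, cast (x * y) = cast x * cast y := fun x y => by
    ext <;> simp [cast]
  have cast_smul : ∀ q : ℚ, cast (q • 1) = (q : F) • 1 := fun q => by
    ext <;> simp [cast]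
  have cast_add : ∀ x y, cast (x + y) = cast x + cast y := fun x y => by
    ext <;> simp [cast]
  have h1 : (⟨0, 1, 0, 0⟩ : ℍ[ℚ,a',b']) * ⟨0, 1, 0, 0⟩ = a' • 1 := by ext <;> simp
  have h2 : (⟨0, 0, 1, 0⟩ : ℍ[ℚ,a',b']) * ⟨0, 0, 1, 0⟩ = b' • 1 := by ext <;> simp
  have h3 : (⟨0, 0, 1, 0⟩ : ℍ[ℚ,a',b']) * ⟨0, 1, 0, 0⟩ + ⟨0, 1, 0, 0⟩ * ⟨0, 0, 1, 0⟩ = (0 : ℚ) • 1 := by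
    ext <;> simp
  { i := cast (f ⟨0, 1, 0, 0⟩)
    j := cast (f ⟨0, 0, 1, 0⟩)
    k := cast (f ⟨0, 1, 0, 0⟩) * cast (f ⟨0, 0, 1, 0⟩)
    i_mul_i := by
      rw [← cast_mul, ← map_mul, h1, map_smul, map_one, cast_smul, zero_smul, add_zero]
    j_mul_j := by
      rw [← cast_mul, ← map_mul, h2, map_smul, map_one, cast_smul]
    i_mul_j := rfl
    j_mul_i := by
      rw [zero_smul, zero_sub, eq_neg_iff_add_eq_zero, ← cast_mul, ← cast_mul, ← cast_add, ← map_mul,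
        ← map_mul, ← map_add, h3, map_smul, map_one, cast_smul, Rat.cast_zero, zero_smul] }

theorem quaternionBasisExtend_liftHom (F : Type) [Field F] [CharZero F]
    (f : ℍ[ℚ,a',b'] →ₐ[ℚ] ℍ[ℚ,a,b]) (x : ℍ[ℚ,a',b']) :
    (quaternionBasisExtend F f).liftHom ⟨x.re, x.imI, x.imJ, x.imK⟩ =
      ⟨(f x).re, (f x).imI, (f x).imJ, (f x).imK⟩ := by
  have hx : x = x.re • 1 + x.imI • ⟨0, 1, 0, 0⟩ + x.imJ • ⟨0, 0, 1, 0⟩ +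
      x.imK • ((⟨0, 1, 0, 0⟩ : ℍ[ℚ,a',b']) * ⟨0, 0, 1, 0⟩) := by
    ext <;> simp
  have hf : f x = x.re • 1 + x.imI • f ⟨0, 1, 0, 0⟩ + x.imJ • f ⟨0, 0, 1, 0⟩ +
      x.imK • (f ⟨0, 1, 0, 0⟩ * f ⟨0, 0, 1, 0⟩) := by
    conv_lhs => rw [hx]
    simp only [map_add, map_smul, map_mul, map_one]
  rw [hf]
  change (quaternionBasisExtend F f).lift _ = _
  simp only [QuaternionAlgebra.Basis.lift, quaternionBasisExtend]
  ext <;> simp [Algebra.algebraMap_eq_smul_one]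

/-- Ramification is stated through the parameters `a, b`, so its independence of them has to be
shown in order to pass to `(-d, c)`. The images of the generators define maps in both directions
over `F`, whose composite fixes the generators. -/
theorem RamifiedAt.of_algEquiv {F : Type} [Field F] [CharZero F] (f : ℍ[ℚ,a',b'] ≃ₐ[ℚ] ℍ[ℚ,a,b])
    (h : RamifiedAt F a b) : RamifiedAt F a' b' := by
  intro x hx
  let φ := (quaternionBasisExtend F f.toAlgHom).liftHom
  let ψ := (quaternionBasisExtend F f.symm.toAlgHom).liftHom
  have h1 : ∀ y : ℍ[ℚ,a',b'], ψ (φ ⟨y.re, y.imI, y.imJ, y.imK⟩) = ⟨y.re, y.imI, y.imJ, y.imK⟩ := fun y => by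
    simp only [φ, ψ]
    rw [quaternionBasisExtend_liftHom, quaternionBasisExtend_liftHom]
    simp
  have hid : ψ.comp φ = AlgHom.id F _ := by
    apply QuaternionAlgebra.hom_ext
    · simpa using h1 ⟨0, 1, 0, 0⟩
    · simpa using h1 ⟨0, 0, 1, 0⟩
  have hψφ : ψ (φ x) = x := DFunLike.congr_fun hid x
  have hφx : φ x ≠ 0 := fun h0 => hx (by rw [← hψφ, h0, map_zero])
  rw [← hψφ]
  exact (h _ hφx).map ψ

end BaseChange

/-! ### Quaternion algebras containing an imaginary quadratic field -/

section QuaternionDecomposition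

open NumberField

variable {K : Type*} [Field K] [NumberField K]

/-- A decomposition `B = K + K j` with `j x = x̄ j` and `j² = c`. -/
structure QuatModel (m : QuadraticModel K) (a b : ℚ) where
  κ : K →ₐ[ℚ] ℍ[ℚ,a,b]
  j : ℍ[ℚ,a,b]
  c : ℚ
  c_neg : c < 0
  j_mul_κ : ∀ x, j * κ x = κ (m.conj x) * j
  j_mul_j : j * j = algebraMap ℚ ℍ[ℚ,a,b] c
  star_κ : ∀ x, star (κ x) = κ (m.conj x)
  star_j : star j = -j

namespace QuatModel

variable {m : QuadraticModel K} {a b : ℚ} (Q : QuatModel m a b)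

/-- The element `α + β j`. -/
noncomputable def elem (α β : K) : ℍ[ℚ,a,b] := Q.κ α + Q.κ β * Q.j

theorem κ_ratCast (q : ℚ) : Q.κ (q : K) = algebraMap ℚ _ q := by
  rw [← Q.κ.commutes q, eq_ratCast]

theorem elem_mul (α β α' β' : K) : Q.elem α β * Q.elem α' β' =
    Q.elem (α * α' + Q.c • (β * m.conj β')) (α * β' + β * m.conj α') := by
  have h1 : Q.κ β * Q.j * Q.κ α' = Q.κ (β * m.conj α') * Q.j := by
    rw [mul_assoc, Q.j_mul_κ, ← mul_assoc, map_mul]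
  have h2 : Q.κ β * Q.j * (Q.κ β' * Q.j) = Q.κ (Q.c • (β * m.conj β')) := by
    calc _ = Q.κ β * (Q.j * Q.κ β') * Q.j := by noncomm_ring
      _ = Q.κ β * Q.κ (m.conj β') * (Q.j * Q.j) := by rw [Q.j_mul_κ]; noncomm_ring
      _ = _ := by rw [Q.j_mul_j, ← map_mul, map_smul, ← Algebra.commutes, Algebra.smul_def]
  unfold elem
  rw [add_mul, mul_add, mul_add, h1, h2, map_add, map_add, map_mul Q.κ α α', map_mul Q.κ α β', add_mul,
    ← mul_assoc]
  abel

theorem elem_add (α β α' β' : K) : Q.elem α β + Q.elem α' β' = Q.elem (α + α') (β + β') := by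
  simp only [elem, map_add, add_mul]; abel

theorem elem_neg (α β : K) : -Q.elem α β = Q.elem (-α) (-β) := by
  simp only [elem, map_neg, neg_mul]; abel

theorem elem_zero : Q.elem 0 0 = 0 := by simp [elem]

theorem elem_sub (α β α' β' : K) : Q.elem α β - Q.elem α' β' = Q.elem (α - α') (β - β') := by
  rw [sub_eq_add_neg, elem_neg, elem_add, ← sub_eq_add_neg, ← sub_eq_add_neg]

theorem elem_smul (q : ℚ) (α β : K) : q • Q.elem α β = Q.elem (q • α) (q • β) := by
  simp only [elem, map_smul, smul_add, smul_mul_assoc]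

theorem elem_zero_right (α : K) : Q.elem α 0 = Q.κ α := by simp [elem]

theorem elem_one : Q.elem 1 0 = 1 := by simp [elem]

theorem star_elem (α β : K) : star (Q.elem α β) = Q.elem (m.conj α) (-β) := by
  simp only [elem]
  rw [star_add, star_mul, Q.star_κ, Q.star_κ, Q.star_j, neg_mul, Q.j_mul_κ, m.conj_conj, map_neg, neg_mul]

theorem quatForm_elem (α β α' β' : K) : quatForm (Q.elem α β) (Q.elem α' β') =
    2 * m.re (α * m.conj α') - 2 * Q.c * m.re (β * m.conj β') := by
  apply (algebraMap ℚ ℍ[ℚ,a,b]).injective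
  rw [coe_quatForm, star_elem, star_elem, elem_mul, elem_mul, elem_add, ← Q.κ_ratCast, ← elem_zero_right]
  congr 1
  · apply m.ext
    · rw [m.re_ratCast]; simp; ring
    · rw [m.im_ratCast]; simp; ring
  · simp; ring

theorem quatForm_self_elem (α β : K) : quatForm (Q.elem α β) (Q.elem α β) =
    2 * m.nrm α - 2 * Q.c * m.nrm β := by
  rw [quatForm_elem, m.mul_conj, m.mul_conj, m.re_ratCast, m.re_ratCast]

theorem elem_eq_zero {α β : K} (h : Q.elem α β = 0) : α = 0 ∧ β = 0 := by
  have h1 := Q.quatForm_self_elem α β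
  rw [h] at h1
  simp [quatForm] at h1
  have h2 := m.nrm_nonneg α
  have h3 := mul_nonneg (neg_nonneg.mpr Q.c_neg.le) (m.nrm_nonneg β)
  have h4 : m.nrm α = 0 := by linarith
  have h5 : -Q.c * m.nrm β = 0 := by linarith
  exact ⟨m.nrm_eq_zero.mp h4, m.nrm_eq_zero.mp
    ((mul_eq_zero.mp h5).resolve_left (neg_ne_zero.mpr Q.c_neg.ne))⟩

theorem elem_inj {α β α' β' : K} (h : Q.elem α β = Q.elem α' β') : α = α' ∧ β = β' := by
  have h1 : Q.elem (α - α') (β - β') = 0 := by rw [← elem_sub, h, sub_self]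
  obtain ⟨h2, h3⟩ := Q.elem_eq_zero h1
  exact ⟨sub_eq_zero.mp h2, sub_eq_zero.mp h3⟩

/-- The pair `(α, β)` gives `α + β j`. -/
noncomputable def elemₗ : (K × K) →ₗ[ℚ] ℍ[ℚ,a,b] where
  toFun x := Q.elem x.1 x.2
  map_add' _ _ := (Q.elem_add _ _ _ _).symm
  map_smul' q _ := (Q.elem_smul q _ _).symm

theorem exists_eq_elem (x : ℍ[ℚ,a,b]) : ∃ α β, x = Q.elem α β := by
  have hinj : Function.Injective Q.elemₗ := fun x y h => by
    obtain ⟨h1, h2⟩ := Q.elem_inj h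
    exact Prod.ext h1 h2
  have hfin : Module.finrank ℚ K = 2 := by
    rw [m.e.toLinearEquiv.finrank_eq, QuadraticAlgebra.finrank_eq_two]
  have hdim : Module.finrank ℚ (K × K) = Module.finrank ℚ ℍ[ℚ,a,b] := by
    rw [Module.finrank_prod, hfin, QuaternionAlgebra.finrank_eq_four]
  obtain ⟨y, rfl⟩ := (LinearMap.injective_iff_surjective_of_finrank_eq_finrank hdim).mp hinj x
  exact ⟨y.1, y.2, rfl⟩

/-- The square root of `-d` in `B`. -/
theorem κ_sqrt_mul : Q.κ (m.ofCoords 0 1) * Q.κ (m.ofCoords 0 1) = (-(m.d : ℚ)) • 1 := by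
  rw [← map_mul, ← Algebra.algebraMap_eq_smul_one, ← Q.κ_ratCast]
  congr 1
  apply m.ext <;> simp

/-- The identification of `B` with `ℍ[ℚ,-d,c]`. -/
noncomputable def algEquiv : ℍ[ℚ,-(m.d : ℚ),Q.c] ≃ₐ[ℚ] ℍ[ℚ,a,b] :=
  AlgEquiv.ofBijective
    (QuaternionAlgebra.Basis.liftHom
      { i := Q.κ (m.ofCoords 0 1)
        j := Q.j
        k := Q.κ (m.ofCoords 0 1) * Q.j
        i_mul_i := by rw [Q.κ_sqrt_mul, zero_smul, add_zero]
        j_mul_j := by rw [Q.j_mul_j, Algebra.algebraMap_eq_smul_one]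
        i_mul_j := rfl
        j_mul_i := by
          rw [Q.j_mul_κ, show m.conj (m.ofCoords 0 1) = -m.ofCoords 0 1 from m.ext (by simp) (by simp),
            map_neg, zero_smul, zero_sub, neg_mul] })
    (by
      have key : ∀ x : ℍ[ℚ,-(m.d : ℚ),Q.c], ∀ B : QuaternionAlgebra.Basis ℍ[ℚ,a,b] (-(m.d : ℚ)) 0 Q.c,
          B.i = Q.κ (m.ofCoords 0 1) → B.j = Q.j →
          B.liftHom x = Q.elem (m.ofCoords x.re x.imI) (m.ofCoords x.imJ x.imK) := by
        intro x B h1 h2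
        have e : ∀ r s : ℚ, Q.κ (m.ofCoords r s) = algebraMap ℚ _ r + s • Q.κ (m.ofCoords 0 1) := fun r s => by
          rw [← Q.κ_ratCast, ← map_smul, ← map_add]
          congr 1
          apply m.ext <;> simp
        change B.lift x = _
        rw [QuaternionAlgebra.Basis.lift, ← B.i_mul_j, h1, h2, elem, e x.re, e x.imJ, add_mul, Algebra.algebraMap_eq_smul_one,
          Algebra.algebraMap_eq_smul_one, smul_mul_assoc, smul_mul_assoc, one_mul]
        abel
      constructor
      · rw [injective_iff_map_eq_zero]
        intro x hx
        rw [key x _ rfl rfl] at hx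
        obtain ⟨h1, h2⟩ := Q.elem_eq_zero hx
        have e1 := congrArg m.re h1
        have e2 := congrArg m.im h1
        have e3 := congrArg m.re h2
        have e4 := congrArg m.im h2
        simp at e1 e2 e3 e4
        ext <;> simp [e1, e2, e3, e4]
      · intro y
        obtain ⟨α, β, rfl⟩ := Q.exists_eq_elem y
        refine ⟨⟨m.re α, m.im α, m.re β, m.im β⟩, ?_⟩
        rw [key _ _ rfl rfl]
        congr 1 <;> apply m.ext <;> simp)

theorem ramifiedAt_iff (F : Type) [Field F] [CharZero F] :
    RamifiedAt F (-(m.d : ℚ)) Q.c ↔ RamifiedAt F a b :=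
  ⟨fun h => h.of_algEquiv Q.algEquiv.symm, fun h => h.of_algEquiv Q.algEquiv⟩

theorem ramifiedExactlyAt {p : ℕ} (h : RamifiedExactlyAt p a b) :
    RamifiedExactlyAt p (-(m.d : ℚ)) Q.c :=
  ⟨neg_ne_zero.mpr m.d_pos_rat.ne', Q.c_neg.ne, (Q.ramifiedAt_iff ℝ).mpr h.infinite,
    fun l _ => (Q.ramifiedAt_iff ℚ_[l]).trans (h.finite l)⟩

end QuatModel

theorem exists_quatModel (m : QuadraticModel K) {a b : ℚ} (h : RamifiedAt ℝ a b) (u : ℍ[ℚ,a,b])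
    (hu : u * u = algebraMap ℚ _ (-(m.d : ℚ))) :
    ∃ Q : QuatModel m a b, ∀ x, Q.κ x = algebraMap ℚ _ (m.re x) + m.im x • u := by
  obtain ⟨ha, hb⟩ := h.neg
  have hd := m.d_pos_rat
  -- A nonzero real part would force the imaginary parts of `u` to vanish, and the square of a
  -- rational number is not negative.
  have hre : u.re = 0 := by
    have e0 := congrArg QuaternionAlgebra.re hu
    have e1 := congrArg QuaternionAlgebra.imI hu
    have e2 := congrArg QuaternionAlgebra.imJ hu
    have e3 := congrArg QuaternionAlgebra.imK hu
    simp at e0 e1 e2 e3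
    by_contra hne
    have f1 : u.imI = 0 := by
      have : 2 * u.re * u.imI = 0 := by linarith
      simpa [hne] using this
    have f2 : u.imJ = 0 := by
      have : 2 * u.re * u.imJ = 0 := by linarith
      simpa [hne] using this
    have f3 : u.imK = 0 := by
      have : 2 * u.re * u.imK = 0 := by linarith
      simpa [hne] using this
    rw [f1, f2, f3] at e0
    nlinarith [mul_self_nonneg u.re]
  have hstar : star u = -u := by ext <;> simp [hre]
  have hu0 : u ≠ 0 := by
    rintro rfl
    have := congrArg QuaternionAlgebra.re hu
    simp at this
    exact hd.ne' (by exact_mod_cast this)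
  let κ : K →ₐ[ℚ] ℍ[ℚ,a,b] :=
    { toFun := fun x => algebraMap ℚ _ (m.re x) + m.im x • u
      map_one' := by simp
      map_mul' := fun x y => by
        simp only [m.re_mul, m.im_mul, Algebra.algebraMap_eq_smul_one] at hu ⊢
        rw [add_mul, mul_add, mul_add, smul_mul_smul_comm, smul_mul_smul_comm, smul_mul_smul_comm,
          smul_mul_smul_comm, hu, one_mul, one_mul, mul_one, smul_smul]
        module
      map_zero' := by simp
      map_add' := fun x y => by
        simp only [m.re_add, m.im_add, map_add, add_smul]; abel
      commutes' := fun q => by simp }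
  have hκ : ∀ x, κ x = algebraMap ℚ _ (m.re x) + m.im x • u := fun x => rfl
  obtain ⟨v, hv, hvu⟩ : ∃ v : ℍ[ℚ,a,b], star v = -v ∧ u * v ≠ v * u := by
    by_contra! hc
    have h1 := hc ⟨0, 1, 0, 0⟩ (by ext <;> simp)
    have h2 := hc ⟨0, 0, 1, 0⟩ (by ext <;> simp)
    have e1 := congrArg QuaternionAlgebra.imJ h1
    have e2 := congrArg QuaternionAlgebra.imK h1
    have e3 := congrArg QuaternionAlgebra.imK h2
    simp at e1 e2 e3
    have f1 : u.imI = 0 := by linarith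
    have f2 : u.imJ = 0 := by linarith
    have f3 : u.imK = 0 := by
      have : a * u.imK = 0 := by linarith
      simpa [ha.ne] using this
    apply hu0
    ext <;> simp [hre, f1, f2, f3]
  -- As `u⁻¹ = -u / d`, this is `d (v - u v u⁻¹)`: a multiple of the component of `v` that
  -- anticommutes with `u`.
  set j : ℍ[ℚ,a,b] := (m.d : ℚ) • v + u * v * u with hj
  rw [Algebra.algebraMap_eq_smul_one] at hu
  have huj : u * j = (m.d : ℚ) • (u * v - v * u) := by
    rw [hj, mul_add, mul_smul_comm, ← mul_assoc, ← mul_assoc, hu, smul_mul_assoc, smul_mul_assoc, one_mul,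
      smul_sub, neg_smul, sub_eq_add_neg]
  have hju : j * u = -(u * j) := by
    rw [huj, hj, add_mul, mul_assoc (u * v), hu, mul_smul_comm, mul_one, smul_mul_assoc]
    module
  have hj0 : j ≠ 0 := by
    intro h0
    rw [h0, mul_zero] at huj
    rcases smul_eq_zero.mp huj.symm with h1 | h1
    · exact hd.ne' h1
    · exact hvu (sub_eq_zero.mp h1)
  have hjs : star j = -j := by
    rw [hj, star_add, star_mul, star_mul, star_smul, hv, hstar]
    simp only [star_trivial]
    rw [smul_neg, neg_mul_neg, neg_mul, mul_assoc, neg_add]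
  clear_value j
  have hpos := quatForm_self_pos h hj0
  set n := j.re ^ 2 - a * j.imI ^ 2 - b * j.imJ ^ 2 + a * b * j.imK ^ 2 with hn
  have hjj : j * star j = algebraMap ℚ _ n := QuaternionAlgebra.mul_star_eq j
  have hn0 : 0 < n := by
    have e1 : quatForm j j = 2 * n := by
      rw [quatForm, hjj]; simp; ring
    linarith
  refine ⟨⟨κ, j, -n, by linarith, fun x => ?_, ?_, fun x => ?_, hjs⟩, hκ⟩
  · rw [hκ, hκ, mul_add, add_mul, ← Algebra.commutes, m.re_conj, m.im_conj, mul_smul_comm, hju, smul_mul_assoc]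
    module
  · rw [map_neg, ← hjj, hjs]; noncomm_ring
  · rw [hκ, hκ, star_add, star_smul, hstar, m.re_conj, m.im_conj, QuaternionAlgebra.coe_algebraMap,
      QuaternionAlgebra.star_coe]
    simp

end QuaternionDecomposition

/-! ### Orders -/

section Orders

variable {a b : ℚ}

theorem IsOrder.exists_nsmul_mem {O : Subring ℍ[ℚ,a,b]} (hO : IsOrder O) (x : ℍ[ℚ,a,b]) :
    ∃ n : ℕ, 0 < n ∧ n • x ∈ O := by
  have hx : x ∈ Submodule.span ℚ (O : Set ℍ[ℚ,a,b]) := by rw [hO.2]; trivial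
  induction hx using Submodule.span_induction with
  | mem x hx => exact ⟨1, one_pos, by simpa using hx⟩
  | zero => exact ⟨1, one_pos, by simp⟩
  | add x y _ _ hx hy =>
    obtain ⟨n, hn, hnx⟩ := hx
    obtain ⟨k, hk, hky⟩ := hy
    refine ⟨n * k, Nat.mul_pos hn hk, ?_⟩
    rw [smul_add]
    refine O.add_mem ?_ ?_
    · rw [mul_comm, mul_smul]; exact O.nsmul_mem hnx k
    · rw [mul_smul]; exact O.nsmul_mem hky n
  | smul q x _ hx =>
    obtain ⟨n, hn, hnx⟩ := hx
    refine ⟨q.den * n, Nat.mul_pos q.den_pos hn, ?_⟩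
    have : (q.den * n) • q • x = q.num • (n • x) := by
      rw [← Nat.cast_smul_eq_nsmul ℚ, ← Nat.cast_smul_eq_nsmul ℚ n, ← Int.cast_smul_eq_zsmul ℚ, smul_smul, smul_smul,
        ← Rat.mul_den_eq_num q]
      congr 1
      push_cast
      ring
    rw [this]
    exact O.zsmul_mem hnx _

theorem IsOrder.isIntegral {O : Subring ℍ[ℚ,a,b]} (hO : IsOrder O) {x : ℍ[ℚ,a,b]} (hx : x ∈ O) :
    IsIntegral ℤ x := by
  have := hO.1
  have hint : IsIntegral ℤ (⟨x, hx⟩ : O) := Algebra.IsIntegral.isIntegral _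
  exact hint.map O.subtype.toIntAlgHom

theorem IsOrder.exists_int {O : Subring ℍ[ℚ,a,b]} (hO : IsOrder O) {q : ℚ}
    (h : algebraMap ℚ ℍ[ℚ,a,b] q ∈ O) : ∃ t : ℤ, q = t := by
  have h1 : IsIntegral ℤ q := by
    have := hO.isIntegral h
    exact (isIntegral_algHom_iff ((Algebra.ofId ℚ ℍ[ℚ,a,b]).restrictScalars ℤ)
      (algebraMap ℚ ℍ[ℚ,a,b]).injective).mp this
  obtain ⟨z, hz⟩ := IsIntegrallyClosed.isIntegral_iff.mp h1
  exact ⟨z, by rw [← hz]; simp⟩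

theorem IsOrder.exists_int_quatForm {O : Subring ℍ[ℚ,a,b]} (hO : IsOrder O) {x y : ℍ[ℚ,a,b]}
    (hx : x ∈ O) (hy : y ∈ O) : ∃ t : ℤ, quatForm x y = t :=
  ⟨_, (hO.num_quatForm ⟨x, hx⟩ ⟨y, hy⟩).symm⟩

/-- Multiples of `i`, `j`, `k` lie in `O`. Pairing with these and with 1 is integral on every order
above `O`, which confines all of them to one lattice of finite rank, and that lattice is a
noetherian module. -/
theorem IsOrder.exists_maximal_ge (ha : a ≠ 0) (hb : b ≠ 0) {O : Subring ℍ[ℚ,a,b]} (hO : IsOrder O) :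
    ∃ R, IsMaximalOrder R ∧ O ≤ R := by
  obtain ⟨n₁, hn₁, h₁⟩ := hO.exists_nsmul_mem ⟨0, 1, 0, 0⟩
  obtain ⟨n₂, hn₂, h₂⟩ := hO.exists_nsmul_mem ⟨0, 0, 1, 0⟩
  obtain ⟨n₃, hn₃, h₃⟩ := hO.exists_nsmul_mem ⟨0, 0, 0, 1⟩
  let φ : (Fin 4 → ℤ) →ₗ[ℤ] ℍ[ℚ,a,b] :=
    { toFun := fun v => ⟨v 0 / 2, v 1 / (-2 * n₁ * a), v 2 / (-2 * n₂ * b), v 3 / (2 * n₃ * a * b)⟩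
      map_add' := fun v w => by ext <;> simp [add_div]
      map_smul' := fun t v => by ext <;> simp [mul_div_assoc] }
  let M := LinearMap.range φ
  have hM : ∀ S, IsOrder S → O ≤ S → ∀ x ∈ S, x ∈ M := by
    intro S hS hOS x hx
    obtain ⟨t₀, e₀⟩ := hS.exists_int_quatForm hx S.one_mem
    obtain ⟨t₁, e₁⟩ := hS.exists_int_quatForm hx (hOS h₁)
    obtain ⟨t₂, e₂⟩ := hS.exists_int_quatForm hx (hOS h₂)
    obtain ⟨t₃, e₃⟩ := hS.exists_int_quatForm hx (hOS h₃)
    have p₁ : (n₁ : ℚ) ≠ 0 := by exact_mod_cast hn₁.ne'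
    have p₂ : (n₂ : ℚ) ≠ 0 := by exact_mod_cast hn₂.ne'
    have p₃ : (n₃ : ℚ) ≠ 0 := by exact_mod_cast hn₃.ne'
    simp [quatForm] at e₀ e₁ e₂ e₃
    refine ⟨![t₀, t₁, t₂, t₃], ?_⟩
    ext
    · simp [φ]; linarith
    · simp [φ]; field_simp; linarith
    · simp [φ]; field_simp; linarith
    · simp [φ]; field_simp; linarith
  have : Module.Finite ℤ M := inferInstance
  let f : Subring ℍ[ℚ,a,b] → Submodule ℤ M := fun S => (S.toAddSubgroup.toIntSubmodule).comap M.subtype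
  have hf : ∀ S (x : M), x ∈ f S ↔ (x : ℍ[ℚ,a,b]) ∈ S := fun S x => Iff.rfl
  have hwf : WellFounded (fun x y : Submodule ℤ M => x > y) := wellFounded_gt
  obtain ⟨_, ⟨R, ⟨hR, hOR⟩, rfl⟩, hmax⟩ := hwf.has_min (f '' {S | IsOrder S ∧ O ≤ S}) ⟨_, O, ⟨hO, le_rfl⟩, rfl⟩
  refine ⟨R, ⟨hR, fun T hT hRT x hx => ?_⟩, hOR⟩
  have h1 := hmax (f T) ⟨T, ⟨hT, hOR.trans hRT⟩, rfl⟩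
  have h2 : f R ≤ f T := fun y hy => hRT hy
  have h3 : f T ≤ f R := by
    by_contra h
    exact h1 (lt_of_le_not_ge h2 h)
  exact h3 (x := ⟨x, hM T hT (hOR.trans hRT) x hx⟩) hx

end Orders

/-! ### Orders containing the ring of integers of an imaginary quadratic field -/

section OrdersContaining

open NumberField

variable {K : Type*} [Field K] [NumberField K]

namespace QuadraticModel

theorem exists_nsmul_int (m : QuadraticModel K) (x : K) : ∃ n : ℕ, 0 < n ∧ ∃ z : 𝓞 K, (z : K) = n • x := by
  refine ⟨(m.re x).den * (m.im x).den, Nat.mul_pos (Rat.den_pos _) (Rat.den_pos _), ?_⟩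
  have e1 := Rat.mul_den_eq_num (m.re x)
  have e2 := Rat.mul_den_eq_num (m.im x)
  apply m.exists_int_of_coords ((m.re x).num * (m.im x).den - (m.im x).num * (m.re x).den)
    (2 * ((m.im x).num * (m.re x).den))
  · rw [nsmul_eq_mul, re_mul, re_natCast, im_natCast]
    push_cast
    rw [← e1, ← e2]
    ring
  · rw [nsmul_eq_mul, im_mul, re_natCast, im_natCast]
    push_cast
    rw [← e2]
    ring

theorem exists_nsmul_mem (m : QuadraticModel K) {I : FracIdeal K} (hI : I ≠ 0) (x : K) : ∃ n : ℕ, 0 < n ∧ n • x ∈ I := by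
  obtain ⟨y, hy, N, hy0, -, -⟩ := m.exists_nrm_eq_mul hI Nat.prime_two
  obtain ⟨n, hn, z, hz⟩ := m.exists_nsmul_int (x * y⁻¹)
  refine ⟨n, hn, ?_⟩
  have : n • x = z • y := by
    rw [Algebra.smul_def z y]
    change _ = (z : K) * y
    rw [hz, smul_mul_assoc, inv_mul_cancel_right₀ hy0]
  rw [this]
  exact (I : Submodule (𝓞 K) K).smul_mem z hy

end QuadraticModel

namespace QuatModel

variable {m : QuadraticModel K} {a b : ℚ} (Q : QuatModel m a b)

theorem κ_eq (x : K) : Q.κ x = Q.elem x 0 := (Q.elem_zero_right x).symm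

theorem mul_star_elem (α β : K) : Q.elem α β * star (Q.elem α β) =
    algebraMap ℚ _ (m.nrm α - Q.c * m.nrm β) := by
  rw [star_elem, elem_mul, ← Q.κ_ratCast, κ_eq]
  congr 1
  · rw [map_neg, mul_neg, m.mul_conj, m.mul_conj, Algebra.smul_def, eq_ratCast]
    push_cast
    ring
  · simp; ring

/-- The ideal of all `β` such that `βj` lies in a given order. -/
noncomputable def coeffIdeal {R : Subring ℍ[ℚ,a,b]} (hR : IsOrder R)
    (hκ : ∀ x : 𝓞 K, Q.κ x ∈ R) : FracIdeal K :=
  let L : Submodule (𝓞 K) K :=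
    { carrier := {β | Q.elem 0 β ∈ R}
      add_mem' := fun {x y} hx hy => by
        have := R.add_mem hx hy
        rwa [elem_add, add_zero] at this
      zero_mem' := by
        change Q.elem 0 0 ∈ R
        rw [elem_zero]
        exact R.zero_mem
      smul_mem' := fun z x hx => by
        have := R.mul_mem (hκ z) hx
        rw [κ_eq, elem_mul] at this
        simpa [Algebra.smul_def] using this }
  ⟨L, by
    apply FractionalIdeal.isFractional_of_fg
    have := hR.1
    let φ : L.restrictScalars ℤ →ₗ[ℤ] R :=
      { toFun := fun x => ⟨Q.elem 0 x, x.2⟩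
        map_add' := fun x y => Subtype.ext (by
          simp only [Subring.coe_add, elem_add, add_zero]; rfl)
        map_smul' := fun t x => Subtype.ext (by
          change Q.elem 0 (t • (x : K)) = t • Q.elem 0 x
          rw [← Int.cast_smul_eq_zsmul ℚ, ← Int.cast_smul_eq_zsmul ℚ, elem_smul, smul_zero]) }
    have hφ : Function.Injective φ := fun x y h =>
      Subtype.ext (Q.elem_inj (congrArg Subtype.val h)).2
    have hfin : Module.Finite ℤ (L.restrictScalars ℤ) := Module.Finite.of_injective φ hφ
    exact Submodule.FG.of_restrictScalars ℤ (Module.Finite.iff_fg.mp hfin)⟩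

variable {R : Subring ℍ[ℚ,a,b]} (hR : IsOrder R) (hκ : ∀ x : 𝓞 K, Q.κ x ∈ R)

theorem mem_coeffIdeal {β : K} : β ∈ Q.coeffIdeal hR hκ ↔ Q.elem 0 β ∈ R := Iff.rfl

theorem coeffIdeal_ne_zero : Q.coeffIdeal hR hκ ≠ 0 := by
  obtain ⟨n, hn, h⟩ := hR.exists_nsmul_mem (Q.elem 0 1)
  rw [← Nat.cast_smul_eq_nsmul ℚ, elem_smul, smul_zero] at h
  have h1 : ((n : ℚ) • (1 : K)) ∈ Q.coeffIdeal hR hκ := h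
  intro h0
  rw [h0, FractionalIdeal.mem_zero_iff] at h1
  rcases smul_eq_zero.mp h1 with h2 | h2
  · exact hn.ne' (by exact_mod_cast h2)
  · exact one_ne_zero h2

/-- The reduced norm of `βj` is `-c N(β)`, an integer for every `β` in the ideal. Integrality passes
from the norms of elements to the norm of the ideal. -/
theorem exists_absNorm_coeffIdeal : ∃ t : ℕ, 0 < t ∧
    -Q.c * FractionalIdeal.absNorm (Q.coeffIdeal hR hκ) = t := by
  have h0 := Q.coeffIdeal_ne_zero hR hκ
  obtain ⟨t, ht⟩ := m.mul_absNorm_int h0 (-Q.c) (fun x hx => by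
    have h1 := (Q.mem_coeffIdeal hR hκ).mp hx
    have h2 := R.mul_mem h1 (hR.star_mem h1)
    rw [mul_star_elem] at h2
    obtain ⟨t, ht⟩ := hR.exists_int h2
    refine ⟨t, ?_⟩
    rw [← ht]
    have : m.nrm 0 = 0 := m.nrm_eq_zero.mpr rfl
    rw [this]
    ring)
  have hpos : 0 < -Q.c * FractionalIdeal.absNorm (Q.coeffIdeal hR hκ) :=
    mul_pos (neg_pos.mpr Q.c_neg) (QuadraticModel.absNorm_pos h0)
  rw [ht] at hpos
  have hpos' : 0 < t := by exact_mod_cast hpos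
  refine ⟨t.toNat, by omega, ?_⟩
  rw [ht]
  exact_mod_cast (Int.toNat_of_nonneg hpos'.le).symm

theorem smul_mul_conj_int {I : FracIdeal K} (hI : I ≠ 0) {t : ℤ} (ht : -Q.c * FractionalIdeal.absNorm I = t)
    {x y : K} (hx : x ∈ I) (hy : y ∈ I) : ∃ z : 𝓞 K, Q.c • (x * m.conj y) = z := by
  obtain ⟨z, hz⟩ := m.mul_conj_mem hI hx hy
  refine ⟨((-t : ℤ) : 𝓞 K) * z, ?_⟩
  rw [hz, smul_smul, show Q.c * FractionalIdeal.absNorm I = ((-t : ℤ) : ℚ) by push_cast; linarith]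
  rw [Int.cast_smul_eq_zsmul, zsmul_eq_mul]
  simp

/-- The ring `𝓞 + I j`. -/
noncomputable def sumSubring {I : FracIdeal K} (hI : I ≠ 0) {t : ℤ}
    (ht : -Q.c * FractionalIdeal.absNorm I = t) : Subring ℍ[ℚ,a,b] where
  carrier := {x | ∃ (z : 𝓞 K) (β : K), β ∈ I ∧ x = Q.elem z β}
  mul_mem' := by
    rintro _ _ ⟨z, β, hβ, rfl⟩ ⟨w, γ, hγ, rfl⟩
    obtain ⟨s, hs⟩ := Q.smul_mul_conj_int hI ht hβ hγ
    refine ⟨z * w + s, z * γ + β * m.conj w, ?_, ?_⟩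
    · refine (I : Submodule (𝓞 K) K).add_mem ?_ ?_
      · have := (I : Submodule (𝓞 K) K).smul_mem z hγ
        rwa [Algebra.smul_def] at this
      · have := (I : Submodule (𝓞 K) K).smul_mem (m.conjO w) hβ
        rw [Algebra.smul_def, mul_comm] at this
        exact this
    · rw [elem_mul, hs]; simp
  one_mem' := ⟨1, 0, I.zero_mem, by simp [elem_one]⟩
  add_mem' := by
    rintro _ _ ⟨z, β, hβ, rfl⟩ ⟨w, γ, hγ, rfl⟩
    exact ⟨z + w, β + γ, (I : Submodule (𝓞 K) K).add_mem hβ hγ, by rw [elem_add]; simp⟩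
  zero_mem' := ⟨0, 0, I.zero_mem, by simp [elem_zero]⟩
  neg_mem' := by
    rintro _ ⟨z, β, hβ, rfl⟩
    exact ⟨-z, -β, (I : Submodule (𝓞 K) K).neg_mem hβ, by rw [elem_neg]; simp⟩

theorem isOrder_sumSubring {I : FracIdeal K} (hI : I ≠ 0) {t : ℤ}
    (ht : -Q.c * FractionalIdeal.absNorm I = t) : IsOrder (Q.sumSubring hI ht) := by
  constructor
  · let φ : (𝓞 K × I) →ₗ[ℤ] Q.sumSubring hI ht :=
      { toFun := fun x => ⟨Q.elem x.1 x.2, x.1, x.2, x.2.2, rfl⟩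
        map_add' := fun x y => Subtype.ext (by
          simp only [Subring.coe_add, elem_add]; simp)
        map_smul' := fun s x => Subtype.ext (by
          change Q.elem ((s • x.1 : 𝓞 K) : K) (s • (x.2 : K)) = s • Q.elem x.1 x.2
          rw [← Int.cast_smul_eq_zsmul ℚ s (Q.elem _ _), elem_smul, Int.cast_smul_eq_zsmul, Int.cast_smul_eq_zsmul]
          simp) }
    apply Module.Finite.of_surjective φ
    rintro ⟨_, z, β, hβ, rfl⟩
    exact ⟨(z, ⟨β, hβ⟩), rfl⟩
  · rw [eq_top_iff]
    rintro x -
    obtain ⟨α, β, rfl⟩ := Q.exists_eq_elem x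
    obtain ⟨n, hn, z, hz⟩ := m.exists_nsmul_int α
    obtain ⟨k, hk, hkβ⟩ := m.exists_nsmul_mem hI β
    have h1 : (n * k) • Q.elem α β ∈ Q.sumSubring hI ht := by
      refine ⟨k * z, (n * k) • β, ?_, ?_⟩
      · rw [mul_smul]; exact (I : Submodule (𝓞 K) K).smul_of_tower_mem n hkβ
      · rw [← Nat.cast_smul_eq_nsmul ℚ, elem_smul, Nat.cast_smul_eq_nsmul, Nat.cast_smul_eq_nsmul]
        congr 1
        simp [hz]
        ring
    have hnk : ((n * k : ℕ) : ℚ) ≠ 0 := by exact_mod_cast (Nat.mul_pos hn hk).ne'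
    have h2 := Submodule.smul_mem (Submodule.span ℚ ((Q.sumSubring hI ht : Subring _) : Set ℍ[ℚ,a,b]))
      (((n * k : ℕ) : ℚ)⁻¹) (Submodule.subset_span h1)
    rwa [← Nat.cast_smul_eq_nsmul ℚ, smul_smul, inv_mul_cancel₀ hnk, one_smul] at h2

theorem exists_isMaximalOrder (ha : a ≠ 0) (hb : b ≠ 0) {I : FracIdeal K} (hI : I ≠ 0) {t : ℤ}
    (ht : -Q.c * FractionalIdeal.absNorm I = t) :
    ∃ (R : Subring ℍ[ℚ,a,b]) (hR : IsMaximalOrder R) (hκ : ∀ x : 𝓞 K, Q.κ x ∈ R),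
      I ≤ Q.coeffIdeal hR.prop hκ := by
  obtain ⟨R, hR, hle⟩ := (Q.isOrder_sumSubring hI ht).exists_maximal_ge ha hb
  refine ⟨R, hR, fun x => hle ⟨x, 0, I.zero_mem, Q.κ_eq _⟩, fun β hβ => ?_⟩
  exact hle ⟨0, β, hβ, by simp⟩

end QuatModel

end OrdersContaining

/-! ### Maximal orders containing the ring of integers -/

section MaximalOrders

open NumberField

variable {K : Type*} [Field K] [NumberField K] {m : QuadraticModel K} {a b : ℚ} (Q : QuatModel m a b)

namespace QuatModel

theorem mem_of_coprime_nsmul_mem {A : Type*} [AddCommGroup A] (H : AddSubgroup A) {n k : ℕ}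
    (h : n.Coprime k) {x : A} (hn : n • x ∈ H) (hk : k • x ∈ H) : x ∈ H := by
  have h1 := Nat.gcd_eq_gcd_ab n k
  rw [h] at h1
  have h2 : x = n.gcdA k • (n • x) + n.gcdB k • (k • x) := by
    rw [← natCast_zsmul, ← natCast_zsmul, smul_smul, smul_smul, ← add_smul,
      show n.gcdA k * (n : ℤ) + n.gcdB k * (k : ℤ) = 1 by rw [mul_comm, mul_comm _ (k : ℤ), ← h1]; simp, one_smul]
  rw [h2]
  exact H.add_mem (H.zsmul_mem hn _) (H.zsmul_mem hk _)

theorem elem_nsmul (n : ℕ) (α β : K) : n • Q.elem α β = Q.elem (n • α) (n • β) := by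
  rw [← Nat.cast_smul_eq_nsmul ℚ, elem_smul, Nat.cast_smul_eq_nsmul, Nat.cast_smul_eq_nsmul]

variable {R : Subring ℍ[ℚ,a,b]}

/-- The ideal of coefficients of a maximal order cannot be enlarged. -/
theorem le_coeffIdeal_of_isMaximalOrder (hR : IsMaximalOrder R) (hκ : ∀ x : 𝓞 K, Q.κ x ∈ R)
    {I : FracIdeal K} (hI : Q.coeffIdeal hR.prop hκ ≤ I) {t : ℤ} (ht : -Q.c * FractionalIdeal.absNorm I = t)
    {k : ℕ} (hk : 0 < k) (hkI : ∀ x ∈ I, k • x ∈ Q.coeffIdeal hR.prop hκ)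
    (hco : ∀ α β, Q.elem α β ∈ R → ∃ n : ℕ, n.Coprime k ∧ (∃ z : 𝓞 K, (z : K) = n • α) ∧
      n • β ∈ Q.coeffIdeal hR.prop hκ) : I ≤ Q.coeffIdeal hR.prop hκ := by
  have hI0 : I ≠ 0 := by
    rintro rfl
    exact Q.coeffIdeal_ne_zero hR.prop hκ (le_antisymm hI bot_le)
  -- The enlargement is `R + I j`. To see that it is closed under products `r (γ j)` and `(γ j) r`,
  -- multiply by `k`, which moves `γ j` into `R`, and by the coprime `n`, which moves `r` into `𝓞 +
  -- I j`.
  let H : AddSubgroup ℍ[ℚ,a,b] :=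
    { carrier := {x | ∃ r ∈ R, ∃ β ∈ I, x = r + Q.elem 0 β}
      add_mem' := by
        rintro _ _ ⟨r, hr, β, hβ, rfl⟩ ⟨s, hs, γ, hγ, rfl⟩
        refine ⟨r + s, R.add_mem hr hs, β + γ, (I : Submodule (𝓞 K) K).add_mem hβ hγ, ?_⟩
        rw [← add_zero (0 : K), ← elem_add, add_zero]
        abel
      zero_mem' := ⟨0, R.zero_mem, 0, I.zero_mem, by rw [elem_zero, add_zero]⟩
      neg_mem' := by
        rintro _ ⟨r, hr, β, hβ, rfl⟩
        refine ⟨-r, R.neg_mem hr, -β, (I : Submodule (𝓞 K) K).neg_mem hβ, ?_⟩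
        rw [neg_add, elem_neg, neg_zero] }
  have hRH : ∀ r ∈ R, r ∈ H := fun r hr => ⟨r, hr, 0, I.zero_mem, by rw [elem_zero, add_zero]⟩
  have hIH : ∀ β ∈ I, Q.elem 0 β ∈ H := fun β hβ => ⟨0, R.zero_mem, β, hβ, by rw [zero_add]⟩
  have hzH : ∀ (z : 𝓞 K) (x : K), x = z → ∀ β ∈ I, Q.elem x β ∈ H := by
    rintro z x rfl β hβ
    refine ⟨Q.κ z, hκ z, β, hβ, ?_⟩
    rw [κ_eq, elem_add, add_zero, zero_add]
  have hkH : ∀ β ∈ I, k • Q.elem 0 β ∈ R := fun β hβ => by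
    rw [elem_nsmul, smul_zero]
    exact hkI β hβ
  have hright : ∀ r ∈ R, ∀ γ ∈ I, r * Q.elem 0 γ ∈ H := by
    intro r hr γ hγ
    obtain ⟨α, β, rfl⟩ := Q.exists_eq_elem r
    obtain ⟨n, hn, ⟨z, hz⟩, hβ⟩ := hco α β hr
    apply mem_of_coprime_nsmul_mem H hn
    · rw [← smul_mul_assoc, elem_nsmul, ← hz, elem_mul]
      obtain ⟨s, hs⟩ := Q.smul_mul_conj_int hI0 ht (hI hβ) hγ
      rw [hs]
      refine hzH (z * 0 + s) _ (by simp) _ ?_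
      rw [map_zero, mul_zero, add_zero]
      have := (I : Submodule (𝓞 K) K).smul_mem z hγ
      rwa [Algebra.smul_def] at this
    · rw [← mul_smul_comm]
      exact hRH _ (R.mul_mem hr (hkH γ hγ))
  have hleft : ∀ r ∈ R, ∀ γ ∈ I, Q.elem 0 γ * r ∈ H := by
    intro r hr γ hγ
    obtain ⟨α, β, rfl⟩ := Q.exists_eq_elem r
    obtain ⟨n, hn, ⟨z, hz⟩, hβ⟩ := hco α β hr
    apply mem_of_coprime_nsmul_mem H hn
    · rw [← mul_smul_comm, elem_nsmul, ← hz, elem_mul]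
      obtain ⟨s, hs⟩ := Q.smul_mul_conj_int hI0 ht hγ (hI hβ)
      rw [hs]
      refine hzH s _ (by simp) _ ?_
      rw [zero_mul, zero_add]
      have := (I : Submodule (𝓞 K) K).smul_mem (m.conjO z) hγ
      rw [Algebra.smul_def, mul_comm] at this
      exact this
    · rw [← smul_mul_assoc]
      exact hRH _ (R.mul_mem (hkH γ hγ) hr)
  let T : Subring ℍ[ℚ,a,b] :=
    { H with
      one_mem' := hRH 1 R.one_mem
      mul_mem' := by
        rintro _ _ ⟨r, hr, β, hβ, rfl⟩ ⟨s, hs, γ, hγ, rfl⟩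
        change _ ∈ H
        rw [add_mul, mul_add, mul_add]
        refine H.add_mem (H.add_mem (hRH _ (R.mul_mem hr hs)) (hright r hr γ hγ))
          (H.add_mem (hleft s hs β hβ) ?_)
        rw [elem_mul]
        obtain ⟨s, hs⟩ := Q.smul_mul_conj_int hI0 ht hβ hγ
        rw [hs]
        refine hzH s _ (by simp) _ ?_
        rw [map_zero, mul_zero, zero_mul, add_zero]
        exact I.zero_mem }
  have hTH : ∀ x, x ∈ T ↔ x ∈ H := fun x => Iff.rfl
  have hkT : ∀ x ∈ T, k • x ∈ R := by
    rintro _ ⟨r, hr, β, hβ, rfl⟩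
    rw [smul_add]
    exact R.add_mem (R.nsmul_mem hr k) (hkH β hβ)
  -- Multiplication by `k` embeds the new ring in `R`, so it is finitely generated.
  have hT : IsOrder T := by
    constructor
    · have := hR.prop.1
      let φ : T →ₗ[ℤ] R :=
        { toFun := fun x => ⟨k • (x : ℍ[ℚ,a,b]), hkT x x.2⟩
          map_add' := fun x y => Subtype.ext (smul_add k (x : ℍ[ℚ,a,b]) y)
          map_smul' := fun s x => Subtype.ext (smul_comm k s (x : ℍ[ℚ,a,b])) }
      have hφ : Function.Injective φ := fun x y h => by
        have h1 : k • (x : ℍ[ℚ,a,b]) = k • (y : ℍ[ℚ,a,b]) := congrArg Subtype.val h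
        rw [← Nat.cast_smul_eq_nsmul ℚ, ← Nat.cast_smul_eq_nsmul ℚ] at h1
        have hk' : (k : ℚ) ≠ 0 := by exact_mod_cast hk.ne'
        exact Subtype.ext (smul_right_injective _ hk' h1)
      exact Module.Finite.of_injective φ hφ
    · rw [eq_top_iff, ← hR.prop.2]
      exact Submodule.span_mono fun x hx => hRH x hx
  intro β hβ
  exact hR.le_of_ge hT (fun x hx => hRH x hx) (hIH β hβ)

/-- Integrality of the pairings with 1 and `ω` puts `α` in the inverse different, so `d α` is
integral; whenever `n α` is, subtracting it from `n (α + βj)` shows that `n β` is in the coefficient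
ideal. This settles `l ∤ d`. For `l ∣ d` take `n = d / l`, prime to `l` as `d` is squarefree; the
reduced norm and `l ∣ t` show that `n α` is already integral. -/
theorem exists_coprime_nsmul_mem (hR : IsOrder R) (hκ : ∀ x : 𝓞 K, Q.κ x ∈ R)
    {l t : ℕ} (hl : l.Prime) (ht : -Q.c * FractionalIdeal.absNorm (Q.coeffIdeal hR hκ) = t) (hlt : l ∣ t)
    (α β : K) (h : Q.elem α β ∈ R) : ∃ n : ℕ, n.Coprime l ∧ (∃ z : 𝓞 K, (z : K) = n • α) ∧
      n • β ∈ Q.coeffIdeal hR hκ := by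
  have hd0 : (m.d : ℚ) ≠ 0 := m.d_pos_rat.ne'
  obtain ⟨ω, hω⟩ := m.exists_int_of_coords (x := m.ofCoords (1 / 2) (1 / 2)) 0 1 (by simp) (by simp)
  obtain ⟨t₀, e₀⟩ := hR.exists_int_quatForm h R.one_mem
  obtain ⟨t₁, e₁⟩ := hR.exists_int_quatForm h (hκ ω)
  rw [← Q.elem_one, quatForm_elem] at e₀
  rw [κ_eq, quatForm_elem, hω] at e₁
  simp at e₀ e₁
  have hre : m.re α = t₀ / 2 := by linarith
  have him : m.im α = (2 * t₁ - t₀) / (2 * m.d) := by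
    rw [hre] at e₁
    field_simp
    linarith
  have hfin : ∀ n : ℕ, (∃ z : 𝓞 K, (z : K) = n • α) → n • β ∈ Q.coeffIdeal hR hκ := by
    rintro n ⟨z, hz⟩
    have h1 := R.sub_mem (R.nsmul_mem h n) (hκ z)
    rw [hz, κ_eq, elem_nsmul, elem_sub, sub_self, sub_zero] at h1
    exact h1
  have hdz : ∃ z : 𝓞 K, (z : K) = m.d • α := by
    have hd4 := m.mod_four
    have hdiv : ((m.d : ℤ) * t₀ - (2 * t₁ - t₀)) / 2 * 2 = (m.d : ℤ) * t₀ - (2 * t₁ - t₀) := by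
      apply Int.ediv_mul_cancel
      have h1 : (m.d : ℤ) = 4 * (m.d / 4 : ℕ) + 3 := by omega
      rw [h1]
      ring_nf
      omega
    have hdq : (((((m.d : ℤ) * t₀ - (2 * t₁ - t₀)) / 2 : ℤ)) : ℚ) = ((m.d : ℚ) * t₀ - (2 * t₁ - t₀)) / 2 := by
      rw [eq_div_iff two_ne_zero]
      exact_mod_cast hdiv
    apply m.exists_int_of_coords (((m.d : ℤ) * t₀ - (2 * t₁ - t₀)) / 2) (2 * t₁ - t₀)
    · rw [hdq]; simp [hre]; ring
    · simp [him]; field_simp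
  by_cases hld : l ∣ m.d
  · obtain ⟨d', hd'⟩ := hld
    have hcop : d'.Coprime l := by
      rw [Nat.coprime_comm, hl.coprime_iff_not_dvd]
      rintro ⟨d'', rfl⟩
      have := m.squarefree l ⟨d'', by rw [hd']; ring⟩
      exact hl.one_lt.ne' (Nat.isUnit_iff.mp this)
    have hl2 : l ≠ 2 := by
      rintro rfl
      have := m.mod_four
      omega
    obtain ⟨y, hy⟩ := m.exists_int_of_coords (x := m.ofCoords 0 1 * α) (-t₁) t₀
      (by simp [hre, him]; field_simp; ring) (by simp [hre])
    obtain ⟨δ, hδ⟩ := m.exists_int_of_coords (x := m.ofCoords 0 1) (-1) 2 (by simp) (by simp)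
    have hδβ : m.ofCoords 0 1 * β ∈ Q.coeffIdeal hR hκ := by
      have h1 := R.sub_mem (R.mul_mem (hκ δ) h) (hκ y)
      rw [hδ, hy, κ_eq, κ_eq, elem_mul, elem_sub] at h1
      rw [mem_coeffIdeal]
      simpa using h1
    obtain ⟨s, hs⟩ := m.nrm_mem (Q.coeffIdeal_ne_zero hR hκ) hδβ
    have h2 := R.mul_mem h (hR.star_mem h)
    rw [mul_star_elem] at h2
    obtain ⟨u, hu⟩ := hR.exists_int h2
    have hs' : m.d * m.nrm β = FractionalIdeal.absNorm (Q.coeffIdeal hR hκ) * s := by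
      rw [← hs, m.nrm_mul]
      simp [QuadraticModel.nrm]
    -- This is `4d` times the equation `N(α) - c N(β) = u`, with `d N(β)` expressed by the norm of
    -- `√-d β`, a member of the coefficient ideal.
    have hkey : (2 * t₁ - t₀) ^ 2 = m.d * (4 * u - t₀ ^ 2) - 4 * (t * s : ℤ) := by
      have h3 : m.nrm α * (4 * m.d) = (m.d : ℚ) * t₀ ^ 2 + (2 * t₁ - t₀) ^ 2 := by
        rw [QuadraticModel.nrm, hre, him]
        field_simp
        ring
      have : ((2 * t₁ - t₀) ^ 2 : ℚ) = m.d * (4 * u - t₀ ^ 2) - 4 * (t * s) := by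
        rw [← ht, ← hu]
        linear_combination -h3 + 4 * Q.c * hs'
      exact_mod_cast this
    have hl' := Nat.prime_iff_prime_int.mp hl
    have hdvd : (l : ℤ) ∣ 2 * t₁ - t₀ := by
      apply hl'.dvd_of_dvd_pow (n := 2)
      rw [hkey]
      have hld : (l : ℤ) ∣ m.d := ⟨d', by exact_mod_cast hd'⟩
      refine dvd_sub (Dvd.dvd.mul_right hld _) (Dvd.dvd.mul_left ?_ _)
      exact Dvd.dvd.mul_right (by exact_mod_cast hlt) _
    obtain ⟨w, hw⟩ := hdvd
    have hdiv : ((d' : ℤ) * t₀ - w) / 2 * 2 = (d' : ℤ) * t₀ - w := by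
      apply Int.ediv_mul_cancel
      have hlo : (l : ℤ) % 2 = 1 := by
        rcases hl.eq_two_or_odd with h | h
        · exact absurd h hl2
        · omega
      have hdo : (d' : ℤ) % 2 = 1 := by
        have h4 : (l * d') % 4 = 3 := by rw [← hd']; exact m.mod_four
        have : d' % 2 = 1 := by
          by_contra h
          obtain ⟨e, rfl⟩ : ∃ e, d' = 2 * e := ⟨d' / 2, by omega⟩
          have : (l * (2 * e)) = 2 * (l * e) := by ring
          omega
        omega
      apply Int.dvd_of_emod_eq_zero
      have h1 : (2 * t₁ - t₀) % 2 = w % 2 := by rw [hw, Int.mul_emod, hlo]; simp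
      have h2 : ((d' : ℤ) * t₀) % 2 = t₀ % 2 := by rw [Int.mul_emod, hdo]; simp
      omega
    have hdq : (((((d' : ℤ) * t₀ - w) / 2 : ℤ)) : ℚ) = ((d' : ℚ) * t₀ - w) / 2 := by
      rw [eq_div_iff two_ne_zero]
      exact_mod_cast hdiv
    have hwq : (2 * t₁ - t₀ : ℚ) = l * w := by exact_mod_cast hw
    have hdq' : (m.d : ℚ) = l * d' := by exact_mod_cast hd'
    have hz : ∃ z : 𝓞 K, (z : K) = d' • α := by
      apply m.exists_int_of_coords (((d' : ℤ) * t₀ - w) / 2) w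
      · rw [hdq]; simp [hre]; ring
      · rw [nsmul_eq_mul, m.im_mul, m.re_natCast, m.im_natCast, him, hwq, zero_mul, add_zero]
        rw [hdq'] at hd0 ⊢
        have h1 := left_ne_zero_of_mul hd0
        have h2 := right_ne_zero_of_mul hd0
        field_simp
    exact ⟨d', hcop, hz, hfin _ hz⟩
  · exact ⟨m.d, (hl.coprime_iff_not_dvd.mpr hld).symm, hdz, hfin _ hdz⟩

/-- If `N(P)` divided `t`, the larger ideal `I P⁻¹` would still have integral `-c N(I P⁻¹)`, and `l
I P⁻¹ ⊆ I`, so `R + I P⁻¹ j` would contradict maximality. -/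
theorem not_absNorm_dvd (hR : IsMaximalOrder R) (hκ : ∀ x : 𝓞 K, Q.κ x ∈ R) {t : ℕ}
    (ht : -Q.c * FractionalIdeal.absNorm (Q.coeffIdeal hR.prop hκ) = t) {P : Ideal (𝓞 K)} (hP : P ≠ ⊤)
    {l : ℕ} (hl : l.Prime) (hlP : (l : 𝓞 K) ∈ P) : ¬ Ideal.absNorm P ∣ t := by
  rintro ⟨s, hs⟩
  set I := Q.coeffIdeal hR.prop hκ with hI
  have hI0 : I ≠ 0 := Q.coeffIdeal_ne_zero hR.prop hκ
  have hP0 : P ≠ ⊥ := by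
    rintro rfl
    have : l = 0 := by exact_mod_cast (Ideal.mem_bot.mp hlP)
    exact hl.ne_zero this
  have hPF : ((P : Ideal (𝓞 K)) : FracIdeal K) ≠ 0 := by rwa [Ne, FractionalIdeal.coeIdeal_eq_zero]
  have hNP : (Ideal.absNorm P : ℚ) ≠ 0 := by
    exact_mod_cast (Ideal.absNorm_eq_zero_iff.not.mpr hP0)
  have hII : I = P * (I * (P : FracIdeal K)⁻¹) := by
    rw [mul_comm, mul_assoc, inv_mul_cancel₀ hPF, mul_one]
  have hlt : l ∣ t := by
    rw [hs]
    apply Dvd.dvd.mul_right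
    obtain ⟨M, hM, hPM⟩ := Ideal.exists_le_maximal P hP
    have h1 : Ideal.absNorm P ≠ 1 := by rwa [Ne, Ideal.absNorm_eq_one_iff]
    obtain ⟨q, hq, hqP⟩ := Nat.exists_prime_and_dvd h1
    have h2 := (map_dvd Ideal.absNorm (Ideal.dvd_iff_le.mpr ((Ideal.span_singleton_le_iff_mem P).mpr hlP)))
    have h3 : Ideal.absNorm (Ideal.span {(l : 𝓞 K)}) = l ^ 2 := by
      have := m.absNorm_span_singleton (l : 𝓞 K)
      have h4 : ((l : 𝓞 K) : K) = (l : K) := map_natCast _ _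
      rw [h4, m.nrm_natCast] at this
      exact_mod_cast this
    rw [h3] at h2
    have h5 := (Nat.prime_dvd_prime_iff_eq hq hl).mp (hq.dvd_of_dvd_pow (hqP.trans h2))
    rwa [h5] at hqP
  have hle : I ≤ I * (P : FracIdeal K)⁻¹ := by
    conv_lhs => rw [hII]
    calc (P : FracIdeal K) * (I * (P : FracIdeal K)⁻¹) ≤ 1 * (I * (P : FracIdeal K)⁻¹) := by
          gcongr; exact FractionalIdeal.coeIdeal_le_one
      _ = _ := one_mul _
  have h1 := Q.le_coeffIdeal_of_isMaximalOrder hR hκ (I := I * (P : FracIdeal K)⁻¹) hle (t := s) (by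
    rw [map_mul, map_inv₀, FractionalIdeal.coeIdeal_absNorm, ← mul_assoc, ht, hs]
    push_cast
    field_simp) hl.pos (fun x hx => by
      change l • x ∈ I
      rw [hII, nsmul_eq_mul]
      exact FractionalIdeal.mul_mem_mul ((FractionalIdeal.mem_coeIdeal _).mpr ⟨l, hlP, by simp⟩) hx)
    (fun α β h => Q.exists_coprime_nsmul_mem hR.prop hκ hl ht hlt α β h)
  have h2 : I * (P : FracIdeal K)⁻¹ = I := le_antisymm h1 hle
  have h3 : (P : FracIdeal K)⁻¹ = 1 := mul_left_cancel₀ hI0 (by rw [h2, mul_one])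
  rw [inv_eq_one, FractionalIdeal.coeIdeal_eq_one] at h3
  exact hP (h3.trans Ideal.one_eq_top)

/-- The ideal `(l)` has norm `l²`, so `l²` does not divide `t`. Were `(l)` not prime, it would have
a factor of norm `l`, excluded in the same way by `l ∣ t`. -/
theorem inertCondition_of_dvd (hR : IsMaximalOrder R) (hκ : ∀ x : 𝓞 K, Q.κ x ∈ R) {t : ℕ}
    (ht : -Q.c * FractionalIdeal.absNorm (Q.coeffIdeal hR.prop hκ) = t) {l : ℕ} (hl : l.Prime) (hlt : l ∣ t) :
    InertCondition m.d l ∧ ¬ l ^ 2 ∣ t := by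
  have hne : Ideal.span {(l : 𝓞 K)} ≠ ⊤ := by
    intro h
    have := m.absNorm_span_singleton (l : 𝓞 K)
    have h4 : ((l : 𝓞 K) : K) = (l : K) := map_natCast _ _
    rw [h4, m.nrm_natCast, h, Ideal.absNorm_top] at this
    have h5 : 1 = l ^ 2 := by exact_mod_cast this
    nlinarith [hl.two_le]
  have hN : Ideal.absNorm (Ideal.span {(l : 𝓞 K)}) = l ^ 2 := by
    have := m.absNorm_span_singleton (l : 𝓞 K)
    have h4 : ((l : 𝓞 K) : K) = (l : K) := map_natCast _ _
    rw [h4, m.nrm_natCast] at this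
    exact_mod_cast this
  have h2 : ¬ l ^ 2 ∣ t := by
    rw [← hN]
    exact Q.not_absNorm_dvd hR hκ ht hne hl (Ideal.mem_span_singleton_self _)
  refine ⟨?_, h2⟩
  obtain ⟨P, hP, hlP⟩ := Ideal.exists_le_maximal _ hne
  rw [Ideal.span_singleton_le_iff_mem] at hlP
  obtain ⟨M, hM⟩ := Ideal.dvd_iff_le.mpr ((Ideal.span_singleton_le_iff_mem P).mpr hlP)
  by_cases hM1 : M = ⊤
  · rw [hM1, Ideal.mul_top] at hM
    exact m.inertCondition_of_isPrime hl (hM ▸ hP.isPrime)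
  · exfalso
    have h3 := congrArg Ideal.absNorm hM
    rw [hN, map_mul] at h3
    have h4 : Ideal.absNorm P ≠ 1 := by rw [Ne, Ideal.absNorm_eq_one_iff]; exact hP.ne_top
    have h5 : Ideal.absNorm M ≠ 1 := by rwa [Ne, Ideal.absNorm_eq_one_iff]
    obtain ⟨h6, -⟩ := (hl.mul_eq_prime_sq_iff h4 h5).mp h3.symm
    exact Q.not_absNorm_dvd hR hκ ht hP.ne_top hl hlP (h6 ▸ hlt)

theorem even_valuation_nrm {l : ℕ} [hl : Fact l.Prime] (hin : InertCondition m.d l) {x : K} (hx : x ≠ 0) :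
    Even (padicValRat l (m.nrm x)) := by
  rw [← conicSolvable_iff_even_of_inert m.mod_four hin (m.nrm_pos hx).ne']
  refine ⟨(m.im x : ℚ_[l]), 1, (m.re x : ℚ_[l]), Or.inr (Or.inl one_ne_zero), ?_⟩
  rw [QuadraticModel.nrm]
  push_cast
  ring

/-- The coefficient ideal of a maximal order has norm `-p / c`. -/
theorem absNorm_coeffIdeal {p : ℕ} (hp : p.Prime) (hin : InertCondition m.d p) (hB : RamifiedExactlyAt p a b)
    (hR : IsMaximalOrder R) (hκ : ∀ x : 𝓞 K, Q.κ x ∈ R) :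
    -Q.c * FractionalIdeal.absNorm (Q.coeffIdeal hR.prop hκ) = p := by
  obtain ⟨t, ht0, ht⟩ := Q.exists_absNorm_coeffIdeal hR.prop hκ
  have hI0 := Q.coeffIdeal_ne_zero hR.prop hκ
  have hc0 := Q.c_neg.ne
  have hQ := Q.ramifiedExactlyAt hB
  -- At an inert prime norms have even valuation. Evaluating `-c N(x)` at a generator `x` of the
  -- ideal near `l` shows that `t` and `c` have the same parity of valuation, and that of `c`
  -- detects ramification.
  have key : ∀ l : ℕ, [Fact l.Prime] → InertCondition m.d l →
      (Even (padicValRat l (t : ℚ)) ↔ l ≠ p) := by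
    intro l hl hin
    have h1 := conicSolvable_iff_even_of_inert (l := l) m.mod_four hin hc0
    have h2 := not_ramifiedAt_iff (F := ℚ_[l]) (a := -(m.d : ℚ)) (b := Q.c)
    rw [hQ.finite l] at h2
    push_cast at h1 h2
    rw [← Ne, h1] at h2
    rw [h2]
    obtain ⟨x, hx, N, hx0, hN, hlN⟩ := m.exists_nrm_eq_mul hI0 hl.out
    have hN0 : (N : ℚ) ≠ 0 := by
      have : N ≠ 0 := by rintro rfl; simp at hlN
      exact_mod_cast this
    have ht0' : (t : ℚ) ≠ 0 := by exact_mod_cast ht0.ne'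
    have h3 : -Q.c * m.nrm x = t * N := by rw [hN, ← ht]; ring
    have h4 := congrArg (padicValRat l) h3
    rw [padicValRat.mul (neg_ne_zero.mpr hc0) (m.nrm_pos hx0).ne', padicValRat.mul ht0' hN0,
      padicValRat.neg, padicValRat.of_nat (n := N), padicValNat.eq_zero_of_not_dvd hlN] at h4
    have h5 := even_valuation_nrm hin hx0
    have h6 : padicValRat l (t : ℚ) = padicValRat l Q.c + padicValRat l (m.nrm x) := by
      rw [h4]; simp
    rw [h6, Int.even_add]
    simp [h5]
  -- A prime divisor of `t` is inert and divides it exactly once, hence with odd valuation.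
  have hlp : ∀ l : ℕ, l.Prime → l ∣ t → l = p := by
    intro l hl hlt
    have : Fact l.Prime := ⟨hl⟩
    obtain ⟨h1, h2⟩ := Q.inertCondition_of_dvd hR hκ ht hl hlt
    by_contra hne
    have h3 := (key l h1).mpr hne
    have h4 : padicValNat l t = 1 := by
      apply le_antisymm
      · by_contra! h5
        exact h2 ((padicValNat_dvd_iff_le ht0.ne').mpr h5)
      · exact one_le_padicValNat_of_dvd ht0.ne' hlt
    rw [padicValRat.of_nat, h4] at h3
    simp at h3
  have hpt : p ∣ t := by
    have : Fact p.Prime := ⟨hp⟩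
    by_contra h
    have h1 := (key p hin).not.mpr (by simp)
    rw [padicValRat.of_nat, padicValNat.eq_zero_of_not_dvd h] at h1
    simp at h1
  obtain ⟨-, hp2⟩ := Q.inertCondition_of_dvd hR hκ ht hp hpt
  obtain ⟨k, rfl⟩ := hpt
  have hk : k = 1 := by
    by_contra hk
    obtain ⟨l, hl, hlk⟩ := Nat.exists_prime_and_dvd hk
    have h1 := hlp l hl (Dvd.dvd.mul_left hlk _)
    subst h1
    exact hp2 (by rw [sq]; exact Nat.mul_dvd_mul_left _ hlk)
  rw [ht, hk, mul_one]

end QuatModel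

end MaximalOrders

/-! ### Lattices presented by fractional ideals -/

section Presentation

open NumberField

variable {K : Type*} [Field K] [NumberField K]

/-- The lattice `M` is isomorphic to the fractional ideal `H` with the form `q Tr(x ȳ)`. -/
def IsPresented (m : QuadraticModel K) (M : IntLattice) (H : FracIdeal K) (q : ℚ) : Prop :=
  ∃ φ : M.carrier →+ K, Function.Injective φ ∧ (∀ x, x ∈ H ↔ ∃ y, φ y = x) ∧
    ∀ x y, (M.form x y : ℚ) = 2 * q * m.re (φ x * m.conj (φ y))

variable {m : QuadraticModel K} {a b : ℚ}

namespace QuatModel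

variable (Q : QuatModel m a b)

/-- The coefficient `β` of `α + βj`. -/
noncomputable def coeff : ℍ[ℚ,a,b] →ₗ[ℚ] K :=
  LinearMap.snd ℚ K K ∘ₗ (LinearEquiv.ofBijective Q.elemₗ
    ⟨fun _ _ h => Prod.ext (Q.elem_inj h).1 (Q.elem_inj h).2,
      fun x => by obtain ⟨α, β, rfl⟩ := Q.exists_eq_elem x; exact ⟨(α, β), rfl⟩⟩).symm

theorem coeff_elem (α β : K) : Q.coeff (Q.elem α β) = β := by
  have : Q.elem α β = LinearEquiv.ofBijective Q.elemₗ
    ⟨fun _ _ h => Prod.ext (Q.elem_inj h).1 (Q.elem_inj h).2,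
      fun x => by obtain ⟨α, β, rfl⟩ := Q.exists_eq_elem x; exact ⟨(α, β), rfl⟩⟩ (α, β) := rfl
  rw [coeff, LinearMap.comp_apply, this]
  simp

end QuatModel

namespace EmbeddedMaximalOrder

/-- The decomposition is built from `u = ρ(√-d)`. Agreement of the two embeddings on all of `𝓞 K`
follows after doubling, since `2x` lies in `ℤ[√-d]`. -/
theorem exists_quatModel (h : RamifiedAt ℝ a b) (P : EmbeddedMaximalOrder K a b) (m : QuadraticModel K) :
    ∃ Q : QuatModel m a b, ∀ x : 𝓞 K, Q.κ x = P.ρ x := by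
  obtain ⟨δ, hδ⟩ := m.exists_int_of_coords (x := m.ofCoords 0 1) (-1) 2 (by simp) (by simp)
  have hδ2 : δ * δ = ((-(m.d : ℤ) : ℤ) : 𝓞 K) := by
    apply RingOfIntegers.coe_injective
    rw [map_mul, map_intCast]
    change (δ : K) * δ = _
    rw [hδ]
    apply m.ext
    · rw [m.re_intCast]; simp
    · rw [m.im_intCast]; simp
  obtain ⟨Q, hQ⟩ := _root_.exists_quatModel m h (P.ρ δ) (by
    rw [← Subring.coe_mul, ← map_mul, hδ2, map_intCast, Subring.coe_intCast, map_neg, map_natCast, Int.cast_neg,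
      Int.cast_natCast])
  refine ⟨Q, fun x => ?_⟩
  obtain ⟨r, s, h1, h2⟩ := m.coords x
  have hx : 2 * x = ((2 * r + s : ℤ) : 𝓞 K) + (s : 𝓞 K) * δ := by
    apply RingOfIntegers.coe_injective
    have e2 : ((2 : 𝓞 K)) = ((2 : ℕ) : 𝓞 K) := by norm_num
    rw [e2, map_mul, map_add, map_mul, map_natCast, map_intCast, map_intCast]
    change ((2 : ℕ) : K) * (x : K) = _ + _ * (δ : K)
    rw [hδ]
    apply m.ext
    · rw [m.re_mul, m.re_add, m.re_mul, m.re_natCast, m.im_natCast, m.re_intCast, m.re_intCast, m.im_intCast, h1]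
      simp; ring
    · rw [m.im_mul, m.im_add, m.im_mul, m.re_natCast, m.im_natCast, m.re_intCast, m.im_intCast, m.im_intCast, h2]
      simp; ring
  have h3 : (2 : ℚ) • ((P.ρ x : P.R) : ℍ[ℚ,a,b]) = (2 : ℚ) • Q.κ x := by
    have h4 := congrArg (fun y => ((P.ρ y : P.R) : ℍ[ℚ,a,b])) hx
    simp only [map_mul, map_add, map_intCast, Subring.coe_mul, Subring.coe_add, Subring.coe_intCast] at h4
    rw [hQ, h1, h2, smul_add, smul_smul, show (2 : ℚ) * (s / 2) = s by ring]
    have h5 : ((P.ρ 2 : P.R) : ℍ[ℚ,a,b]) = 2 := by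
      rw [map_ofNat]; rfl
    rw [h5] at h4
    rw [Algebra.algebraMap_eq_smul_one, smul_smul, show (2 : ℚ) * (r + s / 2) = ((2 * r + s : ℤ) : ℚ) by push_cast; ring,
      Int.cast_smul_eq_zsmul, Int.cast_smul_eq_zsmul, zsmul_eq_mul, zsmul_eq_mul, mul_one, ← h4, two_smul, two_mul]
  exact (smul_right_injective _ (two_ne_zero (α := ℚ)) h3).symm

variable (P : EmbeddedMaximalOrder K a b)

/-- This is `R J J̄ ⊆ N(J) R`, from `J J̄ = (N(J))`; it is checked on generators and extended by
left multiplication. -/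
theorem exists_smul_of_mem_leftIdeal (Q : QuatModel m a b) (hQ : ∀ x : 𝓞 K, Q.κ x = P.ρ x) {J : Ideal (𝓞 K)}
    (hJ : J ≠ ⊥) {x : P.R} (hx : x ∈ P.leftIdeal J) {y : 𝓞 K} (hy : y ∈ J) :
    ∃ r ∈ P.R, (x : ℍ[ℚ,a,b]) * Q.κ (m.conj y) = (Ideal.absNorm J : ℚ) • r := by
  unfold leftIdeal at hx
  induction hx using Submodule.span_induction with
  | mem x hx =>
    obtain ⟨j, hj, rfl⟩ := hx
    obtain ⟨z, hz⟩ := m.intCast_eq_natCast_of_conjIdeal J hJ hj hy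
    refine ⟨P.ρ z, (P.ρ z).2, ?_⟩
    rw [← hQ, ← map_mul, hz, map_smul, hQ]
  | zero => exact ⟨0, P.R.zero_mem, by simp⟩
  | add x x' _ _ hx hx' =>
    obtain ⟨r, hr, h1⟩ := hx
    obtain ⟨r', hr', h2⟩ := hx'
    exact ⟨r + r', P.R.add_mem hr hr', by rw [Subring.coe_add, add_mul, h1, h2, smul_add]⟩
  | smul s x _ hx =>
    obtain ⟨r, hr, h1⟩ := hx
    exact ⟨s * r, P.R.mul_mem s.2 hr, by
      rw [smul_eq_mul, Subring.coe_mul, mul_assoc, h1, mul_smul_comm]⟩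

/-- Orthogonality to `J`, which spans `K` over `ℚ`, kills the component in `K`. If `βj ∈ R J`,
multiplying on the right by `J̄` gives `β J ⊆ N(J) I = I J̄ J`, and cancelling `J` leaves `β ∈ I
J̄`. Conversely `i ȳ j = (i j) y` lies in `R J`. -/
theorem mem_perp_iff (Q : QuatModel m a b) (hQ : ∀ x : 𝓞 K, Q.κ x = P.ρ x) (hκ : ∀ x : 𝓞 K, Q.κ x ∈ P.R)
    {J : Ideal (𝓞 K)} (hJ : J ≠ ⊥) (x : P.R) :
    x ∈ P.perp J ↔ ∃ β ∈ Q.coeffIdeal P.isOrder hκ * (m.conjIdeal J : FracIdeal K),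
      (x : ℍ[ℚ,a,b]) = Q.elem 0 β := by
  have hJF : ((J : Ideal (𝓞 K)) : FracIdeal K) ≠ 0 := by rwa [Ne, FractionalIdeal.coeIdeal_eq_zero]
  have hN : (Ideal.absNorm J : ℚ) ≠ 0 := by exact_mod_cast (Ideal.absNorm_eq_zero_iff.not.mpr hJ)
  have hNK : ((Ideal.absNorm J : ℕ) : K) ≠ 0 := by exact_mod_cast (Ideal.absNorm_eq_zero_iff.not.mpr hJ)
  constructor
  · rintro ⟨hx, hperp⟩
    obtain ⟨α, β, hαβ⟩ := Q.exists_eq_elem (x : ℍ[ℚ,a,b])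
    -- Pairing with a multiple `n α` that lies in `J` gives `2 n N(α) = 0`.
    have hα : α = 0 := by
      obtain ⟨n, hn, hnα⟩ := m.exists_nsmul_mem hJF α
      obtain ⟨y, hy, hyα⟩ := (FractionalIdeal.mem_coeIdeal _).mp hnα
      have h1 := hperp y hy
      rw [← Int.cast_inj (α := ℚ), coe_orderForm, ← hQ, Q.κ_eq, hαβ, Q.quatForm_elem] at h1
      change 2 * m.re (α * m.conj (algebraMap (𝓞 K) K y)) - _ = _ at h1
      rw [hyα, nsmul_eq_mul, map_mul, map_natCast, mul_left_comm, m.mul_conj, map_zero, mul_zero, m.re_zero,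
        m.re_mul, m.re_natCast, m.im_natCast, m.re_ratCast] at h1
      have hn' : (n : ℚ) ≠ 0 := by exact_mod_cast hn.ne'
      have : (n : ℚ) * m.nrm α = 0 := by push_cast at h1; linarith
      exact m.nrm_eq_zero.mp ((mul_eq_zero.mp this).resolve_left hn')
    subst hα
    refine ⟨β, ?_, hαβ⟩
    have key : FractionalIdeal.spanSingleton (nonZeroDivisors (𝓞 K)) β * (J : FracIdeal K) ≤
        Q.coeffIdeal P.isOrder hκ * (m.conjIdeal J : FracIdeal K) * (J : FracIdeal K) := by
      rw [mul_assoc, mul_comm (m.conjIdeal J : FracIdeal K), ← FractionalIdeal.coeIdeal_mul, (m.mul_conjIdeal J hJ).1,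
        FractionalIdeal.coeIdeal_span_singleton, map_natCast, mul_comm (Q.coeffIdeal P.isOrder hκ)]
      intro w hw
      rw [FractionalIdeal.mem_singleton_mul] at hw ⊢
      obtain ⟨y', hy', rfl⟩ := hw
      obtain ⟨y, hy, rfl⟩ := (FractionalIdeal.mem_coeIdeal _).mp hy'
      obtain ⟨r, hr, h1⟩ := P.exists_smul_of_mem_leftIdeal Q hQ hJ hx hy
      refine ⟨(Ideal.absNorm J : ℚ)⁻¹ • (β * y), ?_, ?_⟩
      · rw [Q.mem_coeffIdeal]
        have h2 : Q.elem 0 ((Ideal.absNorm J : ℚ)⁻¹ • (β * y)) = r := by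
          rw [hαβ, Q.κ_eq, Q.elem_mul] at h1
          simp only [map_zero, mul_zero, smul_zero, add_zero, zero_mul, m.conj_conj, zero_add] at h1
          have h3 := Q.elem_smul ((Ideal.absNorm J : ℚ)⁻¹) 0 (β * y)
          rw [smul_zero] at h3
          rw [← h3, h1, smul_smul, inv_mul_cancel₀ hN, one_smul]
        rw [h2]
        exact hr
      · rw [Algebra.smul_def, map_inv₀, map_natCast, mul_inv_cancel_left₀ hNK]
    have h2 : FractionalIdeal.spanSingleton (nonZeroDivisors (𝓞 K)) β ≤
        Q.coeffIdeal P.isOrder hκ * (m.conjIdeal J : FracIdeal K) := by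
      have h3 : FractionalIdeal.spanSingleton (nonZeroDivisors (𝓞 K)) β * (J : FracIdeal K) * (J : FracIdeal K)⁻¹ ≤
          Q.coeffIdeal P.isOrder hκ * (m.conjIdeal J : FracIdeal K) * (J : FracIdeal K) * (J : FracIdeal K)⁻¹ := by
        gcongr
      rwa [mul_inv_cancel_right₀ hJF, mul_inv_cancel_right₀ hJF] at h3
    exact h2 (FractionalIdeal.mem_spanSingleton_self _ β)
  · rintro ⟨β, hβ, hx⟩
    refine ⟨?_, fun y hy => ?_⟩
    · have : ∀ β ∈ Q.coeffIdeal P.isOrder hκ * (m.conjIdeal J : FracIdeal K),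
          ∃ x ∈ P.leftIdeal J, (x : ℍ[ℚ,a,b]) = Q.elem 0 β := by
        intro β hβ
        refine FractionalIdeal.mul_induction_on hβ ?_ ?_
        · intro i hi y' hy'
          obtain ⟨y, hy, rfl⟩ := (FractionalIdeal.mem_coeIdeal _).mp hy'
          rw [m.mem_conjIdeal] at hy
          refine ⟨⟨Q.elem 0 i, hi⟩ * P.ρ (m.conjO y), Ideal.mul_mem_left _ _ (Ideal.subset_span ⟨_, hy, rfl⟩), ?_⟩
          rw [Subring.coe_mul, ← hQ, Q.κ_eq, Q.elem_mul]
          simp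
        · rintro x y ⟨x', hx', h1⟩ ⟨y', hy', h2⟩
          exact ⟨x' + y', add_mem hx' hy', by rw [Subring.coe_add, h1, h2, Q.elem_add, add_zero]⟩
      obtain ⟨x', hx', h1⟩ := this β hβ
      rwa [Subtype.ext (hx.trans h1.symm)]
    · rw [← Int.cast_inj (α := ℚ), coe_orderForm, ← hQ, Q.κ_eq, hx, Q.quatForm_elem]
      simp

theorem isPresented_perpLattice (h : RamifiedAt ℝ a b) (Q : QuatModel m a b) (hQ : ∀ x : 𝓞 K, Q.κ x = P.ρ x)
    (hκ : ∀ x : 𝓞 K, Q.κ x ∈ P.R) {J : Ideal (𝓞 K)} (hJ : J ≠ ⊥) :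
    IsPresented m (P.perpLattice h J) (Q.coeffIdeal P.isOrder hκ * (m.conjIdeal J : FracIdeal K)) (-Q.c) := by
  have key : ∀ x : P.perp J, ∃ β ∈ Q.coeffIdeal P.isOrder hκ * (m.conjIdeal J : FracIdeal K),
      ((x : P.R) : ℍ[ℚ,a,b]) = Q.elem 0 β := fun x => (P.mem_perp_iff Q hQ hκ hJ x).mp x.2
  let φ : P.perp J →+ K :=
    { toFun := fun x => Q.coeff ((x : P.R) : ℍ[ℚ,a,b])
      map_zero' := by simp
      map_add' := fun x y => by simp }
  have hφ : ∀ x : P.perp J, ((x : P.R) : ℍ[ℚ,a,b]) = Q.elem 0 (φ x) := fun x => by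
    obtain ⟨β, -, hβ⟩ := key x
    change _ = Q.elem 0 (Q.coeff ((x : P.R) : ℍ[ℚ,a,b]))
    rw [hβ, Q.coeff_elem]
  have hmem : ∀ y : P.perp J, φ y ∈ Q.coeffIdeal P.isOrder hκ * (m.conjIdeal J : FracIdeal K) := fun y => by
    obtain ⟨β, hβ, h1⟩ := key y
    rw [hφ] at h1
    rwa [(Q.elem_inj h1).2]
  have hform : ∀ x y : P.perp J, ((orderForm P.R P.isOrder (x : P.R) (y : P.R) : ℤ) : ℚ) =
      2 * -Q.c * m.re (φ x * m.conj (φ y)) := fun x y => by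
    rw [coe_orderForm, hφ x, hφ y, Q.quatForm_elem]
    simp
  refine ⟨φ, fun x y hxy => ?_, fun x => ⟨fun hx => ?_, fun ⟨y, hy⟩ => hy ▸ hmem y⟩, hform⟩
  · apply Subtype.ext
    apply Subtype.ext
    rw [hφ x, hφ y]
    exact congrArg _ hxy
  · have h0 : Q.elem 0 x ∈ P.R := by
      have hle : Q.coeffIdeal P.isOrder hκ * (m.conjIdeal J : FracIdeal K) ≤ Q.coeffIdeal P.isOrder hκ := by
        calc _ ≤ Q.coeffIdeal P.isOrder hκ * 1 := by gcongr; exact FractionalIdeal.coeIdeal_le_one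
          _ = _ := mul_one _
      exact hle hx
    have h1 := (P.mem_perp_iff Q hQ hκ hJ ⟨Q.elem 0 x, h0⟩).mpr ⟨x, hx, rfl⟩
    exact ⟨⟨_, h1⟩, Q.coeff_elem 0 x⟩


end EmbeddedMaximalOrder

end Presentation

/-! ### Invariants of presented lattices -/

section PresentedLattices

open NumberField

variable {K : Type*} [Field K] [NumberField K] {m : QuadraticModel K}

namespace QuadraticModel

theorem finrank_eq_two (m : QuadraticModel K) : Module.finrank ℚ K = 2 := by
  rw [m.e.toLinearEquiv.finrank_eq, QuadraticAlgebra.finrank_eq_two]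

theorem exists_integral_basis (m : QuadraticModel K) : ∃ b : Module.Basis (Fin 2) ℤ (𝓞 K),
    b 0 = 1 ∧ (b 1 : K) = m.ofCoords (1 / 2) (1 / 2) := by
  obtain ⟨ω, hω⟩ := m.exists_int_of_coords (x := m.ofCoords (1 / 2) (1 / 2)) 0 1 (by simp) (by simp)
  have hco : ∀ r s : ℤ, ((r • (1 : 𝓞 K) + s • ω : 𝓞 K) : K) = m.ofCoords (r + s / 2) (s / 2) := fun r s => by
    have : ((r • (1 : 𝓞 K) + s • ω : 𝓞 K) : K) = r + s * (ω : K) := by simp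
    rw [this, hω]
    apply m.ext <;> simp <;> ring
  have hli : LinearIndependent ℤ ![(1 : 𝓞 K), ω] := by
    rw [LinearIndependent.pair_iff]
    intro r s h
    have h1 := hco r s
    rw [h, show ((0 : 𝓞 K) : K) = 0 from map_zero _] at h1
    have h2 := congrArg m.re h1
    have h3 := congrArg m.im h1
    rw [m.re_ofCoords, m.re_zero] at h2
    rw [m.im_ofCoords, m.im_zero] at h3
    have h4 : (s : ℚ) = 0 := by linarith
    have h5 : (r : ℚ) = 0 := by linarith
    exact ⟨by exact_mod_cast h5, by exact_mod_cast h4⟩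
  have hsp : ⊤ ≤ Submodule.span ℤ (Set.range ![(1 : 𝓞 K), ω]) := by
    rintro x -
    rw [Matrix.range_cons, Matrix.range_cons, Matrix.range_empty, Set.union_empty,
      Set.singleton_union, Submodule.mem_span_pair]
    obtain ⟨r, s, h1, h2⟩ := m.coords x
    refine ⟨r, s, RingOfIntegers.coe_injective ?_⟩
    change ((r • (1 : 𝓞 K) + s • ω : 𝓞 K) : K) = (x : K)
    rw [hco]
    exact m.ext (by simp [h1]) (by simp [h2])
  exact ⟨Module.Basis.mk hli hsp, by simp, by simpa using hω⟩

/-- The ideal norm is a covolume. The factor 2 normalises it to 1 on the integral basis `1, (1 +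
√-d)/2`. -/
theorem absNorm_eq_of_basis (m : QuadraticModel K) (I : FracIdeal K) (b : Module.Basis (Fin 2) ℤ I) :
    FractionalIdeal.absNorm I = |2 * (m.re (b 0) * m.im (b 1) - m.im (b 0) * m.re (b 1))| := by
  obtain ⟨c, hc0, hc1⟩ := m.exists_integral_basis
  have h := FractionalIdeal.abs_det_basis_change (K := K) c I b
  rw [← h]
  set B := c.localizationLocalization ℚ (nonZeroDivisors ℤ) K with hB
  have hB0 : B 0 = 1 := by rw [hB, Module.Basis.localizationLocalization_apply, hc0, map_one]
  have hB1 : B 1 = m.ofCoords (1 / 2) (1 / 2) := by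
    rw [hB, Module.Basis.localizationLocalization_apply]; exact hc1
  have key : ∀ x : K, m.re x = B.repr x 0 + B.repr x 1 / 2 ∧ m.im x = B.repr x 1 / 2 := fun x => by
    have h1 := B.sum_repr x
    rw [Fin.sum_univ_two, hB0, hB1] at h1
    have h2 := congrArg m.re h1
    have h3 := congrArg m.im h1
    simp at h2 h3
    exact ⟨by rw [← h2]; ring, by rw [← h3]; ring⟩
  rw [Module.Basis.det_apply, Matrix.det_fin_two]
  simp only [Module.Basis.toMatrix_apply, Function.comp_apply]
  obtain ⟨e1, e2⟩ := key (b 0)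
  obtain ⟨e3, e4⟩ := key (b 1)
  rw [e1, e2, e3, e4]
  congr 1
  ring

end QuadraticModel

namespace IsPresented

variable {M N : IntLattice} {H : FracIdeal K} {q : ℚ}

theorem exists_equiv (h : IsPresented m M H q) : ∃ e : M.carrier ≃ₗ[ℤ] H,
    ∀ x y, (M.form x y : ℚ) = 2 * q * m.re ((e x : K) * m.conj (e y)) := by
  obtain ⟨φ, hφ, hH, hf⟩ := h
  let ψ : M.carrier →ₗ[ℤ] H :=
    { toFun := fun x => ⟨φ x, (hH _).mpr ⟨x, rfl⟩⟩
      map_add' := fun x y => Subtype.ext (map_add φ x y)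
      map_smul' := fun t x => Subtype.ext (map_zsmul φ t x) }
  refine ⟨LinearEquiv.ofBijective ψ ⟨fun x y hxy => hφ (congrArg Subtype.val hxy), fun y => ?_⟩, hf⟩
  obtain ⟨x, hx⟩ := (hH y).mp y.2
  exact ⟨x, Subtype.ext hx⟩

theorem rank_eq (h : IsPresented m M H q) (hH : H ≠ 0) : M.rank = 2 := by
  obtain ⟨e, -⟩ := h.exists_equiv
  rw [IntLattice.rank, e.finrank_eq]
  have := NumberField.fractionalIdeal_rank K (Units.mk0 H hH)
  rw [RingOfIntegers.rank, m.finrank_eq_two] at this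
  exact this

theorem exists_basis (h : IsPresented m M H q) (hH : H ≠ 0) : Nonempty (Module.Basis (Fin 2) ℤ M.carrier) :=
  ⟨Module.finBasisOfFinrankEq ℤ M.carrier (h.rank_eq hH)⟩

/-- The Gram determinant is `(2q)² d` times the square of the coordinate determinant of the basis,
which is half the ideal norm up to sign. -/
theorem disc_eq (h : IsPresented m M H q) (hH : H ≠ 0) :
    (M.disc : ℚ) = (q * FractionalIdeal.absNorm H) ^ 2 * m.d := by
  obtain ⟨e, he⟩ := h.exists_equiv
  obtain ⟨b⟩ := h.exists_basis hH
  rw [M.disc_eq b, Matrix.det_fin_two]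
  simp only [LinearMap.BilinForm.toMatrix_apply]
  push_cast
  rw [he, he, he, he, m.absNorm_eq_of_basis H (b.map e), mul_pow, sq_abs]
  simp only [Module.Basis.map_apply, m.re_mul, m.re_conj, m.im_conj]
  ring

theorem isPosDef (h : IsPresented m M H q) (hq : 0 < q) : M.IsPosDef := by
  obtain ⟨e, he⟩ := h.exists_equiv
  intro x hx
  have hx' : (e x : K) ≠ 0 := fun h0 => hx (by
    have : e x = 0 := Subtype.ext h0
    simpa using this)
  have h1 := he x x
  rw [m.mul_conj, m.re_ratCast] at h1
  have h2 := m.nrm_pos hx'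
  have : (0 : ℚ) < M.form x x := by rw [h1]; positivity
  exact_mod_cast this

/-- For `x, y ∈ H` the product `x ȳ` is `N(H)` times an integer of `K`. Such divisibilities are
local, so every lattice of the genus inherits them. -/
theorem form_self_dvd (h : IsPresented m M H q) (hH : H ≠ 0) {k : ℤ}
    (hk : q * FractionalIdeal.absNorm H = k) (x : M.carrier) : 2 * k ∣ M.form x x := by
  obtain ⟨e, he⟩ := h.exists_equiv
  have h1 := he x x
  obtain ⟨t, ht⟩ := m.nrm_mem hH (e x).2
  rw [m.mul_conj, m.re_ratCast, ht] at h1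
  refine ⟨t, ?_⟩
  have : (M.form x x : ℚ) = 2 * k * t := by rw [h1, ← hk]; ring
  exact_mod_cast this

theorem form_dvd (h : IsPresented m M H q) (hH : H ≠ 0) {k : ℤ}
    (hk : q * FractionalIdeal.absNorm H = k) (x y : M.carrier) : k ∣ M.form x y := by
  obtain ⟨e, he⟩ := h.exists_equiv
  have h1 := he x y
  obtain ⟨z, hz⟩ := m.mul_conj_mem hH (e x).2 (e y).2
  obtain ⟨r, s, h2, -⟩ := m.coords z
  rw [hz, m.re_smul, h2] at h1
  refine ⟨2 * r + s, ?_⟩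
  have : (M.form x y : ℚ) = k * (2 * r + s) := by rw [h1, ← hk]; ring
  exact_mod_cast this

theorem isEven (h : IsPresented m M H q) (hH : H ≠ 0) {k : ℤ}
    (hk : q * FractionalIdeal.absNorm H = k) : M.IsEven := fun x =>
  even_iff_two_dvd.mpr ((Dvd.intro _ rfl).trans (h.form_self_dvd hH hk x))

theorem iso (h : IsPresented m M H q) (h' : IsPresented m N H q) : M.Iso N := by
  obtain ⟨e, he⟩ := h.exists_equiv
  obtain ⟨f, hf⟩ := h'.exists_equiv
  refine ⟨e.trans f.symm, fun x y => ?_⟩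
  have : (N.form (e.trans f.symm x) (e.trans f.symm y) : ℚ) = M.form x y := by
    rw [hf, he]; simp
  exact_mod_cast this

/-- Multiplication by `μ` leaves the product of `q` and the norm of the ideal unchanged. It brings
lattices from decompositions with different `c` to a common `q`. -/
theorem rescale (h : IsPresented m M H q) {μ : K} (hμ : μ ≠ 0) :
    IsPresented m M (FractionalIdeal.spanSingleton (nonZeroDivisors (𝓞 K)) μ * H) (q / m.nrm μ) := by
  obtain ⟨φ, hφ, hH, hf⟩ := h
  have hn := (m.nrm_pos hμ).ne'
  refine ⟨(AddMonoidHom.mulLeft μ).comp φ, fun x y hxy => hφ (mul_left_cancel₀ hμ hxy), fun x => ?_, fun x y => ?_⟩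
  · rw [FractionalIdeal.mem_singleton_mul]
    constructor
    · rintro ⟨y, hy, rfl⟩
      obtain ⟨z, rfl⟩ := (hH y).mp hy
      exact ⟨z, rfl⟩
    · rintro ⟨y, rfl⟩
      exact ⟨φ y, (hH _).mpr ⟨y, rfl⟩, rfl⟩
  · rw [hf]
    have : ((AddMonoidHom.mulLeft μ).comp φ) x * m.conj (((AddMonoidHom.mulLeft μ).comp φ) y) =
        m.nrm μ • (φ x * m.conj (φ y)) := by
      rw [Algebra.smul_def, eq_ratCast, ← m.mul_conj]
      simp only [AddMonoidHom.comp_apply, AddMonoidHom.coe_mulLeft, map_mul]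
      ring
    rw [this, m.re_smul]
    field_simp

end IsPresented

end PresentedLattices

/-! ### Isomorphism over a ring extension -/

section IsoOver

/-- The isometry over `A` is `f / n`, with inverse `g / n`. Multiplication by an element of norm one
is thus handled by integral maps once its denominator is cleared. -/
theorem IntLattice.IsoOver.of_isUnit {A : Type} [CommRing A] {M N : IntLattice} (f : M.carrier →ₗ[ℤ] N.carrier)
    (g : N.carrier →ₗ[ℤ] M.carrier) (n : ℤ) (hn : IsUnit (n : A)) (hfg : ∀ x, f (g x) = (n * n) • x)
    (hgf : ∀ x, g (f x) = (n * n) • x) (hf : ∀ x y, N.form (f x) (f y) = n * n * M.form x y) :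
    IntLattice.IsoOver A M N := by
  obtain ⟨u, hu⟩ := hn
  have hinv : (↑u⁻¹ : A) * (n : A) = 1 := by rw [← hu]; simp
  have hcast : ∀ (L : IntLattice) (z : A ⊗[ℤ] L.carrier), ((n * n : ℤ) : A) • z = (n * n) • z := fun L z => by
    rw [Int.cast_smul_eq_zsmul]
  have hcomp : ∀ (L L' : IntLattice) (f : L.carrier →ₗ[ℤ] L'.carrier) (g : L'.carrier →ₗ[ℤ] L.carrier),
      (∀ x, f (g x) = (n * n) • x) →
      ((↑u⁻¹ : A) • f.baseChange A) ∘ₗ ((↑u⁻¹ : A) • g.baseChange A) = LinearMap.id := by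
    intro L L' f g h
    ext x
    simp only [LinearMap.comp_apply, LinearMap.smul_apply, LinearMap.baseChange_tmul, map_smul,
      TensorProduct.AlgebraTensorModule.curry_apply, TensorProduct.curry_apply,
      LinearMap.id_apply, LinearMap.coe_restrictScalars, h]
    rw [TensorProduct.tmul_smul, ← hcast, smul_smul, smul_smul]
    have : (↑u⁻¹ : A) * (↑u⁻¹ * ((n * n : ℤ) : A)) = 1 := by
      push_cast
      linear_combination ((↑u⁻¹ : A) * (n : A) + 1) * hinv
    rw [mul_assoc, this, one_smul]
  refine ⟨LinearEquiv.ofLinearMap ((↑u⁻¹ : A) • f.baseChange A) ((↑u⁻¹ : A) • g.baseChange A)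
    (hcomp _ _ f g hfg) (hcomp _ _ g f hgf), fun x y => ?_⟩
  simp only [LinearEquiv.coe_ofLinearMap, LinearMap.smul_apply, map_smul, smul_eq_mul]
  induction x using TensorProduct.induction_on with
  | zero => simp
  | add x x' hx hx' => simp only [map_add, LinearMap.add_apply, mul_add, hx, hx']
  | tmul s x =>
    induction y using TensorProduct.induction_on with
    | zero => simp
    | add y y' hy hy' => simp only [map_add, mul_add, hy, hy']
    | tmul t y =>
      rw [LinearMap.baseChange_tmul, LinearMap.baseChange_tmul, LinearMap.BilinForm.baseChange_tmul,
        LinearMap.BilinForm.baseChange_tmul, hf, ← Int.cast_smul_eq_zsmul A, ← Int.cast_smul_eq_zsmul A]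
      simp only [smul_eq_mul]
      push_cast
      linear_combination ((M.form x y : ℤ) : A) * (s * t) * ((↑u⁻¹ : A) * (n : A) + 1) * hinv

theorem PadicInt.isUnit_natCast_of_not_dvd {l : ℕ} [hl : Fact l.Prime] {n : ℕ} (h : ¬ l ∣ n) :
    IsUnit (((n : ℤ) : ℤ_[l])) := by
  rw [PadicInt.isUnit_iff]
  by_contra h1
  have h2 := lt_of_le_of_ne (PadicInt.norm_le_one _) h1
  rw [PadicInt.norm_int_lt_one_iff_dvd] at h2
  exact h (by exact_mod_cast h2)

end IsoOver

/-! ### Ideals of equal norm lie in the same genus -/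

section Genus

open NumberField

variable {K : Type*} [Field K] [NumberField K] {m : QuadraticModel K}

/-- Multiplication by the norm-one element `y` preserves the form `q Tr(x x̄')`, and near `l` it
carries one ideal onto the other. -/
theorem IsPresented.sameGenus {M N : IntLattice} {H H' : FracIdeal K} {q : ℚ} (h : IsPresented m M H q)
    (h' : IsPresented m N H' q) (hH : H ≠ 0) (hH' : H' ≠ 0)
    (hN : FractionalIdeal.absNorm H = FractionalIdeal.absNorm H') : IntLattice.SameGenus M N := by
  obtain ⟨e, he⟩ := h.exists_equiv
  obtain ⟨f, hf⟩ := h'.exists_equiv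
  have key : ∀ l : ℕ, l.Prime → ∃ n : ℕ, ¬ l ∣ n ∧ ∀ (A : Type) [CommRing A], IsUnit ((n : ℤ) : A) →
      IntLattice.IsoOver A M N := by
    intro l hl
    obtain ⟨y, n, hy, hn, h1, h2⟩ := m.exists_nrm_one_mul_mem hH hH' hN hl
    have hy0 : y ≠ 0 := by rintro rfl; simp [QuadraticModel.nrm] at hy
    let φ : H →ₗ[ℤ] H' :=
      { toFun := fun x => ⟨n • (y * x), h1 x x.2⟩
        map_add' := fun x x' => Subtype.ext (by
          change n • (y * ((x : K) + x')) = n • (y * (x : K)) + n • (y * (x' : K))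
          rw [mul_add, smul_add])
        map_smul' := fun t x => Subtype.ext (by
          change n • (y * (t • (x : K))) = t • n • (y * (x : K))
          rw [mul_smul_comm, smul_comm]) }
    let ψ : H' →ₗ[ℤ] H :=
      { toFun := fun x => ⟨n • (y⁻¹ * x), h2 x x.2⟩
        map_add' := fun x x' => Subtype.ext (by
          change n • (y⁻¹ * ((x : K) + x')) = n • (y⁻¹ * (x : K)) + n • (y⁻¹ * (x' : K))
          rw [mul_add, smul_add])
        map_smul' := fun t x => Subtype.ext (by
          change n • (y⁻¹ * (t • (x : K))) = t • n • (y⁻¹ * (x : K))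
          rw [mul_smul_comm, smul_comm]) }
    have hφψ : ∀ x, φ (ψ x) = ((n : ℤ) * n) • x := fun x => Subtype.ext (by
      change n • (y * (n • (y⁻¹ * (x : K)))) = ((n : ℤ) * n) • (x : K)
      rw [mul_smul_comm, mul_inv_cancel_left₀ hy0, smul_smul, ← natCast_zsmul, Nat.cast_mul])
    have hψφ : ∀ x, ψ (φ x) = ((n : ℤ) * n) • x := fun x => Subtype.ext (by
      change n • (y⁻¹ * (n • (y * (x : K)))) = ((n : ℤ) * n) • (x : K)
      rw [mul_smul_comm, inv_mul_cancel_left₀ hy0, smul_smul, ← natCast_zsmul, Nat.cast_mul])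
    refine ⟨n, hn, fun A _ hu => IntLattice.IsoOver.of_isUnit (f.symm.toLinearMap ∘ₗ φ ∘ₗ e.toLinearMap)
      (e.symm.toLinearMap ∘ₗ ψ ∘ₗ f.toLinearMap) n hu (fun x => ?_) (fun x => ?_) (fun x x' => ?_)⟩
    · simp [hφψ]
    · simp [hψφ]
    · have hx : ∀ x, ((f (f.symm (φ (e x))) : H') : K) = ((n : ℚ) : K) * (y * (e x : K)) := fun x => by
        rw [f.apply_symm_apply]
        change n • (y * (e x : K)) = _
        rw [nsmul_eq_mul, Rat.cast_natCast]
      have : (N.form (f.symm (φ (e x))) (f.symm (φ (e x'))) : ℚ) = n * n * M.form x x' := by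
        rw [hf, hx, hx, he]
        have : ((n : ℚ) : K) * (y * (e x : K)) * m.conj (((n : ℚ) : K) * (y * (e x' : K))) =
            ((n * n : ℚ) : K) * ((e x : K) * m.conj (e x')) := by
          have h3 := m.mul_conj y
          rw [hy, Rat.cast_one] at h3
          rw [map_mul, map_mul, map_ratCast]
          push_cast
          linear_combination (n : K) * n * (e x : K) * m.conj (e x') * h3
        rw [this, m.re_mul, m.re_ratCast, m.im_ratCast]
        ring
      exact_mod_cast this
  constructor
  · intro l hl
    obtain ⟨n, hn, h1⟩ := key l hl.out
    exact h1 ℤ_[l] (PadicInt.isUnit_natCast_of_not_dvd hn)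
  -- Over `ℝ` every nonzero `n` is a unit, so the maps found for any one prime serve.
  · obtain ⟨n, hn, h1⟩ := key 2 Nat.prime_two
    refine h1 ℝ (isUnit_iff_ne_zero.mpr ?_)
    have : n ≠ 0 := by rintro rfl; simp at hn
    exact_mod_cast this

end Genus

/-! ### Lattices in the genus of a presented lattice -/

section GenusConverse

open NumberField

theorem IntLattice.form_eq_of_basis (M : IntLattice) (b : Module.Basis (Fin 2) ℤ M.carrier) (x y : M.carrier) :
    M.form x y = b.repr x 0 * b.repr y 0 * M.form (b 0) (b 0) +
      (b.repr x 0 * b.repr y 1 + b.repr x 1 * b.repr y 0) * M.form (b 0) (b 1) +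
      b.repr x 1 * b.repr y 1 * M.form (b 1) (b 1) := by
  have hx := b.sum_repr x
  have hy := b.sum_repr y
  rw [Fin.sum_univ_two] at hx hy
  conv_lhs => rw [← hx, ← hy]
  simp only [map_add, map_smul, LinearMap.add_apply, LinearMap.smul_apply, smul_eq_mul]
  rw [M.symm (b 1) (b 0)]
  ring

theorem IntLattice.IsoOver.rank_eq {A : Type} [CommRing A] [Nontrivial A] {M N : IntLattice}
    (h : IntLattice.IsoOver A M N) : N.rank = M.rank := by
  obtain ⟨e, -⟩ := h
  have := e.finrank_eq
  rw [Module.finrank_baseChange, Module.finrank_baseChange] at this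
  exact this.symm

theorem IntLattice.IsoOver.exists_matrix {A : Type} [CommRing A] {M N : IntLattice}
    (h : IntLattice.IsoOver A M N) (b : Module.Basis (Fin 2) ℤ M.carrier) (c : Module.Basis (Fin 2) ℤ N.carrier) :
    ∃ T : Matrix (Fin 2) (Fin 2) A, IsUnit T.det ∧ ∀ i j, ((N.form (c i) (c j) : ℤ) : A) =
      T 0 i * T 0 j * (M.form (b 0) (b 0) : ℤ) + (T 0 i * T 1 j + T 1 i * T 0 j) * (M.form (b 0) (b 1) : ℤ) +
        T 1 i * T 1 j * (M.form (b 1) (b 1) : ℤ) := by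
  obtain ⟨e, he⟩ := h
  refine ⟨LinearMap.toMatrix (c.baseChange A) (b.baseChange A) e.symm, ?_, fun i j => ?_⟩
  · exact LinearEquiv.isUnit_det e.symm (c.baseChange A) (b.baseChange A)
  · have h1 := LinearMap.BilinForm.toMatrix_comp (b.baseChange A) (c.baseChange A)
      (LinearMap.BilinForm.baseChange A M.form) e.symm.toLinearMap e.symm.toLinearMap
    have h2 := congrFun (congrFun h1 i) j
    rw [LinearMap.BilinForm.toMatrix_apply, LinearMap.BilinForm.comp_apply] at h2
    simp only [LinearEquiv.coe_coe] at h2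
    rw [← he, e.apply_symm_apply, e.apply_symm_apply, Module.Basis.baseChange_apply, Module.Basis.baseChange_apply,
      LinearMap.BilinForm.baseChange_tmul, Matrix.mul_apply] at h2
    simp only [Matrix.mul_apply, Fin.sum_univ_two, Matrix.transpose_apply, LinearMap.BilinForm.toMatrix_apply,
      Module.Basis.baseChange_apply, LinearMap.BilinForm.baseChange_tmul, mul_one, zsmul_eq_mul,
      M.symm (b 1) (b 0)] at h2
    rw [h2]
    ring

theorem Int.dvd_of_forall_padicInt_dvd {a b : ℤ} (h : ∀ (l : ℕ) [Fact l.Prime], (a : ℤ_[l]) ∣ (b : ℤ_[l])) :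
    a ∣ b := by
  rw [← Int.natAbs_dvd_natAbs, Nat.dvd_iff_prime_pow_dvd_dvd]
  intro l k hl hlk
  have : Fact l.Prime := ⟨hl⟩
  rw [← Int.natCast_dvd_natCast, Int.dvd_natAbs] at hlk ⊢
  push_cast at hlk ⊢
  rw [← PadicInt.pow_p_dvd_int_iff] at hlk ⊢
  exact hlk.trans (h l)

variable {K : Type*} [Field K] [NumberField K] {m : QuadraticModel K}

/-- A rational point of `z² = -d x² + r y²` has `y ≠ 0` because `z² + d x²` is definite; dividing by
`y²` exhibits `r` as a norm. -/
theorem QuadraticModel.exists_nrm_eq (m : QuadraticModel K) {r : ℚ} (hr : 0 < r)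
    (h : ∀ (l : ℕ) [Fact l.Prime], l ≠ 2 → tameSymbol l ((-(m.d : ℚ) : ℚ) : ℚ_[l]) (r : ℚ_[l]) = 1) :
    ∃ x : K, x ≠ 0 ∧ m.nrm x = r := by
  have hd := m.d_pos_rat
  obtain ⟨x, y, z, hne, heq⟩ := legendre (neg_ne_zero.mpr hd.ne') hr.ne' (Or.inr hr) h

  have hy : y ≠ 0 := by
    rintro rfl
    have h1 : z ^ 2 + m.d * x ^ 2 = 0 := by linarith
    have h2 := mul_nonneg hd.le (sq_nonneg x)
    have h3 : z ^ 2 = 0 := by nlinarith [sq_nonneg z]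
    have h4 : (m.d : ℚ) * x ^ 2 = 0 := by linarith
    rcases hne with h | h | h
    · exact h (by simpa [hd.ne'] using h4)
    · exact h rfl
    · exact h (by simpa using h3)
  have hn : m.nrm (m.ofCoords (z / y) (x / y)) = r := by
    simp only [QuadraticModel.nrm, m.re_ofCoords, m.im_ofCoords]
    field_simp
    linarith
  refine ⟨_, ?_, hn⟩
  intro h0
  rw [h0, m.nrm_eq_zero.mpr rfl] at hn
  exact hr.ne hn

/-- Gauss's correspondence between forms and ideals: the basis is sent to `μ` and `μ τ` with `τ = (B
+ √-d)/(2A)`, a root of `A X² - B X + C`. The image is stable under the integers of `K` because `4AC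
- B² = d`, and `μ` fixes the scale. -/
theorem exists_isPresented_of_gram {N : IntLattice} (b : Module.Basis (Fin 2) ℤ N.carrier) {q : ℚ}
    {k A B C : ℤ} (hA : 0 < A) (h00 : N.form (b 0) (b 0) = 2 * k * A) (h01 : N.form (b 0) (b 1) = k * B)
    (h11 : N.form (b 1) (b 1) = 2 * k * C) (hABC : 4 * A * C - B ^ 2 = m.d) {μ : K} (hμ : μ ≠ 0)
    (hμn : q * m.nrm μ = k * A) : ∃ Λ : FracIdeal K, Λ ≠ 0 ∧ IsPresented m N Λ q := by
  have hA' : (A : ℚ) ≠ 0 := by exact_mod_cast hA.ne'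
  have hABCq : 4 * (A : ℚ) * C - B ^ 2 = m.d := by exact_mod_cast hABC
  set τ : K := m.ofCoords (B / (2 * A)) (1 / (2 * A)) with hτ
  let φ : N.carrier →+ K :=
    { toFun := fun x => μ * ((b.repr x 0 : ℤ) + (b.repr x 1 : ℤ) * τ)
      map_zero' := by simp
      map_add' := fun x y => by simp; ring }
  have hφ : ∀ x, φ x = μ * ((b.repr x 0 : ℤ) + (b.repr x 1 : ℤ) * τ) := fun x => rfl
  have hinj : Function.Injective φ := by
    rw [injective_iff_map_eq_zero]
    intro x hx
    rw [hφ] at hx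
    have h1 := (mul_eq_zero.mp hx).resolve_left hμ
    have h2 := congrArg m.re h1
    have h3 := congrArg m.im h1
    simp [hτ, hA'] at h2 h3
    rw [h3] at h2
    simp at h2
    apply b.repr.injective
    ext i
    fin_cases i
    · simpa using h2
    · simpa using h3
  obtain ⟨B', hB'⟩ : ∃ B', B = 2 * B' + 1 := by
    have hd4 := m.mod_four
    have h1 : B % 2 = 1 := by
      by_contra h
      obtain ⟨e, rfl⟩ : ∃ e, B = 2 * e := ⟨B / 2, by omega⟩
      have : 4 * (A * C - e ^ 2) = m.d := by rw [← hABC]; ring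
      omega
    exact ⟨B / 2, by omega⟩
  have hB'q : (B : ℚ) = 2 * B' + 1 := by exact_mod_cast hB'
  let L : Submodule (𝓞 K) K :=
    { carrier := {x | ∃ y, φ y = x}
      add_mem' := by
        rintro _ _ ⟨x, rfl⟩ ⟨y, rfl⟩
        exact ⟨x + y, map_add φ x y⟩
      zero_mem' := ⟨0, map_zero φ⟩
      smul_mem' := by
        rintro z _ ⟨x, rfl⟩
        obtain ⟨r, s, h1, h2⟩ := m.coords z
        set u := b.repr x 0 with hu
        set v := b.repr x 1 with hv
        -- With `B = 2B' + 1`, the generator `ω = (1 + √-d)/2` acts by `ω = A τ - B'` and `ω τ = (B'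
        -- + 1) τ - C`.
        refine ⟨(r * u + s * (-B' * u - C * v)) • b 0 + (r * v + s * (A * u + (B' + 1) * v)) • b 1, ?_⟩
        rw [hφ, hφ, ← hu, ← hv, Algebra.smul_def, mul_left_comm]
        congr 1
        change _ = (z : K) * _
        simp only [map_add, map_smul, Module.Basis.repr_self, Finsupp.add_apply, Finsupp.smul_apply,
          Finsupp.single_apply, smul_eq_mul]
        apply m.ext
        · simp [hτ, h1, h2]
          rw [← hABCq, hB'q]
          field_simp
          ring
        · simp [hτ, h1, h2]
          rw [hB'q]
          field_simp
          ring }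
  have hfin : Module.Finite ℤ (L.restrictScalars ℤ) := by
    let ψ : N.carrier →ₗ[ℤ] L.restrictScalars ℤ :=
      { toFun := fun x => ⟨φ x, x, rfl⟩
        map_add' := fun x y => Subtype.ext (map_add φ x y)
        map_smul' := fun t x => Subtype.ext (map_zsmul φ t x) }
    apply Module.Finite.of_surjective ψ
    rintro ⟨_, x, rfl⟩
    exact ⟨x, rfl⟩
  let Λ : FracIdeal K := ⟨L, FractionalIdeal.isFractional_of_fg
    (Submodule.FG.of_restrictScalars ℤ (Module.Finite.iff_fg.mp hfin))⟩
  refine ⟨Λ, ?_, φ, hinj, fun x => Iff.rfl, fun x y => ?_⟩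
  · intro h0
    have h1 : φ (b 0) ∈ Λ := ⟨b 0, rfl⟩
    rw [h0, FractionalIdeal.mem_zero_iff] at h1
    exact b.ne_zero 0 (hinj (by rw [h1, map_zero]))
  · rw [N.form_eq_of_basis b, h00, h01, h11, hφ, hφ]
    generalize b.repr x 0 = x₀
    generalize b.repr x 1 = x₁
    generalize b.repr y 0 = y₀
    generalize b.repr y 1 = y₁
    have h1 : μ * ((x₀ : K) + x₁ * τ) * m.conj (μ * (y₀ + y₁ * τ)) =
        m.nrm μ • (((x₀ : K) + x₁ * τ) * m.conj (y₀ + y₁ * τ)) := by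
      rw [Algebra.smul_def, eq_ratCast, ← m.mul_conj, map_mul]
      ring
    rw [h1, m.re_smul]
    simp only [hτ, m.re_mul, m.re_add, m.im_add, m.im_mul, m.re_conj, m.im_conj, m.re_intCast, m.im_intCast,
      m.re_ofCoords, m.im_ofCoords]
    push_cast
    rw [← hABCq]
    have h2 : 2 * q * (m.nrm μ) = 2 * (k * A) := by linarith
    rw [← mul_assoc (2 * q), h2]
    field_simp
    ring

/-- Discriminant and divisibility of the entries are local, so the Gram matrix of `N` has entries
`2kA, kB, 2kC` with `4AC - B² = d`, and positivity comes from `ℝ`. To realise it with the given `q`,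
the scale `kA / q` must be a norm. It is one locally, since the value is represented by `M` there,
and Legendre's theorem makes it one globally. -/
theorem IsPresented.of_sameGenus {M N : IntLattice} {H : FracIdeal K} {q : ℚ} (h : IsPresented m M H q)
    (hH : H ≠ 0) (hq : 0 < q) {k : ℤ} (hk : q * FractionalIdeal.absNorm H = k)
    (hG : IntLattice.SameGenus M N) : ∃ Λ : FracIdeal K, Λ ≠ 0 ∧ IsPresented m N Λ q ∧
      FractionalIdeal.absNorm Λ = FractionalIdeal.absNorm H := by
  obtain ⟨b⟩ := h.exists_basis hH
  have hNrank : N.rank = 2 := by rw [hG.2.rank_eq, h.rank_eq hH]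
  let c : Module.Basis (Fin 2) ℤ N.carrier := Module.finBasisOfFinrankEq ℤ N.carrier hNrank
  have hk0 : 0 < k := by
    have : (0 : ℚ) < k := by rw [← hk]; exact mul_pos hq (QuadraticModel.absNorm_pos hH)
    exact_mod_cast this
  have hdM : M.disc = M.form (b 0) (b 0) * M.form (b 1) (b 1) - M.form (b 0) (b 1) ^ 2 := by
    rw [M.disc_eq b, Matrix.det_fin_two]
    simp only [LinearMap.BilinForm.toMatrix_apply, M.symm (b 1) (b 0)]
    ring
  have hdN : N.disc = N.form (c 0) (c 0) * N.form (c 1) (c 1) - N.form (c 0) (c 1) ^ 2 := by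
    rw [N.disc_eq c, Matrix.det_fin_two]
    simp only [LinearMap.BilinForm.toMatrix_apply, N.symm (c 1) (c 0)]
    ring
  have hMd : M.disc = k ^ 2 * m.d := by
    have := h.disc_eq hH
    rw [hk] at this
    exact_mod_cast this
  have hMd0 : 0 < M.disc := by
    rw [hMd]
    have := m.d_pos
    positivity
  have hdet : ∀ (A : Type) [CommRing A], IntLattice.IsoOver A M N → ∃ u : A, IsUnit u ∧ (N.disc : A) = u ^ 2 * M.disc := by
    intro A _ hA
    obtain ⟨T, hT, hTe⟩ := hA.exists_matrix b c
    refine ⟨T.det, hT, ?_⟩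
    rw [hdM, hdN, Matrix.det_fin_two]
    push_cast
    rw [hTe, hTe, hTe]
    ring
  have hdisc : N.disc = M.disc := by
    have h1 : M.disc ∣ N.disc := Int.dvd_of_forall_padicInt_dvd fun l _ => by
      obtain ⟨u, -, hu⟩ := hdet ℤ_[l] (hG.1 l)
      exact ⟨u ^ 2, by rw [hu, mul_comm]⟩
    have h2 : N.disc ∣ M.disc := Int.dvd_of_forall_padicInt_dvd fun l _ => by
      obtain ⟨u, hu, he⟩ := hdet ℤ_[l] (hG.1 l)
      obtain ⟨v, hv⟩ := (hu.pow 2).exists_left_inv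
      exact ⟨v, by rw [he]; linear_combination -(M.disc : ℤ_[l]) * hv⟩
    have h3 : 0 < N.disc := by
      obtain ⟨u, hu, he⟩ := hdet ℝ hG.2
      have h4 : (0 : ℝ) < N.disc := by
        rw [he]
        have h5 : (0 : ℝ) < M.disc := by exact_mod_cast hMd0
        have h6 := hu.ne_zero
        positivity
      exact_mod_cast h4
    exact Int.dvd_antisymm h3.le hMd0.le h2 h1
  obtain ⟨x, hx⟩ := h.form_self_dvd hH hk (b 0)
  obtain ⟨y, hy⟩ := h.form_self_dvd hH hk (b 1)
  obtain ⟨z, hz⟩ := h.form_dvd hH hk (b 0) (b 1)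
  have hself : ∀ i, 2 * k ∣ N.form (c i) (c i) := fun i => Int.dvd_of_forall_padicInt_dvd fun l _ => by
    obtain ⟨T, -, hTe⟩ := (hG.1 l).exists_matrix b c
    refine ⟨T 0 i ^ 2 * x + T 0 i * T 1 i * z + T 1 i ^ 2 * y, ?_⟩
    rw [hTe, hx, hy, hz]
    push_cast
    ring
  obtain ⟨A, hA⟩ := hself 0
  obtain ⟨C, hC⟩ := hself 1
  obtain ⟨B, hB⟩ : k ∣ N.form (c 0) (c 1) := Int.dvd_of_forall_padicInt_dvd fun l _ => by
    obtain ⟨T, -, hTe⟩ := (hG.1 l).exists_matrix b c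
    refine ⟨T 0 0 * T 0 1 * (2 * x) + (T 0 0 * T 1 1 + T 1 0 * T 0 1) * z + T 1 0 * T 1 1 * (2 * y), ?_⟩
    rw [hTe, hx, hy, hz]
    push_cast
    ring
  have hABC : 4 * A * C - B ^ 2 = m.d := by
    rw [hdisc, hMd, hA, hB, hC] at hdN
    have : k ^ 2 * (4 * A * C - B ^ 2) = k ^ 2 * m.d := by linarith
    exact mul_left_cancel₀ (pow_ne_zero 2 hk0.ne') this
  have hN00 : 0 < N.form (c 0) (c 0) := by
    obtain ⟨T, hT, hTe⟩ := hG.2.exists_matrix b c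
    have hM00 : 0 < M.form (b 0) (b 0) := h.isPosDef hq _ (b.ne_zero 0)
    have e := hTe 0 0
    have hM00' : (0 : ℝ) < M.form (b 0) (b 0) := by exact_mod_cast hM00
    have hD : (0 : ℝ) < (M.form (b 0) (b 0) : ℝ) * M.form (b 1) (b 1) - M.form (b 0) (b 1) ^ 2 := by
      rw [hdM] at hMd0; exact_mod_cast hMd0
    -- Completing the square in the real form shows that its value at a nonzero vector is positive.
    have e2 : (M.form (b 0) (b 0) : ℝ) * N.form (c 0) (c 0) =
        (M.form (b 0) (b 0) * T 0 0 + M.form (b 0) (b 1) * T 1 0) ^ 2 +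
          (M.form (b 0) (b 0) * M.form (b 1) (b 1) - M.form (b 0) (b 1) ^ 2) * T 1 0 ^ 2 := by
      rw [e]; ring
    have h5 : (0 : ℝ) < (M.form (b 0) (b 0) : ℝ) * N.form (c 0) (c 0) := by
      rw [e2]
      by_cases h10 : T 1 0 = 0
      · have h00 : T 0 0 ≠ 0 := by
          intro h00
          apply hT.ne_zero
          rw [Matrix.det_fin_two, h10, h00]
          ring
        rw [h10]
        have : (M.form (b 0) (b 0) : ℝ) * T 0 0 + M.form (b 0) (b 1) * 0 ≠ 0 := by
          rw [mul_zero, add_zero]; exact mul_ne_zero hM00'.ne' h00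
        positivity
      · positivity
    exact_mod_cast pos_of_mul_pos_right h5 hM00'.le
  have hA0 : 0 < A := by
    rw [hA] at hN00
    exact pos_of_mul_pos_right hN00 (by positivity)
  obtain ⟨e, he⟩ := h.exists_equiv
  -- Locally the value is `2q N(ξ)` with `ξ` the combination of `e (b 0)` and `e (b 1)` given by
  -- `T`, so `2q` times it is `N(2q ξ)`. Dividing `ν` by `2q` afterwards gives `q N(μ) = kA`.
  obtain ⟨ν, hν0, hν⟩ := m.exists_nrm_eq (r := 2 * q * N.form (c 0) (c 0))
    (mul_pos (by positivity) (by exact_mod_cast hN00)) (fun l _ _ => by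
      obtain ⟨T, -, hTe⟩ := (hG.1 l).exists_matrix b c
      have e1 : ((N.form (c 0) (c 0) : ℤ) : ℚ_[l]) = (T 0 0 : ℚ_[l]) ^ 2 * ((M.form (b 0) (b 0) : ℚ) : ℚ_[l]) +
          2 * (T 0 0 : ℚ_[l]) * (T 1 0 : ℚ_[l]) * ((M.form (b 0) (b 1) : ℚ) : ℚ_[l]) +
          (T 1 0 : ℚ_[l]) ^ 2 * ((M.form (b 1) (b 1) : ℚ) : ℚ_[l]) := by
        have := congrArg (fun t : ℤ_[l] => (t : ℚ_[l])) (hTe 0 0)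
        push_cast at this ⊢
        rw [this]
        ring
      rw [he, he, he] at e1
      refine ConicSolvable.tameSymbol_eq_one ?_ ?_ ?_
      · have := m.d_pos_rat.ne'
        exact_mod_cast neg_ne_zero.mpr this
      · have : 2 * q * N.form (c 0) (c 0) ≠ 0 := mul_ne_zero (by positivity) (by exact_mod_cast hN00.ne')
        exact_mod_cast this
      · refine ⟨2 * q * (T 0 0 * m.im (e (b 0)) + T 1 0 * m.im (e (b 1))), 1,
          2 * q * (T 0 0 * m.re (e (b 0)) + T 1 0 * m.re (e (b 1))), Or.inr (Or.inl one_ne_zero), ?_⟩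
        simp only [m.re_mul, m.re_conj, m.im_conj] at e1
        push_cast at e1 ⊢
        rw [e1]
        ring)
  have hq2 : ((2 * q : ℚ) : K) ≠ 0 := by
    have : 2 * q ≠ 0 := by positivity
    exact_mod_cast this
  obtain ⟨Λ, hΛ0, hΛ⟩ := exists_isPresented_of_gram (m := m) (q := q) c hA0 hA hB hC hABC (μ := ν * ((2 * q : ℚ) : K)⁻¹)
    (mul_ne_zero hν0 (inv_ne_zero hq2)) (by
      rw [m.nrm_mul, m.nrm_inv, m.nrm_ratCast, hν, hA]
      push_cast
      field_simp)
  refine ⟨Λ, hΛ0, hΛ, ?_⟩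
  have h1 := hΛ.disc_eq hΛ0
  have h2 := h.disc_eq hH
  rw [hdisc, h2] at h1
  have h3 := mul_right_cancel₀ m.d_pos_rat.ne' h1
  have h4 : q * FractionalIdeal.absNorm H = q * FractionalIdeal.absNorm Λ := by
    have p1 := mul_pos hq (QuadraticModel.absNorm_pos hH)
    have p2 := mul_pos hq (QuadraticModel.absNorm_pos hΛ0)
    exact (pow_left_inj₀ p1.le p2.le two_ne_zero).mp h3
  exact (mul_left_cancel₀ hq.ne' h4).symm

end GenusConverse

/-! ### The genus of the orthogonal complements -/

section MainTheorem

open NumberField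

variable {K : Type*} [Field K] [NumberField K] {m : QuadraticModel K} {a b : ℚ}

theorem FractionalIdeal.eq_of_le_of_absNorm_eq {I I' : FracIdeal K} (hI' : I' ≠ 0) (hle : I ≤ I')
    (hN : FractionalIdeal.absNorm I = FractionalIdeal.absNorm I') : I = I' := by
  have h1 : I * I'⁻¹ ≤ 1 := by
    rw [← mul_inv_cancel₀ hI']
    gcongr
  obtain ⟨A, hA⟩ := FractionalIdeal.le_one_iff_exists_coeIdeal.mp h1
  have h2 : FractionalIdeal.absNorm (A : FracIdeal K) = 1 := by
    rw [hA, map_mul, map_inv₀, hN, mul_inv_cancel₀]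
    exact (QuadraticModel.absNorm_pos hI').ne'
  rw [FractionalIdeal.coeIdeal_absNorm] at h2
  have h3 : A = ⊤ := Ideal.absNorm_eq_one_iff.mp (by exact_mod_cast h2)
  rw [h3, FractionalIdeal.coeIdeal_top] at hA
  calc I = I * I'⁻¹ * I' := by rw [mul_assoc, inv_mul_cancel₀ hI', mul_one]
    _ = I' := by rw [← hA, one_mul]

/-- A pure quaternion `x i + y j + z k` squares to `a x² + b y² - a b z²`, so a representation of
`-d` by this form is an embedding of `K`. -/
theorem exists_quatModel_of_inert (m : QuadraticModel K) {p : ℕ} (hp : p.Prime) (hin : InertCondition m.d p)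
    (hB : RamifiedExactlyAt p a b) : Nonempty (QuatModel m a b) := by
  obtain ⟨ha, hb⟩ := hB.infinite.neg
  obtain ⟨x, y, z, h⟩ := exists_representation hp m.mod_four hin ha hb fun l _ hl2 => hB.tameSymbol_eq l hl2
  obtain ⟨Q, -⟩ := exists_quatModel m hB.infinite ⟨0, x, y, z⟩ (by
    generalize -(m.d : ℚ) = d at *
    ext <;> simp <;> linarith)
  exact ⟨Q⟩

/-- The embedded maximal order attached to a decomposition `B = K + K j`. -/
noncomputable def QuatModel.embeddedMaximalOrder (Q : QuatModel m a b) {R : Subring ℍ[ℚ,a,b]} (hR : IsMaximalOrder R)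
    (hκ : ∀ x : 𝓞 K, Q.κ x ∈ R) : EmbeddedMaximalOrder K a b where
  R := R
  isMaximalOrder := hR
  ρ := (Q.κ.toRingHom.comp (algebraMap (𝓞 K) K)).codRestrict R hκ
  injective := fun x y hxy => by
    have h1 : Q.κ (x : K) = Q.κ y := congrArg Subtype.val hxy
    exact RingOfIntegers.coe_injective (Q.κ.toRingHom.injective h1)

/-- For `I = Λ J̄⁻¹` the hypothesis says `-c N(I) = p`, so `𝓞 + I j` is an order. A maximal order
above it has a coefficient ideal that contains `I` and has the same norm, hence equals `I`, and the
complement is `I J̄ = Λ`. -/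
theorem QuatModel.exists_perpLattice_isPresented (Q : QuatModel m a b) {p : ℕ} (hp : p.Prime)
    (hin : InertCondition m.d p) (hB : RamifiedExactlyAt p a b) {J : Ideal (𝓞 K)} (hJ : J ≠ ⊥) {Λ : FracIdeal K}
    (hΛ : Λ ≠ 0) (hN : -Q.c * FractionalIdeal.absNorm Λ = p * Ideal.absNorm J) :
    ∃ P : EmbeddedMaximalOrder K a b, IsPresented m (P.perpLattice hB.infinite J) Λ (-Q.c) := by
  have hJF : ((m.conjIdeal J : Ideal (𝓞 K)) : FracIdeal K) ≠ 0 := by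
    rw [Ne, FractionalIdeal.coeIdeal_eq_zero]; exact m.conjIdeal_ne_bot hJ
  have hNJ : (Ideal.absNorm J : ℚ) ≠ 0 := by exact_mod_cast (Ideal.absNorm_eq_zero_iff.not.mpr hJ)
  set I := Λ * (m.conjIdeal J : FracIdeal K)⁻¹ with hI
  have hI0 : I ≠ 0 := mul_ne_zero hΛ (inv_ne_zero hJF)
  have hIN : -Q.c * FractionalIdeal.absNorm I = p := by
    rw [hI, map_mul, map_inv₀, FractionalIdeal.coeIdeal_absNorm, (m.mul_conjIdeal J hJ).2, ← mul_assoc, hN,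
      mul_inv_cancel_right₀ hNJ]
  obtain ⟨R, hR, hκ, hle⟩ := Q.exists_isMaximalOrder hB.left_ne_zero hB.right_ne_zero hI0 (t := p)
    (by rw [hIN]; simp)
  have hRN := Q.absNorm_coeffIdeal hp hin hB hR hκ
  have heq := FractionalIdeal.eq_of_le_of_absNorm_eq (Q.coeffIdeal_ne_zero hR.prop hκ) hle
    (mul_left_cancel₀ (neg_ne_zero.mpr Q.c_neg.ne) (hIN.trans hRN.symm))
  refine ⟨Q.embeddedMaximalOrder hR hκ, ?_⟩
  have h1 := (Q.embeddedMaximalOrder hR hκ).isPresented_perpLattice hB.infinite Q (fun _ => rfl) hκ hJ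
  have h2 : Q.coeffIdeal (Q.embeddedMaximalOrder hR hκ).isOrder hκ * (m.conjIdeal J : FracIdeal K) = Λ := by
    change Q.coeffIdeal hR.prop hκ * (m.conjIdeal J : FracIdeal K) = Λ
    rw [← heq, hI, mul_assoc, inv_mul_cancel₀ hJF, mul_one]
  rwa [h2] at h1

theorem EmbeddedMaximalOrder.exists_isPresented (P : EmbeddedMaximalOrder K a b) (m : QuadraticModel K) {p : ℕ}
    (hp : p.Prime) (hin : InertCondition m.d p) (hB : RamifiedExactlyAt p a b) {J : Ideal (𝓞 K)} (hJ : J ≠ ⊥) :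
    ∃ (Q : QuatModel m a b) (H : FracIdeal K), H ≠ 0 ∧
      IsPresented m (P.perpLattice hB.infinite J) H (-Q.c) ∧
      -Q.c * FractionalIdeal.absNorm H = p * Ideal.absNorm J := by
  obtain ⟨Q, hQ⟩ := P.exists_quatModel hB.infinite m
  have hκ : ∀ x : 𝓞 K, Q.κ x ∈ P.R := fun x => by rw [hQ]; exact (P.ρ x).2
  have hJF : ((m.conjIdeal J : Ideal (𝓞 K)) : FracIdeal K) ≠ 0 := by
    rw [Ne, FractionalIdeal.coeIdeal_eq_zero]; exact m.conjIdeal_ne_bot hJ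
  refine ⟨Q, _, mul_ne_zero (Q.coeffIdeal_ne_zero P.isOrder hκ) hJF,
    P.isPresented_perpLattice hB.infinite Q hQ hκ hJ, ?_⟩
  rw [map_mul, ← mul_assoc, FractionalIdeal.coeIdeal_absNorm, (m.mul_conjIdeal J hJ).2]
  rw [show -Q.c * FractionalIdeal.absNorm (Q.coeffIdeal P.isOrder hκ) = p from
    Q.absNorm_coeffIdeal hp hin hB P.isMaximalOrder hκ]

/-- The constants `c` of two decompositions differ by a norm from `K`. -/
theorem QuatModel.exists_nrm_eq_div {p : ℕ} (hB : RamifiedExactlyAt p a b) (Q Q' : QuatModel m a b) :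
    ∃ μ : K, μ ≠ 0 ∧ m.nrm μ = Q.c / Q'.c := by
  have hc := Q.c_neg
  have hc' := Q'.c_neg
  -- At each odd prime `c` and `c'` have the same symbol with `-d`, determined by the ramification
  -- of `B`, so `c c'` has trivial symbols and is a norm.
  obtain ⟨μ, hμ, h⟩ := m.exists_nrm_eq (mul_pos_of_neg_of_neg hc hc') (fun l _ hl2 => by
    have h1 := (Q.ramifiedExactlyAt hB).tameSymbol_eq l hl2
    have h2 := (Q'.ramifiedExactlyAt hB).tameSymbol_eq l hl2
    have e1 : (Q.c : ℚ_[l]) ≠ 0 := by exact_mod_cast hc.ne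
    have e2 : (Q'.c : ℚ_[l]) ≠ 0 := by exact_mod_cast hc'.ne
    rw [Rat.cast_mul, tameSymbol_mul_right _ e1 e2, h1, h2]
    split_ifs <;> simp)
  have hcK : (Q'.c : K) ≠ 0 := by exact_mod_cast hc'.ne
  refine ⟨μ * (Q'.c : K)⁻¹, mul_ne_zero hμ (inv_ne_zero hcK), ?_⟩
  rw [m.nrm_mul, m.nrm_inv, m.nrm_ratCast, h]
  field_simp

end MainTheorem

theorem mainTheorem5 (K : Type*) [Field K] [NumberField K]
    (hK : Module.finrank ℚ K = 2) (hD : NumberField.discr K < 0)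
    (hodd : Odd (NumberField.discr K))
    (p : ℕ) (hp : p.Prime) (hinert : (Ideal.span {(p : 𝓞 K)}).IsPrime)
    (a b : ℚ) (hB : RamifiedExactlyAt p a b)
    (J : Ideal (𝓞 K)) (hJ : J ≠ ⊥)
    (hJD : IsCoprime (Ideal.absNorm J : ℤ) (NumberField.discr K)) :
    {c : LatticeClass | ∃ P : EmbeddedMaximalOrder K a b, c = (P.perpLattice hB.infinite J).cls} ⊆
        evenPosLatticeClasses 2 (-((p : ℤ) ^ 2 * (Ideal.absNorm J : ℤ) ^ 2 * NumberField.discr K)) ∧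
      IsGenus {c : LatticeClass |
        ∃ P : EmbeddedMaximalOrder K a b, c = (P.perpLattice hB.infinite J).cls} := by
  obtain ⟨m⟩ := exists_quadraticModel hK hD hodd
  have hin := m.inertCondition_of_isPrime hp hinert
  have hJ0 : (Ideal.absNorm J : ℚ) ≠ 0 := by exact_mod_cast (Ideal.absNorm_eq_zero_iff.not.mpr hJ)
  constructor
  · rintro _ ⟨P, rfl⟩
    obtain ⟨Q, H, hH, hP, hN⟩ := P.exists_isPresented m hp hin hB hJ
    have hq : 0 < -Q.c := neg_pos.mpr Q.c_neg
    have hk : -Q.c * FractionalIdeal.absNorm H = ((p * Ideal.absNorm J : ℤ) : ℚ) := by rw [hN]; push_cast; rfl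
    refine ⟨_, rfl, hP.rank_eq hH, ?_, hP.isEven hH hk, hP.isPosDef hq⟩
    have h1 := hP.disc_eq hH
    rw [hN] at h1
    rw [m.discr_eq, ← Int.cast_inj (α := ℚ), h1]
    push_cast
    ring
  · obtain ⟨Q₀⟩ := exists_quatModel_of_inert m hp hin hB
    obtain ⟨P₀, -⟩ : ∃ P : EmbeddedMaximalOrder K a b, True := by
      -- Any nonzero ideal with `-c N(I)` integral will do; the principal ideal of the denominator
      -- of `c` is one.
      obtain ⟨R, hR, hκ, -⟩ := Q₀.exists_isMaximalOrder hB.left_ne_zero hB.right_ne_zero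
        (I := FractionalIdeal.spanSingleton _ (Q₀.c.den : K)) (t := -(Q₀.c.num * Q₀.c.den))
        (by
          rw [Ne, FractionalIdeal.spanSingleton_eq_zero_iff]
          exact_mod_cast Q₀.c.den_nz)
        (by
          rw [m.absNorm_spanSingleton, m.nrm_natCast]
          push_cast
          rw [← Rat.mul_den_eq_num Q₀.c]
          ring)
      exact ⟨Q₀.embeddedMaximalOrder hR hκ, trivial⟩
    obtain ⟨Q, H, hH, hP, hN⟩ := P₀.exists_isPresented m hp hin hB hJ
    have hq : 0 < -Q.c := neg_pos.mpr Q.c_neg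
    have hk : -Q.c * FractionalIdeal.absNorm H = ((p * Ideal.absNorm J : ℤ) : ℚ) := by rw [hN]; push_cast; rfl
    refine ⟨P₀.perpLattice hB.infinite J, Set.ext fun x => ⟨?_, ?_⟩⟩
    · rintro ⟨P, rfl⟩
      refine ⟨_, rfl, ?_⟩
      obtain ⟨Q', H', hH', hP', hN'⟩ := P.exists_isPresented m hp hin hB hJ
      -- Scaling by `μ` replaces the constant of the second decomposition by that of the first; both
      -- ideals then have norm `p N(J) / q`.
      obtain ⟨μ, hμ, hμn⟩ := QuatModel.exists_nrm_eq_div hB Q' Q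
      have h1 := hP'.rescale hμ
      have hc := Q.c_neg.ne
      have hc' := Q'.c_neg.ne
      rw [hμn, show -Q'.c / (Q'.c / Q.c) = -Q.c by field_simp] at h1
      have hμ0 : FractionalIdeal.spanSingleton (nonZeroDivisors (𝓞 K)) μ ≠ 0 := by
        rwa [Ne, FractionalIdeal.spanSingleton_eq_zero_iff]
      refine hP.sameGenus h1 hH (mul_ne_zero hμ0 hH') ?_
      rw [m.absNorm_span_mul, hμn]
      apply mul_left_cancel₀ (neg_ne_zero.mpr hc)
      rw [hN, ← hN']
      field_simp
    · rintro ⟨N, rfl, hG⟩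
      -- The lattice is an ideal with the same `q` and the same norm as `H`, and every such ideal
      -- occurs for the fixed decomposition `Q`.
      obtain ⟨Λ, hΛ0, hΛ, hΛN⟩ := hP.of_sameGenus hH hq hk hG
      obtain ⟨P, hPΛ⟩ := Q.exists_perpLattice_isPresented hp hin hB hJ hΛ0 (by rw [hΛN, hN])
      exact ⟨P, Quotient.sound (hΛ.iso hPΛ)⟩
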